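/- **Setting.** Let $\mathcal D$ be the set of Dirichlet series $\sum_{n\ge1}a_nn^{-s}$ that converge on some half-plane $\{\operatorname{Re}s>\theta\}$, $\theta\in\mathbb R$, and let $\mathcal P$ be the set of Dirichlet polynomials. For $P(s)=\sum_{n\le N}a_nn^{-s}\in\mathcal P$ and $\sigma\ge0$ put $P_\sigma(s)=P(s+\sigma)$ and let $\mathscr BP(z)=\sum_{n\le N}a_n\prod_j z_j^{\nu_j(n)}$ be its Bohr lift, where $n=\prod_j p_j^{\nu_j(n)}$ and $p_j$ is the $j$-th prime. Let $m_\infty$ be the Haar probability measure on the countably infinite torus $\mathbb T^\infty$, and for $\alpha>-1$ let $d\mu_\alpha(\sigma)=\frac{2^{\alpha+1}}{\Gamma(\alpha+1)}\sigma^\alpha e^{-2\sigma}\,d\sigma$ on $(0,\infty)$. For $0<p<\infty$ and $0<q<\infty$ set $$\|P\|_{\mathcal H^p}=\Big(\int_{\mathbb T^\infty}|\mathscr BP|^p\,dm_\infty\Big)^{1/p},\qquad \|P\|_{\mathcal H^{p,q}_\alpha}=\Big(\int_0^\infty\|P_\sigma\|_{\mathcal H^p}^q\,d\mu_\alpha(\sigma)\Big)^{1/q},\qquad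 \|P\|_{\mathcal H^{p,\infty}_\alpha}=\|P\|_{\mathcal H^p}.$$ The spaces $\mathcal H^p$, $\mathcal H^{p,q}_\alpha$ and $\mathcal A^p_\alpha$ are the completions of $\mathcal P$ under $\|\cdot\|_{\mathcal H^p}$, $\|\cdot\|_{\mathcal H^{p,q}_\alpha}$ and $\|\cdot\|_{\mathcal A^p_\alpha}:=\|\cdot\|_{\mathcal H^{p,p}_\alpha}$ respectively, so that $\mathcal H^{p,\infty}_\alpha=\mathcal H^p$; their elements are identified with Dirichlet series (the coefficients being the limits of the coefficients of an approximating Cauchy sequence of polynomials). Moreover $\mathcal H^2=\{\sum a_nn^{-s}:\sum|a_n|^2<\infty\}$. The norm of a Dirichlet series outside the space is understood to be $\infty$. A standard random sequence $\{X_n\}_{n\ge1}$ is a sequence of independent random variables on a probability space $(\Omega,\Sigma,\mathbb P)$ that are all Bernoulli ($\mathbb P(X_n=\pm1)=\tfrac12$), or all Steinhaus (uniform on the unit circle), or all real Gaussian $N(0,1)$. For $f(s)=\sum a_nn^{-s}\in\mathcal D$ let $\mathcal Rf(s)=\sum a_nX_nn^{-s}$, and for a set $\mathscr X$ of Dirichlet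 series let $\mathscr X_\star=\{f\in\mathcal D:\mathcal Rf\in\mathscr X\text{ almost surely}\}$. **Theorem.** Let $0<p<\infty$, $0<q\le\infty$, $\alpha>-1$, and let $\{X_n\}$ be a standard random sequence. For every $f(s)=\sum_{n\ge1}a_nn^{-s}\in\mathcal D$ the following are equivalent: (a) $\mathcal Rf\in\mathcal H^{p,q}_\alpha$ almost surely; (b) $\sup_{N\ge1}\big\|\sum_{n=1}^Na_nX_nn^{-s}\big\|_{\mathcal H^{p,q}_\alpha}<\infty$ almost surely; (c) $\mathbb E\big(\|\mathcal Rf\|^t_{\mathcal H^{p,q}_\alpha}\big)<\infty$ for some $t>0$; (d) $\mathbb E\big(\|\mathcal Rf\|^t_{\mathcal H^{p,q}_\alpha}\big)<\infty$ for every $t>0$; (e) $\mathbb E\big(\exp(\lambda\|\mathcal Rf\|^r_{\mathcal H^{p,q}_\alpha})\big)<\infty$ for some $\lambda>0$, where $r=\min\{p,q,1\}$; (f) $f\in\mathcal H^{2,q}_\alpha$. Hence $(\mathcal H^{p,q}_\alpha)_\star=\mathcal H^{2,q}_\alpha$. In particular $(\mathcal H^p)_\star=\mathcal H^2$ and $(\mathcal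 A^p_\alpha)_\star=\mathcal H^{2,p}_\alpha$. -/

import Mathlib

open MeasureTheory ProbabilityTheory Filter Topology
open scoped ENNReal NNReal

noncomputable section

namespace RandomDirichlet

/-! ### Dirichlet series

A Dirichlet series `∑_{n ≥ 1} a n * n ^ (-s)` is given by its coefficient sequence `a : ℕ+ → ℂ`,
and a Dirichlet polynomial by a finitely supported coefficient sequence `P : ℕ+ →₀ ℂ`. -/

/-- The set of Dirichlet series that converge on some half plane `{s | θ < Re s}`, `θ` real. -/
def dirichletSeries : Set (ℕ+ → ℂ) :=
  {a | ∃ θ : ℝ, ∀ s : ℂ, θ < s.re → ∃ l : ℂ,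
    Tendsto (fun N : ℕ+ => ∑ n ∈ Finset.Icc 1 N, a n * ((n : ℕ) : ℂ) ^ (-s)) atTop (𝓝 l)}

/-- The partial sum `∑_{n=1}^N a n * n ^ (-s)`, a Dirichlet polynomial. -/
def partialSum (N : ℕ+) (a : ℕ+ → ℂ) : ℕ+ →₀ ℂ :=
  ∑ n ∈ Finset.Icc 1 N, Finsupp.single n (a n)

/-- The horizontal translate `P_σ(s) = P(s + σ)`, whose coefficients are `P n * n ^ (-σ)`. -/
def translate (σ : ℝ) (P : ℕ+ →₀ ℂ) : ℕ+ →₀ ℂ :=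
  Finsupp.onFinset P.support (fun n => P n * (((n : ℝ) ^ (-σ) : ℝ) : ℂ)) (fun n hn => by
    rw [Finsupp.mem_support_iff]
    exact left_ne_zero_of_mul hn)

/-! ### The infinite torus and the Bohr lift -/

/-- The uniform probability measure on the unit circle, as a measure on `ℂ`. -/
def circleLaw : Measure ℂ :=
  (AddCircle.haarAddCircle (T := 1)).map (fun t : UnitAddCircle => (AddCircle.toCircle t : ℂ))

instance : IsProbabilityMeasure circleLaw :=
  Measure.isProbabilityMeasure_map
    (continuous_subtype_val.comp AddCircle.continuous_toCircle).measurable.aemeasurable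

/-- The Haar probability measure `m_∞` of the countably infinite torus, i.e. the product of the
uniform measures on the circles; the coordinates are indexed by the primes. -/
def torusMeasure : Measure (Nat.Primes → ℂ) :=
  Measure.infinitePi (fun _ => circleLaw)

/-- The monomial `z ^ ν(n) = ∏_p z_p ^ ν_p(n)`, where `n = ∏_p p ^ ν_p(n)`. -/
def bohrMonomial (n : ℕ+) (z : Nat.Primes → ℂ) : ℂ :=
  ∏ᶠ p : Nat.Primes, z p ^ (n : ℕ).factorization p

/-- The Bohr lift of a Dirichlet polynomial. -/
def bohrLift (P : ℕ+ →₀ ℂ) (z : Nat.Primes → ℂ) : ℂ :=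
  P.sum fun n c => c * bohrMonomial n z

/-! ### The (quasi-)norms on Dirichlet polynomials -/

/-- `‖P‖_{H^p} = (∫ |𝓑P|^p dm_∞)^{1/p}`. -/
def hardyPolyNorm (p : ℝ) (P : ℕ+ →₀ ℂ) : ℝ≥0∞ :=
  (∫⁻ z, ‖bohrLift P z‖ₑ ^ p ∂torusMeasure) ^ (1 / p)

/-- The measure `dμ_α(σ) = 2^{α+1} / Γ(α+1) * σ^α * e^{-2σ} dσ` on `(0, ∞)`. -/
def muMeasure (α : ℝ) : Measure ℝ :=
  (volume.restrict (Set.Ioi 0)).withDensity fun σ =>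
    ENNReal.ofReal (2 ^ (α + 1) / Real.Gamma (α + 1) * σ ^ α * Real.exp (-2 * σ))

/-- `‖P‖_{A^p_α} = (∫_0^∞ ‖P_σ‖_{H^p}^p dμ_α(σ))^{1/p}`. -/
def bergmanPolyNorm (p α : ℝ) (P : ℕ+ →₀ ℂ) : ℝ≥0∞ :=
  (∫⁻ σ, hardyPolyNorm p (translate σ P) ^ p ∂muMeasure α) ^ (1 / p)

open Classical in
/-- `‖P‖_{H^{p,q}_α} = (∫_0^∞ ‖P_σ‖_{H^p}^q dμ_α(σ))^{1/q}` for `q < ∞`, and the norm of `H^p`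
for `q = ∞`. -/
def mixedPolyNorm (p : ℝ) (q : ℝ≥0∞) (α : ℝ) (P : ℕ+ →₀ ℂ) : ℝ≥0∞ :=
  if q = ⊤ then hardyPolyNorm p P
  else (∫⁻ σ, hardyPolyNorm p (translate σ P) ^ q.toReal ∂muMeasure α) ^ (1 / q.toReal)

/-! ### Completions

An element of the completion of the Dirichlet polynomials under a (quasi-)norm `ν` is represented
by a Cauchy sequence of polynomials. It is identified with the Dirichlet series whose coefficients
are the limits of the coefficients of these polynomials, and its norm is the limit of their
norms. -/

/-- `P` is a Cauchy sequence for `ν` whose coefficients converge to those of the series `a`. -/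
def Represents (ν : (ℕ+ →₀ ℂ) → ℝ≥0∞) (P : ℕ → ℕ+ →₀ ℂ) (a : ℕ+ → ℂ) : Prop :=
  (∀ ε : ℝ≥0∞, 0 < ε → ∃ K : ℕ, ∀ j ≥ K, ∀ k ≥ K, ν (P j - P k) < ε) ∧
    ∀ n : ℕ+, Tendsto (fun j => P j n) atTop (𝓝 (a n))

/-- The completion of the Dirichlet polynomials under `ν`, as a set of Dirichlet series. -/
def completionSpace (ν : (ℕ+ →₀ ℂ) → ℝ≥0∞) : Set (ℕ+ → ℂ) :=
  {a | ∃ P : ℕ → ℕ+ →₀ ℂ, Represents ν P a}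

/-- The (quasi-)norm of the completion; it is `∞` on series outside the completion. -/
def completionNorm (ν : (ℕ+ →₀ ℂ) → ℝ≥0∞) (a : ℕ+ → ℂ) : ℝ≥0∞ :=
  ⨅ (P : ℕ → ℕ+ →₀ ℂ) (_ : Represents ν P a), limsup (fun j => ν (P j)) atTop

/-- The Hardy space `H^2` of Dirichlet series with square summable coefficients. -/
def hardyTwo : Set (ℕ+ → ℂ) := {a | Summable fun n => ‖a n‖ ^ 2}

/-- The Hardy space `H^p`. -/
def hardySpace (p : ℝ) : Set (ℕ+ → ℂ) := completionSpace (hardyPolyNorm p)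

/-- The Bergman space `A^p_α`. -/
def bergmanSpace (p α : ℝ) : Set (ℕ+ → ℂ) := completionSpace (bergmanPolyNorm p α)

/-- The mixed norm space `H^{p,q}_α`. -/
def mixedSpace (p : ℝ) (q : ℝ≥0∞) (α : ℝ) : Set (ℕ+ → ℂ) :=
  completionSpace (mixedPolyNorm p q α)

/-- The (quasi-)norm of `H^{p,q}_α`; it is `∞` on series outside `H^{p,q}_α`. -/
def mixedNorm (p : ℝ) (q : ℝ≥0∞) (α : ℝ) (a : ℕ+ → ℂ) : ℝ≥0∞ :=
  completionNorm (mixedPolyNorm p q α) a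

/-! ### Randomization -/

/-- The law on `ℂ` of a Bernoulli variable: the values `1` and `-1` with probability `1/2` each. -/
def bernoulliLaw : Measure ℂ :=
  (1 / 2 : ℝ≥0∞) • Measure.dirac 1 + (1 / 2 : ℝ≥0∞) • Measure.dirac (-1)

/-- The law of a real standard Gaussian variable, as a measure on `ℂ`. -/
def gaussianLaw : Measure ℂ := (gaussianReal 0 1).map (fun x : ℝ => (x : ℂ))

/-- `X` is a standard Bernoulli, Steinhaus or Gaussian sequence: its members are independent and
all have the Bernoulli law, or all the Steinhaus law, or all the law `N(0,1)`. -/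
structure IsStandardRandomSequence {Ω : Type*} [MeasurableSpace Ω] (X : ℕ+ → Ω → ℂ)
    (μ : Measure Ω) : Prop where
  measurable : ∀ n, Measurable (X n)
  indep : iIndepFun X μ
  law : (∀ n, μ.map (X n) = bernoulliLaw) ∨ (∀ n, μ.map (X n) = circleLaw) ∨
    (∀ n, μ.map (X n) = gaussianLaw)

/-- The randomization `𝓡f = ∑ a n * X n * n ^ (-s)` of `f = ∑ a n * n ^ (-s)`, at `ω`. -/
def randomize {Ω : Type*} (X : ℕ+ → Ω → ℂ) (a : ℕ+ → ℂ) (ω : Ω) : ℕ+ → ℂ :=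
  fun n => a n * X n ω

/-- The symbol space `𝒳_⋆` of all convergent Dirichlet series `f` with `𝓡f ∈ 𝒳` almost surely. -/
def symbolSpace {Ω : Type*} [MeasurableSpace Ω] (X : ℕ+ → Ω → ℂ) (μ : Measure Ω)
    (𝒳 : Set (ℕ+ → ℂ)) : Set (ℕ+ → ℂ) :=
  {a | a ∈ dirichletSeries ∧ ∀ᵐ ω ∂μ, randomize X a ω ∈ 𝒳}

end RandomDirichlet

end

noncomputable section

namespace RandomDirichlet

/-! ### The circle -/

/-! Fix `σ` and a point `z` of the torus. The Bohr lift at `z` of the translated random polynomial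
is the random sum `∑ a_n n^{-σ} z^{ν(n)} X_n`. Its monomials are unimodular, so its variance `∑
|a_n|² n^{-2σ}` is the square of the `H²` norm of the translate of the original polynomial and does
not depend on `z`. Every `L^p` mean of such a sum is comparable with its standard deviation.
Averaging over the torus with any exponent `p` therefore produces the `H²` norm, and only the outer
exponent `q` survives.

To make this quantitative, put `W(σ) = ‖P_σ‖_{H²}`, divide the lift by `W`, and move the weight
`W^q` into a probability measure on the half line times the torus. Exponents are comparable on a
probability space, so the mixed norm of the random polynomial lies between `‖P‖_{H^{2,q}}` times an
`L^u` mean and `‖P‖_{H^{2,q}}` times an `L^t` mean of the normalized lift, with `u ≤ min(p,q)` and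
`t ≥ max(p,q)`. Sub-Gaussian tails bound the `k`-th moment of the normalized lift by a constant
times `k!`, uniformly in `(σ,z)`; a Paley-Zygmund argument makes it at least `1/2` with a fixed
probability. Fubini transfers both facts to the norm: `lintegral_mixNorm_pow_le` and
`lowerConst_le_measure`.

Starting from (f), the partial sums of `f` are Cauchy in `H^{2,q}`. The moment bound makes some
sequence of partial sums of the randomization almost surely Cauchy, Ottaviani's inequality bounds
all partial sums, and Fatou's lemma carries the factorial moment bounds to the limit, which gives
all moments and exponential integrability.

Conversely, an almost sure bound on finite approximations of the randomization bounds the same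
approximations of `f` in `H^{2,q}`, because the lower estimate holds with a fixed positive
probability; no zero-one law is needed, and Fatou's lemma gives (f). For (b) the approximations are
the partial sums. For (a) and (c) they must be controlled by the norm of the limit, and partial sums
are not uniformly bounded operators on `H^p` when `p ≤ 1`. They are replaced by finitely supported
multipliers tending to `1` and uniformly bounded on `H^p` (`exists_isTorusMultiplier_tendsto_one`).
These are built prime by prime from truncated dilations of the disc, and dilations are contractive
because `|F|^p` is subharmonic.

The norm of the completion is never shown to be measurable in `ω`. It is squeezed between measurable
quantities: from below, up to a constant, the supremum of the multiplied polynomials; from above a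
lower limit of norms of partial sums. -/

lemma measurable_toCircle : Measurable (fun t : UnitAddCircle => (AddCircle.toCircle t : ℂ)) :=
  (continuous_subtype_val.comp AddCircle.continuous_toCircle).measurable

lemma ae_norm_eq_one_circleLaw : ∀ᵐ z ∂circleLaw, ‖z‖ = 1 := by
  rw [circleLaw, ae_map_iff measurable_toCircle.aemeasurable
    (measurableSet_eq_fun measurable_norm measurable_const)]
  exact Eventually.of_forall fun t => Circle.norm_coe _

lemma exists_toCircle_eq {u : ℂ} (hu : ‖u‖ = 1) :
    ∃ s : UnitAddCircle, (AddCircle.toCircle s : ℂ) = u := by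
  obtain ⟨s, hs⟩ := (AddCircle.homeomorphCircle (T := 1) one_ne_zero).surjective
    ⟨u, by simpa [Submonoid.unitSphere] using hu⟩
  refine ⟨s, ?_⟩
  rw [AddCircle.homeomorphCircle_apply] at hs
  rw [hs]

lemma measurePreserving_mul_circleLaw {u : ℂ} (hu : ‖u‖ = 1) :
    MeasurePreserving (fun z => u * z) circleLaw circleLaw := by
  obtain ⟨s, rfl⟩ := exists_toCircle_eq hu
  refine ⟨measurable_const_mul _, ?_⟩
  rw [circleLaw, Measure.map_map (measurable_const_mul _) measurable_toCircle]
  have : ((fun z => (AddCircle.toCircle s : ℂ) * z) ∘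
      fun t : UnitAddCircle => (AddCircle.toCircle t : ℂ)) =
      (fun t : UnitAddCircle => (AddCircle.toCircle t : ℂ)) ∘ (fun t => s + t) := by
    ext t; simp [AddCircle.toCircle_add]
  rw [this, ← Measure.map_map measurable_toCircle (measurable_const_add s),
    (measurePreserving_add_left _ s).map_eq]

/-- Links the probability law on the circle with contour averages, so that the mean value property
and Cauchy's formula become statements about `circleLaw`. -/
lemma integral_circleLaw {f : ℂ → ℂ} (hf : ContinuousOn f (Metric.sphere 0 1)) :
    ∫ z, f z ∂circleLaw = Real.circleAverage f 0 1 := by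
  have hm : AEStronglyMeasurable f circleLaw := by
    have h := hf.aestronglyMeasurable (μ := circleLaw) Metric.isClosed_sphere.measurableSet
    rwa [Measure.restrict_eq_self_of_ae_mem] at h
    filter_upwards [ae_norm_eq_one_circleLaw] with z hz using by simpa using hz
  rw [circleLaw, integral_map measurable_toCircle.aemeasurable hm]
  have hv : (AddCircle.haarAddCircle : Measure UnitAddCircle) = volume := by
    rw [AddCircle.volume_eq_smul_haarAddCircle]; simp
  rw [hv, ← AddCircle.intervalIntegral_preimage 1 0, Real.circleAverage_def]
  have h2 := intervalIntegral.smul_integral_comp_mul_left (a := 0) (b := 1)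
    (fun θ : ℝ => f (circleMap 0 1 θ)) (2 * Real.pi)
  rw [mul_zero, mul_one] at h2
  rw [← h2, smul_smul, inv_mul_cancel₀ (by positivity), one_smul, zero_add]
  congr 1 with t
  congr 1
  rw [AddCircle.toCircle_apply_mk, Circle.coe_exp]
  simp [circleMap]

lemma enorm_circleAverage_le {f : ℂ → ℂ} (hf : ContinuousOn f (Metric.sphere 0 1)) :
    ‖Real.circleAverage f 0 1‖ₑ ≤ ∫⁻ z, ‖f z‖ₑ ∂circleLaw := by
  rw [← integral_circleLaw hf]
  exact enorm_integral_le_lintegral_enorm _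

/-! ### Analytic majorants of powers of polynomials -/

/-- The difference of the squares is `|1 - āw|² - |w - a|² = (1 - |a|²)(1 - |w|²)`. -/
lemma norm_sub_le_norm_one_sub_mul {a w : ℂ} (ha : ‖a‖ ≤ 1) (hw : ‖w‖ ≤ 1) :
    ‖w - a‖ ≤ ‖1 - (starRingEnd ℂ) a * w‖ := by
  have h1 : ‖w‖ ^ 2 ≤ 1 := pow_le_one₀ (norm_nonneg _) hw
  have h2 : ‖a‖ ^ 2 ≤ 1 := pow_le_one₀ (norm_nonneg _) ha
  refine le_of_sq_le_sq ?_ (norm_nonneg _)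
  have := mul_nonneg (sub_nonneg.2 h1) (sub_nonneg.2 h2)
  rw [Complex.sq_norm, Complex.normSq_apply] at *
  rw [Complex.sq_norm, Complex.normSq_apply] at *
  simp at *
  nlinarith

lemma norm_sub_eq_norm_one_sub_mul {a w : ℂ} (hw : ‖w‖ = 1) :
    ‖w - a‖ = ‖1 - (starRingEnd ℂ) a * w‖ := by
  have h : 1 - (starRingEnd ℂ) a * w = (starRingEnd ℂ) (w - a) * w := by
    rw [map_sub, sub_mul, Complex.conj_mul', hw]; simp
  rw [h, norm_mul, hw, mul_one, RCLike.norm_conj]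

/-- The base has positive real part inside the disc, where the principal power is analytic. On the
boundary the real part may vanish together with the base, and there continuity of the power requires
`p > 0`. -/
lemma diffContOnCl_one_sub_mul_cpow {p : ℝ} (hp : 0 < p) {b : ℂ} (hb : ‖b‖ ≤ 1) :
    DiffContOnCl ℂ (fun w => (1 - b * w) ^ (p : ℂ)) (Metric.ball 0 1) := by
  have hre : ∀ w : ℂ, (b * w).re ≤ ‖b‖ * ‖w‖ := fun w =>
    (Complex.re_le_norm _).trans (norm_mul_le _ _)
  refine ⟨fun w hw => ?_, fun w hw => ?_⟩
  · have : 0 < (1 - b * w).re := by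
      have := hre w
      have hw' : ‖w‖ < 1 := by simpa using hw
      have : ‖b‖ * ‖w‖ < 1 := by nlinarith [norm_nonneg b, norm_nonneg w]
      simp only [Complex.sub_re, Complex.one_re]; linarith
    refine DifferentiableAt.differentiableWithinAt ?_
    exact (by fun_prop : DifferentiableAt ℂ (fun w => 1 - b * w) w).cpow_const (Or.inl this)
  · have : 0 ≤ (1 - b * w).re := by
      have := hre w
      have hw' : ‖w‖ ≤ 1 := by
        simpa using Metric.closure_ball_subset_closedBall hw
      have : ‖b‖ * ‖w‖ ≤ 1 := mul_le_one₀ hb (norm_nonneg _) hw'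
      simp only [Complex.sub_re, Complex.one_re]; linarith
    refine ContinuousAt.continuousWithinAt ?_
    exact ContinuousAt.comp (f := fun w => 1 - b * w) (g := fun z => z ^ (p : ℂ))
      (Complex.continuousAt_cpow_const_of_re_pos (Or.inl this) (by simpa)) (by fun_prop)

/-- A power `|F|^p` of the modulus of a polynomial is dominated on the disc by the modulus of an
analytic function which agrees with it on the unit circle. -/
lemma exists_analytic_majorant {p : ℝ} (hp : 0 < p) (F : Polynomial ℂ) :
    ∃ H : ℂ → ℂ, DiffContOnCl ℂ H (Metric.ball 0 1) ∧
      (∀ w, ‖w‖ ≤ 1 → ‖F.eval w‖ ^ p ≤ ‖H w‖) ∧ ∀ w, ‖w‖ = 1 → ‖F.eval w‖ ^ p = ‖H w‖ := by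
  have hF : F.Splits := IsAlgClosed.splits F
  induction hF using Submonoid.closure_induction with
  | mem F hF =>
    rcases hF with ⟨a, rfl⟩ | ⟨a, rfl⟩
    · refine ⟨fun _ => a ^ (p : ℂ), diffContOnCl_const, fun w _ => ?_, fun w _ => ?_⟩ <;>
        simp [Complex.norm_cpow_real]
    -- A zero `-a` in the closed disc is reflected: `w + a` is replaced by `1 + āw`, which has the
    -- same modulus on the circle, a larger one inside, and nonnegative real part. A zero outside
    -- needs no change beyond extracting the factor `a`.
    · rcases le_or_gt ‖a‖ 1 with ha | ha
      · refine ⟨_, diffContOnCl_one_sub_mul_cpow hp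
          (b := (starRingEnd ℂ) (-a)) (by simpa using ha), fun w hw => ?_, fun w hw => ?_⟩
        · rw [Complex.norm_cpow_real]
          have := norm_sub_le_norm_one_sub_mul (a := -a) (by simpa using ha) hw
          simp only [Polynomial.eval_add, Polynomial.eval_X, Polynomial.eval_C]
          rw [sub_neg_eq_add] at this
          gcongr
        · rw [Complex.norm_cpow_real, ← norm_sub_eq_norm_one_sub_mul hw]
          simp
      · have ha0 : a ≠ 0 := by rintro rfl; simp at ha; linarith
        have key : ∀ w, ‖(Polynomial.X + Polynomial.C a).eval w‖ ^ p =
            ‖a ^ (p : ℂ) • (1 - (-a⁻¹) * w) ^ (p : ℂ)‖ := fun w => by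
          rw [norm_smul, Complex.norm_cpow_real, Complex.norm_cpow_real,
            ← Real.mul_rpow (norm_nonneg _) (norm_nonneg _), ← norm_mul]
          congr 2
          simp; field_simp; ring
        exact ⟨_, (diffContOnCl_one_sub_mul_cpow hp (b := -a⁻¹) (by
          rw [norm_neg, norm_inv]; exact inv_le_one_of_one_le₀ ha.le)).const_smul (a ^ (p : ℂ)),
          fun w _ => (key w).le, fun w _ => key w⟩
  | one => exact ⟨fun _ => 1, diffContOnCl_const, by simp, by simp⟩
  | mul F G _ _ hF hG =>
    obtain ⟨H, h1, h2, h3⟩ := hF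
    obtain ⟨K, k1, k2, k3⟩ := hG
    refine ⟨_, h1.smul k1, fun w hw => ?_, fun w hw => ?_⟩
    · rw [norm_smul, Polynomial.eval_mul, norm_mul, Real.mul_rpow (norm_nonneg _) (norm_nonneg _)]
      exact mul_le_mul (h2 w hw) (k2 w hw) (by positivity) (norm_nonneg _)
    · rw [norm_smul, Polynomial.eval_mul, norm_mul, Real.mul_rpow (norm_nonneg _) (norm_nonneg _),
        h3 w hw, k3 w hw]

lemma enorm_rpow_eq_ofReal (x : ℂ) {p : ℝ} (hp : 0 < p) :
    ‖x‖ₑ ^ p = ENNReal.ofReal (‖x‖ ^ p) := by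
  rw [← ofReal_norm, ENNReal.ofReal_rpow_of_nonneg (norm_nonneg _) hp.le]

lemma closure_unitBall : closure (Metric.ball (0 : ℂ) 1) = Metric.closedBall 0 1 :=
  closure_ball _ one_ne_zero

/-- The subharmonicity of `|F|^p`, along an analytic disc with boundary in the unit circle. -/
lemma enorm_eval_rpow_le_lintegral_comp {p : ℝ} (hp : 0 < p) (F : Polynomial ℂ) {φ : ℂ → ℂ}
    (hφ : DiffContOnCl ℂ φ (Metric.ball 0 1)) (h1 : Set.MapsTo φ (Metric.ball 0 1)
      (Metric.ball 0 1))
    (h2 : ∀ z, ‖z‖ = 1 → ‖φ z‖ = 1) :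
    ‖F.eval (φ 0)‖ₑ ^ p ≤ ∫⁻ z, ‖F.eval (φ z)‖ₑ ^ p ∂circleLaw := by
  obtain ⟨H, H1, H2, H3⟩ := exists_analytic_majorant hp F
  have hd : DiffContOnCl ℂ (H ∘ φ) (Metric.ball 0 1) := H1.comp hφ h1
  have h0 : ‖φ 0‖ < 1 := by simpa using h1 (Metric.mem_ball_self one_pos)
  have hc : ContinuousOn (H ∘ φ) (Metric.sphere 0 1) :=
    hd.continuousOn.mono (by rw [closure_unitBall]; exact Metric.sphere_subset_closedBall)
  calc ‖F.eval (φ 0)‖ₑ ^ p ≤ ‖(H ∘ φ) 0‖ₑ := by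
        rw [enorm_rpow_eq_ofReal _ hp, ← ofReal_norm]
        exact ENNReal.ofReal_le_ofReal (H2 _ h0.le)
    _ = ‖Real.circleAverage (H ∘ φ) 0 1‖ₑ := by
        rw [DiffContOnCl.circleAverage (by simpa using hd)]
    _ ≤ ∫⁻ z, ‖(H ∘ φ) z‖ₑ ∂circleLaw := enorm_circleAverage_le hc
    _ = ∫⁻ z, ‖F.eval (φ z)‖ₑ ^ p ∂circleLaw := by
        refine lintegral_congr_ae ?_
        filter_upwards [ae_norm_eq_one_circleLaw] with z hz
        rw [enorm_rpow_eq_ofReal _ hp, H3 _ (h2 z hz), ofReal_norm]; rfl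

/-- Cauchy's formula is applied to the analytic majorant rather than to `F`. On the circle the
kernel satisfies `|z / (z - w)| ≤ 1 / (1 - |w|)` and the majorant has modulus `|F|^p`. -/
lemma enorm_eval_rpow_le_lintegral {p : ℝ} (hp : 0 < p) (F : Polynomial ℂ) {w : ℂ} (hw : ‖w‖ < 1) :
    ‖F.eval w‖ₑ ^ p ≤ ENNReal.ofReal (1 - ‖w‖)⁻¹ * ∫⁻ z, ‖F.eval z‖ₑ ^ p ∂circleLaw := by
  obtain ⟨H, H1, H2, H3⟩ := exists_analytic_majorant hp F
  have hne : ∀ z : ℂ, ‖z‖ = 1 → z - w ≠ 0 := fun z hz h => by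
    rw [sub_eq_zero] at h; rw [← h, hz] at hw; exact lt_irrefl _ hw
  have hc : ContinuousOn (fun z => ((z - 0) / (z - w)) • H z) (Metric.sphere 0 1) := by
    refine ContinuousOn.smul (ContinuousOn.div (by fun_prop) (by fun_prop) fun z hz =>
      hne z (by simpa using hz)) (H1.continuousOn.mono ?_)
    rw [closure_unitBall]; exact Metric.sphere_subset_closedBall
  calc ‖F.eval w‖ₑ ^ p ≤ ‖H w‖ₑ := by
        rw [enorm_rpow_eq_ofReal _ hp, ← ofReal_norm]
        exact ENNReal.ofReal_le_ofReal (H2 _ hw.le)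
    _ = ‖Real.circleAverage (fun z => ((z - 0) / (z - w)) • H z) 0 1‖ₑ := by
        rw [DiffContOnCl.circleAverage_smul_div (by simpa using H1) (by simpa using hw)]
    _ ≤ ∫⁻ z, ‖((z - 0) / (z - w)) • H z‖ₑ ∂circleLaw := enorm_circleAverage_le hc
    _ ≤ ∫⁻ z, ENNReal.ofReal (1 - ‖w‖)⁻¹ * ‖F.eval z‖ₑ ^ p ∂circleLaw := by
        refine lintegral_mono_ae ?_
        filter_upwards [ae_norm_eq_one_circleLaw] with z hz
        rw [enorm_rpow_eq_ofReal _ hp, H3 _ hz, enorm_smul, ofReal_norm]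
        gcongr
        rw [← ofReal_norm]
        refine ENNReal.ofReal_le_ofReal ?_
        rw [sub_zero, norm_div, hz, one_div]
        have := norm_sub_norm_le z w
        rw [hz] at this
        exact inv_anti₀ (by linarith) this
    _ = _ := lintegral_const_mul' _ _ ENNReal.ofReal_ne_top

/-- A Möbius map `φ` of the disc with `φ(0) = r` avoids the Poisson kernel. Subharmonicity along `ζ
↦ φ(ζ) z` bounds `|F(rz)|^p` by a mean over `ζ`. After exchanging the integrals, the inner mean over
`z` is that of `|F|^p` by rotation invariance, as `|φ(ζ)| = 1` on the circle. -/
lemma lintegral_eval_mul_le {p : ℝ} (hp : 0 < p) (F : Polynomial ℂ) {r : ℝ} (h0 : 0 ≤ r)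
    (h1 : r < 1) :
    ∫⁻ z, ‖F.eval (r * z)‖ₑ ^ p ∂circleLaw ≤ ∫⁻ z, ‖F.eval z‖ₑ ^ p ∂circleLaw := by
  set φ : ℂ → ℂ := fun ζ => (ζ + r) / (1 + r * ζ) with hφ
  have hr : ‖(r : ℂ)‖ = r := by simp [abs_of_nonneg h0]
  have hden : ∀ ζ : ℂ, ‖ζ‖ ≤ 1 → 1 + r * ζ ≠ 0 := fun ζ hζ h => by
    have h2 : ‖(r : ℂ) * ζ‖ = 1 := by rw [eq_neg_of_add_eq_zero_right h]; simp
    rw [norm_mul, hr] at h2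
    nlinarith [norm_nonneg ζ]
  have hφd : DiffContOnCl ℂ φ (Metric.ball 0 1) := by
    refine DifferentiableOn.diffContOnCl ?_
    rw [closure_unitBall]
    intro ζ hζ
    refine DifferentiableAt.differentiableWithinAt (DifferentiableAt.div (by fun_prop)
      (by fun_prop) (hden ζ (by simpa using hζ)))
  have hconj : ∀ ζ : ℂ, 1 - (starRingEnd ℂ) (-(r : ℂ)) * ζ = 1 + r * ζ := fun ζ => by simp
  have hφ1 : ∀ ζ : ℂ, ‖ζ‖ = 1 → ‖φ ζ‖ = 1 := fun ζ hζ => by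
    have := norm_sub_eq_norm_one_sub_mul (a := -(r : ℂ)) hζ
    rw [hconj, sub_neg_eq_add] at this
    simp only [hφ]
    rw [norm_div, this, div_self (norm_ne_zero_iff.2 (hden ζ hζ.le))]
  have hφ2 : ∀ ζ : ℂ, ‖ζ‖ < 1 → ‖φ ζ‖ < 1 := fun ζ hζ => by
    simp only [hφ]
    rw [norm_div, div_lt_one (norm_pos_iff.2 (hden ζ hζ.le))]
    refine lt_of_pow_lt_pow_left₀ 2 (norm_nonneg _) ?_
    have hz : ‖ζ‖ ^ 2 < 1 := by nlinarith [norm_nonneg ζ]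
    have hrr : 0 < 1 - r ^ 2 := by nlinarith
    have := mul_pos (sub_pos.2 hz) hrr
    rw [Complex.sq_norm, Complex.normSq_apply] at *
    rw [Complex.sq_norm, Complex.normSq_apply]
    simp at *
    nlinarith
  have hφm : Measurable φ := by fun_prop
  have step : ∀ z : ℂ, ‖z‖ = 1 →
      ‖F.eval (r * z)‖ₑ ^ p ≤ ∫⁻ ζ, ‖F.eval (φ ζ * z)‖ₑ ^ p ∂circleLaw := fun z hz => by
    have := enorm_eval_rpow_le_lintegral_comp hp F (φ := fun ζ => φ ζ * z) ?_ ?_ ?_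
    · simpa [hφ] using this
    · exact hφd.smul_const z
    · intro ζ hζ
      simpa [hz] using hφ2 ζ (by simpa using hζ)
    · intro ζ hζ
      simp [hz, hφ1 ζ hζ]
  have hmeas : Measurable fun x : ℂ × ℂ => ‖F.eval (φ x.2 * x.1)‖ₑ ^ p :=
    ((F.continuous.measurable.comp
      ((hφm.comp measurable_snd).mul measurable_fst)).enorm).pow_const p
  calc ∫⁻ z, ‖F.eval (r * z)‖ₑ ^ p ∂circleLaw
      ≤ ∫⁻ z, ∫⁻ ζ, ‖F.eval (φ ζ * z)‖ₑ ^ p ∂circleLaw ∂circleLaw := by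
        refine lintegral_mono_ae ?_
        filter_upwards [ae_norm_eq_one_circleLaw] with z hz using step z hz
    _ = ∫⁻ ζ, ∫⁻ z, ‖F.eval (φ ζ * z)‖ₑ ^ p ∂circleLaw ∂circleLaw :=
        lintegral_lintegral_swap hmeas.aemeasurable
    _ = ∫⁻ ζ, ∫⁻ z, ‖F.eval z‖ₑ ^ p ∂circleLaw ∂circleLaw := by
        refine lintegral_congr_ae ?_
        filter_upwards [ae_norm_eq_one_circleLaw] with ζ hζ
        exact (measurePreserving_mul_circleLaw (hφ1 ζ hζ)).lintegral_comp
          (f := fun z => ‖F.eval z‖ₑ ^ p) ((F.continuous.measurable.enorm).pow_const p)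
    _ = _ := by simp

/-! ### Orthogonality of powers on the circle and coefficient estimates. -/

lemma integral_pow_mul_conj_pow_of_lt {a b : ℕ} (hab : b < a) :
    ∫ z, z ^ a * (starRingEnd ℂ) z ^ b ∂circleLaw = 0 := by
  have h : ∫ z, z ^ a * (starRingEnd ℂ) z ^ b ∂circleLaw = ∫ z, z ^ (a - b) ∂circleLaw := by
    refine integral_congr_ae ?_
    filter_upwards [ae_norm_eq_one_circleLaw] with z hz
    rw [← Nat.sub_add_cancel hab.le, pow_add, mul_assoc, ← mul_pow, Complex.mul_conj', hz]
    simp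
  rw [h, integral_circleLaw (by fun_prop), DiffContOnCl.circleAverage
    (Differentiable.diffContOnCl (by fun_prop)), zero_pow (Nat.sub_pos_of_lt hab).ne']

lemma integral_pow_mul_conj_pow (a b : ℕ) :
    ∫ z, z ^ a * (starRingEnd ℂ) z ^ b ∂circleLaw = if a = b then 1 else 0 := by
  split_ifs with hab
  · subst hab
    rw [integral_congr_ae (g := fun _ => (1 : ℂ)), integral_const]
    · simp
    · filter_upwards [ae_norm_eq_one_circleLaw] with z hz
      rw [← mul_pow, Complex.mul_conj', hz]
      simp
  · rcases lt_or_gt_of_ne hab with h | h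
    · have := congrArg (starRingEnd ℂ) (integral_pow_mul_conj_pow_of_lt h)
      rw [← integral_conj] at this
      simpa [mul_comm] using this
    · exact integral_pow_mul_conj_pow_of_lt h

lemma integrable_circleLaw_of_continuous {f : ℂ → ℂ} (hf : Continuous f) :
    Integrable f circleLaw := by
  obtain ⟨C, hC⟩ := (isCompact_sphere (0 : ℂ) 1).exists_bound_of_continuousOn hf.continuousOn
  refine Integrable.of_bound hf.aestronglyMeasurable C ?_
  filter_upwards [ae_norm_eq_one_circleLaw] with z hz using hC z (by simpa using hz)

lemma integral_eval_mul_conj_pow (F : Polynomial ℂ) (R : ℝ) (k : ℕ) :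
    ∫ z, F.eval (R * z) * (starRingEnd ℂ) z ^ k ∂circleLaw = F.coeff k * R ^ k := by
  have hc : Continuous fun z : ℂ => (starRingEnd ℂ) z := Complex.continuous_conj
  simp only [Polynomial.eval_eq_sum, Polynomial.sum_def, Finset.sum_mul]
  rw [integral_finsetSum _ fun j _ => integrable_circleLaw_of_continuous (by fun_prop)]
  have : ∀ j, ∫ z, F.coeff j * (R * z) ^ j * (starRingEnd ℂ) z ^ k ∂circleLaw =
      if j = k then F.coeff j * R ^ j else 0 := fun j => by
    have h : ∀ z : ℂ, F.coeff j * (R * z) ^ j * (starRingEnd ℂ) z ^ k =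
        (F.coeff j * R ^ j) * (z ^ j * (starRingEnd ℂ) z ^ k) := fun z => by ring
    simp only [h]
    rw [integral_const_mul, integral_pow_mul_conj_pow]
    simp
  simp only [this, Finset.sum_ite_eq']
  split_ifs with hk
  · rfl
  · rw [Polynomial.notMem_support_iff.1 hk, zero_mul]

/-- Cauchy estimate for the coefficients of a polynomial in terms of its `L^p` mean. -/
lemma enorm_coeff_mul_pow_le {p : ℝ} (hp : 0 < p) (F : Polynomial ℂ) {R : ℝ} (h0 : 0 ≤ R)
    (h1 : R < 1) (k : ℕ) :
    ‖F.coeff k‖ₑ * ENNReal.ofReal R ^ k ≤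
      (ENNReal.ofReal (1 - R)⁻¹ * ∫⁻ z, ‖F.eval z‖ₑ ^ p ∂circleLaw) ^ (1 / p) := by
  have hR : ‖(R : ℂ)‖ₑ = ENNReal.ofReal R := by
    rw [← ofReal_norm]; simp [abs_of_nonneg h0]
  have h : ‖F.coeff k‖ₑ * ENNReal.ofReal R ^ k = ‖F.coeff k * R ^ k‖ₑ := by
    rw [enorm_mul, enorm_pow, hR]
  -- The left side is a Fourier coefficient of `z ↦ F(Rz)`. The pointwise bound on the circle of
  -- radius `R` then covers all `p > 0`, whereas Hölder's inequality on the unit circle would need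
  -- `p ≥ 1`.
  rw [h, ← integral_eval_mul_conj_pow]
  refine (enorm_integral_le_lintegral_enorm _).trans ?_
  refine (lintegral_mono_ae (g := fun _ => (ENNReal.ofReal (1 - R)⁻¹ *
    ∫⁻ z, ‖F.eval z‖ₑ ^ p ∂circleLaw) ^ (1 / p)) ?_).trans (by simp)
  filter_upwards [ae_norm_eq_one_circleLaw] with z hz
  have hn : ‖(R : ℂ) * z‖ = R := by simp [hz, abs_of_nonneg h0]
  have hz' : ‖(starRingEnd ℂ) z‖ₑ = 1 := by rw [← ofReal_norm, RCLike.norm_conj, hz]; simp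
  rw [enorm_mul, enorm_pow, hz', one_pow, mul_one, one_div, ENNReal.le_rpow_inv_iff hp]
  have := enorm_eval_rpow_le_lintegral hp F (w := R * z) (by rw [hn]; exact h1)
  rwa [hn] at this

/-! ### Coefficient multipliers of the Hardy space of the disc. -/

/-- Multiplication of the coefficients of a polynomial by the sequence `l`. -/
def coeffMul (l : ℕ → ℂ) : Polynomial ℂ →ₗ[ℂ] Polynomial ℂ :=
  Polynomial.lsum fun k => l k • Polynomial.monomial k

lemma coeffMul_eq (l : ℕ → ℂ) (F : Polynomial ℂ) :
    coeffMul l F = ∑ k ∈ F.support, Polynomial.monomial k (l k * F.coeff k) := by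
  simp [coeffMul, Polynomial.lsum_apply, Polynomial.sum_def, Polynomial.smul_monomial]

lemma coeffMul_monomial (l : ℕ → ℂ) (k : ℕ) (c : ℂ) :
    coeffMul l (Polynomial.monomial k c) = Polynomial.monomial k (l k * c) := by
  simp [coeffMul, Polynomial.lsum_apply, Polynomial.sum_monomial_index, Polynomial.smul_monomial]

lemma eval_coeffMul (l : ℕ → ℂ) (F : Polynomial ℂ) (z : ℂ) :
    (coeffMul l F).eval z = ∑ k ∈ F.support, l k * F.coeff k * z ^ k := by
  simp [coeffMul_eq, Polynomial.eval_finsetSum]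

/-- `l` acts on the Hardy space `H^p` of the disc with norm at most `B ^ (1 / p)`. -/
def IsDiscMultiplier (p : ℝ) (B : ℝ≥0∞) (l : ℕ → ℂ) : Prop :=
  ∀ F : Polynomial ℂ, ∫⁻ z, ‖(coeffMul l F).eval z‖ₑ ^ p ∂circleLaw ≤
    B * ∫⁻ z, ‖F.eval z‖ₑ ^ p ∂circleLaw

/-- This is the dilation with `r = 0`, that is, evaluation at the origin, since `0 ^ 0 = 1`. -/
lemma isDiscMultiplier_zero_pow {p : ℝ} (hp : 0 < p) :
    IsDiscMultiplier p 1 (fun k => 0 ^ k) := fun F => by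
  have := lintegral_eval_mul_le hp F le_rfl one_pos
  have h : ∀ z : ℂ, (coeffMul (fun k => 0 ^ k) F).eval z = F.eval (((0 : ℝ) : ℂ) * z) := fun z => by
    rw [eval_coeffMul, Polynomial.eval_eq_sum, Polynomial.sum_def]
    refine Finset.sum_congr rfl fun k _ => ?_
    rw [Complex.ofReal_zero, mul_pow]; ring
  simpa only [h, one_mul] using this

/-- Either `y ≤ θx` or `x ≤ θ⁻¹y`, and one term on the right suffices in each case. The coefficient
of `x ^ p` can be taken close to `1`, which keeps the loss small when an error term is added. -/
lemma add_rpow_le_of_pos {p θ : ℝ} (hp : 0 < p) (hθ : 0 < θ) (x y : ℝ≥0∞) :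
    (x + y) ^ p ≤ ENNReal.ofReal (1 + θ) ^ p * x ^ p + ENNReal.ofReal (1 + θ⁻¹) ^ p * y ^ p := by
  rw [← ENNReal.mul_rpow_of_nonneg _ _ hp.le, ← ENNReal.mul_rpow_of_nonneg _ _ hp.le]
  rw [ENNReal.ofReal_add zero_le_one hθ.le, ENNReal.ofReal_add zero_le_one (by positivity),
    ENNReal.ofReal_one, add_mul, add_mul, one_mul, one_mul]
  rcases le_total y (ENNReal.ofReal θ * x) with h | h
  · exact le_add_right (ENNReal.rpow_le_rpow (by gcongr) hp.le)
  · refine le_add_left (ENNReal.rpow_le_rpow ?_ hp.le)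
    rw [add_comm]
    gcongr
    rw [ENNReal.ofReal_inv_of_pos hθ]
    calc x = (ENNReal.ofReal θ)⁻¹ * (ENNReal.ofReal θ * x) := by
          rw [← mul_assoc, ENNReal.inv_mul_cancel (by simpa) ENNReal.ofReal_ne_top, one_mul]
      _ ≤ _ := by gcongr

/-- Truncations of the dilation multiplier `x ^ (3 k)`. -/
lemma isDiscMultiplier_truncation {p η : ℝ} (hp : 0 < p) (hη : 0 < η) {x : ℝ} (h0 : 0 < x)
    (h1 : x < 1) :
    ∀ᶠ K : ℕ in atTop, IsDiscMultiplier p (ENNReal.ofReal (1 + η))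
      (fun k => if k ≤ K then ((x ^ 3 : ℝ) : ℂ) ^ k else 0) := by
  set Y := ENNReal.ofReal x with hY
  have hY1 : Y < 1 := by simpa [hY] using h1
  have hY0 : 1 - Y ≠ 0 := (tsub_pos_of_lt hY1).ne'
  obtain ⟨θ, hθ0, hθ⟩ : ∃ θ : ℝ, 0 < θ ∧ (1 + θ) ^ p ≤ 1 + η / 2 := by
    have : Tendsto (fun θ : ℝ => (1 + θ) ^ p) (𝓝[>] 0) (𝓝 ((1 + 0) ^ p)) :=
      ((by fun_prop : Continuous fun θ : ℝ => 1 + θ).tendsto 0 |>.rpow_const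
        (Or.inr hp.le)).mono_left nhdsWithin_le_nhds
    have h2 := (this.eventually_le_const (u := 1 + η / 2) (by simpa)).and
      (self_mem_nhdsWithin : ∀ᶠ θ in 𝓝[>] (0 : ℝ), θ ∈ Set.Ioi 0)
    obtain ⟨θ, a, b⟩ := h2.exists
    exact ⟨θ, b, a⟩
  set D := ENNReal.ofReal (1 + θ⁻¹) ^ p * ENNReal.ofReal (1 - x)⁻¹ * ((1 - Y)⁻¹) ^ p with hD
  have hDtop : D ≠ ⊤ := by
    refine ENNReal.mul_ne_top (ENNReal.mul_ne_top ?_ ENNReal.ofReal_ne_top) ?_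
    · exact ENNReal.rpow_ne_top_of_nonneg hp.le ENNReal.ofReal_ne_top
    · exact ENNReal.rpow_ne_top_of_nonneg hp.le (ENNReal.inv_ne_top.2 hY0)
  -- The discarded tail beyond degree `K` will cost at most `D * (Y ^ K) ^ p` times the mean of
  -- `|F|^p`, so `K` is taken large enough to make this factor at most `η / 2`.
  have htend : Tendsto (fun K : ℕ => D * (Y ^ K) ^ p) atTop (𝓝 0) := by
    have h := ENNReal.Tendsto.const_mul (a := D) ((ENNReal.continuous_rpow_const (y := p)).tendsto _
      |>.comp (ENNReal.tendsto_pow_atTop_nhds_zero_of_lt_one hY1)) (Or.inr hDtop)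
    simpa [ENNReal.zero_rpow_of_pos hp] using h
  filter_upwards [htend.eventually_le_const (u := ENNReal.ofReal (η / 2)) (by simpa)]
    with K hK F
  set I := ∫⁻ z, ‖F.eval z‖ₑ ^ p ∂circleLaw with hI
  set B := (ENNReal.ofReal (1 - x)⁻¹ * I) ^ (1 / p) with hB
  -- The exponent `3` provides three factors `x ^ k`: one absorbs the coefficient through the Cauchy
  -- estimate at radius `x`, one is at most `x ^ K` on the tail, and one is summed as a geometric
  -- series.
  have hYx : ∀ k : ℕ, ‖((x ^ 3 : ℝ) : ℂ) ^ k‖ₑ = Y ^ k * Y ^ k * Y ^ k := fun k => by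
    rw [enorm_pow, ← ofReal_norm, Complex.norm_real, Real.norm_of_nonneg (by positivity),
      ENNReal.ofReal_pow h0.le, ← hY, ← pow_mul, ← pow_add, ← pow_add]
    congr 1; ring
  have hpt : ∀ z : ℂ, ‖z‖ = 1 → ‖(coeffMul (fun k => if k ≤ K then ((x ^ 3 : ℝ) : ℂ) ^ k else 0)
      F).eval z‖ₑ ≤ ‖F.eval ((x ^ 3 : ℝ) * z)‖ₑ + Y ^ K * (1 - Y)⁻¹ * B := fun z hz => by
    have hz' : ‖z‖ₑ = 1 := by rw [← ofReal_norm, hz]; simp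
    have hdiff : (coeffMul (fun k => if k ≤ K then ((x ^ 3 : ℝ) : ℂ) ^ k else 0) F).eval z =
        F.eval ((x ^ 3 : ℝ) * z) -
          ∑ k ∈ F.support, if k ≤ K then 0 else ((x ^ 3 : ℝ) : ℂ) ^ k * F.coeff k * z ^ k := by
      rw [eval_coeffMul, Polynomial.eval_eq_sum, Polynomial.sum_def, ← Finset.sum_sub_distrib]
      refine Finset.sum_congr rfl fun k _ => ?_
      split_ifs <;> ring
    rw [hdiff]
    refine (enorm_sub_le).trans ?_
    gcongr
    calc ‖∑ k ∈ F.support, if k ≤ K then 0 else ((x ^ 3 : ℝ) : ℂ) ^ k * F.coeff k * z ^ k‖ₑ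
        ≤ ∑ k ∈ F.support, Y ^ K * Y ^ k * B := by
          refine (enorm_sum_le _ _).trans (Finset.sum_le_sum fun k _ => ?_)
          split_ifs with hk
          · simp
          · rw [enorm_mul, enorm_mul, hYx, enorm_pow, hz', one_pow, mul_one, mul_assoc,
              mul_comm _ ‖F.coeff k‖ₑ]
            have hc : ‖F.coeff k‖ₑ * Y ^ k ≤ B := enorm_coeff_mul_pow_le hp F h0.le h1 k
            gcongr ?_ * _ * ?_
            exact pow_le_pow_right_of_le_one' hY1.le (not_le.1 hk).le
      _ = Y ^ K * (∑ k ∈ F.support, Y ^ k) * B := by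
          rw [← Finset.sum_mul, ← Finset.mul_sum]
      _ ≤ Y ^ K * (1 - Y)⁻¹ * B := by
          gcongr
          rw [← ENNReal.tsum_geometric]
          exact ENNReal.sum_le_tsum _
  have hBp : B ^ p = ENNReal.ofReal (1 - x)⁻¹ * I := by
    rw [hB, ← ENNReal.rpow_mul, one_div_mul_cancel hp.ne', ENNReal.rpow_one]
  have hm : Measurable fun z : ℂ => ‖F.eval ((x ^ 3 : ℝ) * z)‖ₑ ^ p :=
    ((F.continuous.measurable.comp (measurable_const_mul _)).enorm).pow_const p
  calc ∫⁻ z, ‖(coeffMul (fun k => if k ≤ K then ((x ^ 3 : ℝ) : ℂ) ^ k else 0) F).eval z‖ₑ ^ p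
        ∂circleLaw
      ≤ ∫⁻ z, (ENNReal.ofReal (1 + θ) ^ p * ‖F.eval ((x ^ 3 : ℝ) * z)‖ₑ ^ p +
          ENNReal.ofReal (1 + θ⁻¹) ^ p * (Y ^ K * (1 - Y)⁻¹ * B) ^ p) ∂circleLaw := by
        refine lintegral_mono_ae ?_
        filter_upwards [ae_norm_eq_one_circleLaw] with z hz
        exact (ENNReal.rpow_le_rpow (hpt z hz) hp.le).trans (add_rpow_le_of_pos hp hθ0 _ _)
    _ = ENNReal.ofReal (1 + θ) ^ p * ∫⁻ z, ‖F.eval ((x ^ 3 : ℝ) * z)‖ₑ ^ p ∂circleLaw +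
          ENNReal.ofReal (1 + θ⁻¹) ^ p * (Y ^ K * (1 - Y)⁻¹ * B) ^ p := by
        rw [lintegral_add_right _ measurable_const, lintegral_const_mul _ hm, lintegral_const]
        simp
    _ ≤ ENNReal.ofReal (1 + η / 2) * I + ENNReal.ofReal (η / 2) * I := by
        gcongr ?_ * ?_ + ?_
        · rw [ENNReal.ofReal_rpow_of_pos (by positivity)]
          exact ENNReal.ofReal_le_ofReal hθ
        · exact lintegral_eval_mul_le hp F (by positivity) (pow_lt_one₀ h0.le h1 (by norm_num))
        · rw [ENNReal.mul_rpow_of_nonneg _ _ hp.le, ENNReal.mul_rpow_of_nonneg _ _ hp.le, hBp]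
          calc _ = D * (Y ^ K) ^ p * I := by rw [hD]; ring
            _ ≤ _ := by gcongr
    _ = _ := by
        rw [← add_mul, ← ENNReal.ofReal_add (by positivity) (by positivity)]
        congr 2; ring

/-- A dilation with `x` near `1`, so that `x ^ (3M) ≥ 1 - η`, truncated at some `K ≥ M`. The
constant `1 + η` must be arbitrarily close to `1` because one such multiplier is used for each prime
in a growing set. -/
lemma exists_isDiscMultiplier {p η : ℝ} (hp : 0 < p) (hη : 0 < η) (M : ℕ) :
    ∃ (l : ℕ → ℂ) (K : ℕ), l 0 = 1 ∧ (∀ k ≤ M, ‖l k - 1‖ ≤ η) ∧ (∀ k, K < k → l k = 0) ∧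
      IsDiscMultiplier p (ENNReal.ofReal (1 + η)) l := by
  obtain ⟨x, hx0, hx1, hx⟩ : ∃ x : ℝ, 0 < x ∧ x < 1 ∧ 1 - η ≤ (x ^ 3) ^ M := by
    have : Tendsto (fun x : ℝ => (x ^ 3) ^ M) (𝓝[<] 1) (𝓝 ((1 ^ 3) ^ M)) :=
      ((by fun_prop : Continuous fun x : ℝ => (x ^ 3) ^ M).tendsto 1).mono_left nhdsWithin_le_nhds
    have h1 : ∀ᶠ x in 𝓝[<] (1 : ℝ), x ∈ Set.Iio 1 := self_mem_nhdsWithin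
    have h2 := (this.eventually_const_le (u := 1 - η) (by simpa)).and (h1.and
        ((eventually_gt_nhds zero_lt_one).filter_mono nhdsWithin_le_nhds))
    obtain ⟨x, a, b, c⟩ := h2.exists
    exact ⟨x, c, b, a⟩
  obtain ⟨K, hK, hKM⟩ := ((isDiscMultiplier_truncation hp hη hx0 hx1).and
    (eventually_ge_atTop M)).exists
  refine ⟨_, K, ?_, fun k hk => ?_, fun k hk => ?_, hK⟩
  · simp
  · have h3 : x ^ 3 ≤ 1 := pow_le_one₀ hx0.le hx1.le
    have h4 : (x ^ 3) ^ M ≤ (x ^ 3) ^ k := pow_le_pow_of_le_one (by positivity) h3 hk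
    have h5 : (x ^ 3) ^ k ≤ 1 := pow_le_one₀ (by positivity) h3
    rw [if_pos (hk.trans hKM), ← Complex.ofReal_pow, ← Complex.ofReal_one, ← Complex.ofReal_sub,
      Complex.norm_real, Real.norm_eq_abs, abs_le]
    constructor <;> linarith
  · rw [if_neg (not_le.2 hk)]

/-! ### The infinite torus -/

instance : IsProbabilityMeasure torusMeasure := by
  unfold torusMeasure; infer_instance

lemma measurable_update_prod (j : Nat.Primes) :
    Measurable fun x : (Nat.Primes → ℂ) × ℂ => Function.update x.1 j x.2 :=
  measurable_pi_lambda _ fun i => by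
    by_cases h : i = j
    · subst h; simpa using measurable_snd
    · simpa [Function.update_of_ne h, Function.comp_def] using
        (measurable_pi_apply (X := fun _ : Nat.Primes => ℂ) i).comp measurable_fst

/-- Resampling one coordinate independently preserves a product measure, as is checked on finite
boxes. Every one-variable inequality can thus be applied in a single coordinate of the infinite
torus. -/
lemma measurePreserving_update (j : Nat.Primes) :
    MeasurePreserving (fun x : (Nat.Primes → ℂ) × ℂ => Function.update x.1 j x.2)
      (torusMeasure.prod circleLaw) torusMeasure := by
  refine ⟨measurable_update_prod j, ?_⟩
  refine Measure.eq_infinitePi _ fun s t ht => ?_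
  rw [Measure.map_apply (measurable_update_prod j)
    (MeasurableSet.pi s.countable_toSet fun i _ => ht i)]
  have hpre : (fun x : (Nat.Primes → ℂ) × ℂ => Function.update x.1 j x.2) ⁻¹' (Set.pi s t) =
      (Set.pi (s.erase j) t) ×ˢ (if j ∈ s then t j else Set.univ) := by
    ext x
    simp only [Set.mem_preimage, Set.mem_pi, Set.mem_prod, Finset.mem_coe, Finset.mem_erase]
    constructor
    · refine fun h => ⟨fun i hi => by simpa [Function.update_of_ne hi.1] using h i hi.2, ?_⟩
      split_ifs with hj
      · simpa using h j hj
      · trivial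
    · rintro ⟨h1, h2⟩ i hi
      by_cases hij : i = j
      · subst hij; simpa [hi] using h2
      · simpa [Function.update_of_ne hij] using h1 i ⟨hij, hi⟩
  rw [hpre, Measure.prod_prod, torusMeasure, Measure.infinitePi_pi _ fun i _ => ht i]
  split_ifs with hj
  · rw [Finset.prod_erase_mul _ _ hj]
  · rw [measure_univ, mul_one, Finset.erase_eq_of_notMem hj]

lemma lintegral_torusMeasure_update (j : Nat.Primes) {f : (Nat.Primes → ℂ) → ℝ≥0∞}
    (hf : Measurable f) :
    ∫⁻ z, f z ∂torusMeasure =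
      ∫⁻ z, ∫⁻ u, f (Function.update z j u) ∂circleLaw ∂torusMeasure := by
  have h := (measurePreserving_update j).lintegral_comp hf
  rw [← h, lintegral_prod (fun x : (Nat.Primes → ℂ) × ℂ => f (Function.update x.1 j x.2))
      (hf.comp (measurable_update_prod j)).aemeasurable]

lemma ae_norm_eq_one_torusMeasure : ∀ᵐ z ∂torusMeasure, ∀ j, ‖z j‖ = 1 := by
  rw [ae_all_iff]
  intro j
  exact (measurePreserving_eval_infinitePi
      (fun _ : Nat.Primes => circleLaw) j).quasiMeasurePreserving.ae
    ae_norm_eq_one_circleLaw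

/-- The set of prime divisors of `n`. -/
def primeSupport (n : ℕ+) : Finset Nat.Primes := (n : ℕ).primeFactors.subtype Nat.Prime

lemma mem_primeSupport {n : ℕ+} {q : Nat.Primes} :
    q ∈ primeSupport n ↔ (n : ℕ).factorization q ≠ 0 := by
  refine Iff.trans (Finset.mem_subtype (p := Nat.Prime) (a := q)) ?_
  rw [← Nat.support_factorization, Finsupp.mem_support_iff]

lemma mulSupport_bohrMonomial_subset (n : ℕ+) (z : Nat.Primes → ℂ) :
    Function.mulSupport (fun p : Nat.Primes => z p ^ (n : ℕ).factorization p) ⊆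
      (primeSupport n : Set Nat.Primes) := fun p hp => by
  rw [Finset.mem_coe, mem_primeSupport]
  intro h
  exact hp (by simp [h])

lemma bohrMonomial_eq_prod (n : ℕ+) (z : Nat.Primes → ℂ) :
    bohrMonomial n z = ∏ p ∈ primeSupport n, z p ^ (n : ℕ).factorization p :=
  finprod_eq_prod_of_mulSupport_subset _ (mulSupport_bohrMonomial_subset n z)

lemma measurable_bohrMonomial (n : ℕ+) : Measurable (bohrMonomial n) := by
  rw [funext (bohrMonomial_eq_prod n)]
  exact Finset.measurable_prod _ fun p _ => (measurable_pi_apply p).pow_const _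

lemma norm_bohrMonomial (n : ℕ+) {z : Nat.Primes → ℂ} (hz : ∀ j, ‖z j‖ = 1) :
    ‖bohrMonomial n z‖ = 1 := by
  rw [bohrMonomial_eq_prod, norm_prod]
  exact Finset.prod_eq_one fun p _ => by rw [norm_pow, hz, one_pow]

/-- Separates the dependence on one coordinate, so that a Bohr lift becomes a one-variable
polynomial once the other coordinates are frozen. -/
lemma bohrMonomial_update (n : ℕ+) (z : Nat.Primes → ℂ) (j : Nat.Primes) (u : ℂ) :
    bohrMonomial n (Function.update z j u) =
      bohrMonomial n (Function.update z j 1) * u ^ (n : ℕ).factorization j := by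
  have h1 : ∏ᶠ p : Nat.Primes, (if p = j then u ^ (n : ℕ).factorization p else 1) =
      u ^ (n : ℕ).factorization j := by
    rw [finprod_eq_single _ j fun p hp => by simp [hp]]; simp
  have hfin : ∀ z : Nat.Primes → ℂ,
      (Function.mulSupport (fun p : Nat.Primes => z p ^ (n : ℕ).factorization p)).Finite :=
    fun z => (Finset.finite_toSet _).subset (mulSupport_bohrMonomial_subset n z)
  rw [← h1, bohrMonomial, bohrMonomial, ← finprod_mul_distrib (hfin _)
    ((Set.finite_singleton j).subset fun p hp => by
      by_contra h; exact hp (by simp at h; simp [h]))]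
  refine finprod_congr fun p => ?_
  by_cases h : p = j
  · subst h; simp
  · simp [h]

lemma integrable_bohrMonomial_mul (n m : ℕ+) :
    Integrable (fun z => bohrMonomial n z * (starRingEnd ℂ) (bohrMonomial m z)) torusMeasure := by
  refine Integrable.of_bound (((measurable_bohrMonomial n).mul
    (Complex.continuous_conj.measurable.comp
      (measurable_bohrMonomial m))).aestronglyMeasurable) 1 ?_
  filter_upwards [ae_norm_eq_one_torusMeasure] with z hz
  simp [norm_bohrMonomial n hz, norm_bohrMonomial m hz]

/-- Distinct integers have different valuations at some prime. Integrating over that coordinate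
first annihilates the product. -/
lemma integral_bohrMonomial_mul (n m : ℕ+) :
    ∫ z, bohrMonomial n z * (starRingEnd ℂ) (bohrMonomial m z) ∂torusMeasure =
      if n = m then 1 else 0 := by
  split_ifs with h
  · subst h
    rw [integral_congr_ae (g := fun _ => (1 : ℂ)), integral_const]
    · simp
    · filter_upwards [ae_norm_eq_one_torusMeasure] with z hz
      rw [Complex.mul_conj', norm_bohrMonomial n hz]; simp
  · obtain ⟨j, hj⟩ : ∃ j : Nat.Primes, (n : ℕ).factorization j ≠ (m : ℕ).factorization j := by
      by_contra hcon
      push Not at hcon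
      refine h (PNat.eq (Nat.eq_of_factorization_eq n.ne_zero m.ne_zero fun q => ?_))
      by_cases hq : q.Prime
      · exact hcon ⟨q, hq⟩
      · simp [Nat.factorization_eq_zero_of_not_prime _ hq]
    have hmp := measurePreserving_update j
    have hi := integrable_bohrMonomial_mul n m
    rw [← hmp.map_eq, integral_map hmp.measurable.aemeasurable
      (by rw [hmp.map_eq]; exact hi.aestronglyMeasurable),
      integral_prod (fun x : (Nat.Primes → ℂ) × ℂ => bohrMonomial n (Function.update x.1 j x.2) *
        (starRingEnd ℂ) (bohrMonomial m (Function.update x.1 j x.2)))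
        (hmp.integrable_comp_of_integrable hi)]
    have : ∀ z : Nat.Primes → ℂ, ∫ u, bohrMonomial n (Function.update z j u) *
        (starRingEnd ℂ) (bohrMonomial m (Function.update z j u)) ∂circleLaw = 0 := fun z => by
      have h2 : ∀ u, bohrMonomial n (Function.update z j u) *
          (starRingEnd ℂ) (bohrMonomial m (Function.update z j u)) =
          (bohrMonomial n (Function.update z j 1) *
            (starRingEnd ℂ) (bohrMonomial m (Function.update z j 1))) *
          (u ^ (n : ℕ).factorization j * (starRingEnd ℂ) u ^ (m : ℕ).factorization j) := fun u => by
        rw [bohrMonomial_update n, bohrMonomial_update m, map_mul, map_pow]; ring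
      rw [integral_congr_ae (Eventually.of_forall h2), integral_const_mul,
          integral_pow_mul_conj_pow, if_neg hj, mul_zero]
    simp only [this, integral_zero]

/-! ### Coefficientwise products -/

/-- The Dirichlet polynomial with the coefficients `P n * b n`. -/
def lmul (P : ℕ+ →₀ ℂ) (b : ℕ+ → ℂ) : ℕ+ →₀ ℂ :=
  Finsupp.onFinset P.support (fun n => P n * b n) fun n hn => by
    rw [Finsupp.mem_support_iff]
    exact left_ne_zero_of_mul hn

@[simp] lemma lmul_apply (P : ℕ+ →₀ ℂ) (b : ℕ+ → ℂ) (n : ℕ+) : lmul P b n = P n * b n := rfl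

lemma translate_eq_lmul (σ : ℝ) (P : ℕ+ →₀ ℂ) :
    translate σ P = lmul P fun n => (((n : ℝ) ^ (-σ) : ℝ) : ℂ) := rfl

lemma bohrLift_eq_sum {P : ℕ+ →₀ ℂ} {s : Finset ℕ+} (hs : P.support ⊆ s) (z : Nat.Primes → ℂ) :
    bohrLift P z = ∑ n ∈ s, P n * bohrMonomial n z :=
  Finsupp.sum_of_support_subset _ hs _ fun n _ => by simp

lemma bohrLift_lmul (P : ℕ+ →₀ ℂ) (b : ℕ+ → ℂ) (z : Nat.Primes → ℂ) :
    bohrLift (lmul P b) z = ∑ n ∈ P.support, P n * b n * bohrMonomial n z :=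
  bohrLift_eq_sum Finsupp.support_onFinset_subset z

lemma measurable_bohrLift (P : ℕ+ →₀ ℂ) : Measurable (bohrLift P) := by
  rw [funext (bohrLift_eq_sum (Finset.Subset.refl P.support))]
  exact Finset.measurable_sum _ fun n _ => (measurable_bohrMonomial n).const_mul _

/-- Parseval's identity for finite linear combinations of an orthonormal family. -/
lemma lintegral_enorm_sum_sq_of_orthonormal {ι α : Type*} [DecidableEq ι] [MeasurableSpace α]
    {μ : Measure α} {e : ι → α → ℂ}
    (hint : ∀ n m, Integrable (fun x => e n x * (starRingEnd ℂ) (e m x)) μ)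
    (horth : ∀ n m, ∫ x, e n x * (starRingEnd ℂ) (e m x) ∂μ = if n = m then 1 else 0)
    (s : Finset ι) (c : ι → ℂ) :
    ∫⁻ x, ‖∑ n ∈ s, c n * e n x‖ₑ ^ (2 : ℝ) ∂μ = ∑ n ∈ s, ‖c n‖ₑ ^ (2 : ℝ) := by
  have hs : ∀ x : ℂ, ‖x‖ₑ ^ (2 : ℝ) = ENNReal.ofReal (‖x‖ ^ 2) := fun x => by
    rw [enorm_rpow_eq_ofReal _ two_pos, Real.rpow_two]
  have hexp : ∀ x, ((‖∑ n ∈ s, c n * e n x‖ ^ 2 : ℝ) : ℂ) = ∑ n ∈ s, ∑ m ∈ s,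
      (c n * (starRingEnd ℂ) (c m)) * (e n x * (starRingEnd ℂ) (e m x)) := fun x => by
    rw [Complex.ofReal_pow, ← Complex.mul_conj', map_sum, Finset.sum_mul_sum]
    refine Finset.sum_congr rfl fun n _ => Finset.sum_congr rfl fun m _ => ?_
    rw [map_mul]; ring
  have hint' : ∀ n m, Integrable (fun x => (c n * (starRingEnd ℂ) (c m)) *
        (e n x * (starRingEnd ℂ) (e m x))) μ := fun n m => (hint n m).const_mul _
  have hI : Integrable (fun x => ((‖∑ n ∈ s, c n * e n x‖ ^ 2 : ℝ) : ℂ)) μ := by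
    simp only [hexp]
    exact integrable_finsetSum _ fun n _ => integrable_finsetSum _ fun m _ => hint' n m
  have hval : ∫ x, ‖∑ n ∈ s, c n * e n x‖ ^ 2 ∂μ = ∑ n ∈ s, ‖c n‖ ^ 2 := by
    apply Complex.ofReal_injective
    rw [← integral_complex_ofReal]
    simp only [hexp]
    rw [integral_finsetSum _ fun n _ => integrable_finsetSum _ fun m _ => hint' n m,
      Complex.ofReal_sum]
    refine Finset.sum_congr rfl fun n hn => ?_
    rw [integral_finsetSum _ fun m _ => hint' n m]
    simp only [integral_const_mul, horth]
    simp only [mul_ite, mul_one, mul_zero, Finset.sum_ite_eq, if_pos hn]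
    rw [Complex.mul_conj']; simp
  simp only [hs]
  rw [← ofReal_integral_eq_lintegral_ofReal (by simpa [← Complex.ofReal_pow] using hI.re)
    (Eventually.of_forall fun z => by positivity), hval,
    ENNReal.ofReal_sum_of_nonneg fun n _ => by positivity]

lemma lintegral_enorm_bohrLift_sq (P : ℕ+ →₀ ℂ) :
    ∫⁻ z, ‖bohrLift P z‖ₑ ^ (2 : ℝ) ∂torusMeasure = ∑ n ∈ P.support, ‖P n‖ₑ ^ (2 : ℝ) := by
  simp only [bohrLift_eq_sum (Finset.Subset.refl P.support)]
  exact lintegral_enorm_sum_sq_of_orthonormal integrable_bohrMonomial_mul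
    integral_bohrMonomial_mul _ _

lemma hardyPolyNorm_two (P : ℕ+ →₀ ℂ) :
    hardyPolyNorm 2 P = (∑ n ∈ P.support, ‖P n‖ₑ ^ (2 : ℝ)) ^ (1 / 2 : ℝ) := by
  rw [hardyPolyNorm, lintegral_enorm_bohrLift_sq]

/-! ### Multipliers of the Hardy space of the torus -/

/-- `w` acts by coefficientwise multiplication on `H^p` with norm at most `B ^ (1 / p)`. -/
def IsTorusMultiplier (p : ℝ) (B : ℝ≥0∞) (w : ℕ+ → ℂ) : Prop :=
  ∀ P : ℕ+ →₀ ℂ, ∫⁻ z, ‖bohrLift (lmul P w) z‖ₑ ^ p ∂torusMeasure ≤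
    B * ∫⁻ z, ‖bohrLift P z‖ₑ ^ p ∂torusMeasure

lemma IsTorusMultiplier.one (p : ℝ) : IsTorusMultiplier p 1 fun _ => 1 := fun P => by
  have : lmul P (fun _ => 1) = P := by ext; simp
  rw [this, one_mul]

lemma IsTorusMultiplier.mul {p : ℝ} {B C : ℝ≥0∞} {v w : ℕ+ → ℂ} (hv : IsTorusMultiplier p B v)
    (hw : IsTorusMultiplier p C w) : IsTorusMultiplier p (B * C) fun n => v n * w n := fun P => by
  have : lmul P (fun n => v n * w n) = lmul (lmul P w) v := by
    ext n; simp only [lmul_apply]; ring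
  rw [this, mul_assoc]
  exact (hv _).trans (by gcongr; exact hw P)

lemma IsTorusMultiplier.prod {p : ℝ} {B : ℝ≥0∞} {ι : Type*} (s : Finset ι) {w : ι → ℕ+ → ℂ}
    (hw : ∀ i ∈ s, IsTorusMultiplier p B (w i)) :
    IsTorusMultiplier p (B ^ s.card) fun n => ∏ i ∈ s, w i n := by
  classical
  induction s using Finset.induction_on with
  | empty => simpa using IsTorusMultiplier.one p
  | insert i s hi ih =>
    have := (hw i (Finset.mem_insert_self _ _)).mul
      (ih fun k hk => hw k (Finset.mem_insert_of_mem hk))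
    rw [Finset.card_insert_of_notMem hi, pow_succ']
    simpa only [Finset.prod_insert hi] using this

/-- With all coordinates but `j` frozen, the Bohr lift is a polynomial in the remaining variable
whose degrees are the valuations at `j`. The disc estimate holds for each frozen point and
integrates with the same constant. -/
lemma IsDiscMultiplier.isTorusMultiplier {p : ℝ} {B : ℝ≥0∞} {l : ℕ → ℂ}
    (hl : IsDiscMultiplier p B l) (j : Nat.Primes) :
    IsTorusMultiplier p B fun n => l ((n : ℕ).factorization j) := fun P => by
  set F : (Nat.Primes → ℂ) → Polynomial ℂ := fun z => ∑ n ∈ P.support,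
    Polynomial.monomial ((n : ℕ).factorization j)
      (P n * bohrMonomial n (Function.update z j 1)) with hF
  have h1 : ∀ z u, bohrLift P (Function.update z j u) = (F z).eval u := fun z u => by
    rw [bohrLift_eq_sum (Finset.Subset.refl _), hF, Polynomial.eval_finsetSum]
    refine Finset.sum_congr rfl fun n _ => ?_
    rw [Polynomial.eval_monomial, bohrMonomial_update n z j u, mul_assoc]
  have h2 : ∀ z u, bohrLift (lmul P fun n => l ((n : ℕ).factorization j)) (Function.update z j u) =
      (coeffMul l (F z)).eval u := fun z u => by
    rw [bohrLift_lmul, hF, map_sum, Polynomial.eval_finsetSum]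
    refine Finset.sum_congr rfl fun n _ => ?_
    rw [coeffMul_monomial, Polynomial.eval_monomial, bohrMonomial_update n z j u]
    ring
  have hm : ∀ Q : ℕ+ →₀ ℂ, Measurable fun z => ‖bohrLift Q z‖ₑ ^ p := fun Q =>
    (measurable_bohrLift Q).enorm.pow_const p
  rw [lintegral_torusMeasure_update j (hm _), lintegral_torusMeasure_update j (hm P),
    ← lintegral_const_mul]
  · refine lintegral_mono fun z => ?_
    simp only [h1, h2]
    exact hl (F z)
  · exact Measurable.lintegral_prod_right ((hm P).comp (measurable_update_prod j))

/-- Multipliers are tested on one polynomial at a time, so only their values on a finite set matter.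
This reduces products over infinitely many primes to finite ones. -/
lemma IsTorusMultiplier.of_restrict {p : ℝ} {B : ℝ≥0∞} {w : ℕ+ → ℂ}
    (h : ∀ s : Finset ℕ+, ∃ v, IsTorusMultiplier p B v ∧ ∀ n ∈ s, v n = w n) :
    IsTorusMultiplier p B w := fun P => by
  obtain ⟨v, hv, hvw⟩ := h P.support
  have : lmul P w = lmul P v := by
    ext n
    by_cases hn : n ∈ P.support
    · simp [hvw n hn]
    · simp [Finsupp.notMem_support_iff.1 hn]
  rw [this]
  exact hv P

-- The factor `0 ^ ν_q(n)` is the indicator of `q ∤ n`, and as a multiplier it is contractive.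
-- Removing all the primes above `m` therefore costs no constant.
open Classical in
lemma isTorusMultiplier_smooth {p : ℝ} (hp : 0 < p) (m : ℕ) :
    IsTorusMultiplier p 1 fun n : ℕ+ =>
      if ∀ q : Nat.Primes, m < (q : ℕ) → (n : ℕ).factorization q = 0 then 1 else 0 := by
  refine IsTorusMultiplier.of_restrict fun s => ?_
  let U : Finset Nat.Primes :=
    (s.biUnion fun n => primeSupport n).filter
      fun q : Nat.Primes => m < (q : ℕ)
  have h := IsTorusMultiplier.prod U fun q _ => (isDiscMultiplier_zero_pow hp).isTorusMultiplier q
  rw [one_pow] at h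
  refine ⟨_, h, fun n hn => ?_⟩
  split_ifs with hc
  · refine Finset.prod_eq_one fun q hq => ?_
    rw [hc q (Finset.mem_filter.1 hq).2, pow_zero]
  · push Not at hc
    obtain ⟨q, hq, hq0⟩ := hc
    refine Finset.prod_eq_zero (i := q) ?_ (zero_pow hq0)
    refine Finset.mem_filter.2 ⟨Finset.mem_biUnion.2 ⟨n, hn, ?_⟩, hq⟩
    exact mem_primeSupport.2 hq0

open Classical in
/-- Finitely supported multipliers of `H^p` which are uniformly bounded and tend to `1`. -/
lemma exists_isTorusMultiplier_tendsto_one {p : ℝ} (hp : 0 < p) :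
    ∃ Λ : ℕ → ℕ+ →₀ ℂ, (∀ n, Tendsto (fun m => Λ m n) atTop (𝓝 1)) ∧
      ∀ m, IsTorusMultiplier p (ENNReal.ofReal (Real.exp 1)) (Λ m) := by
  have hfinite : ∀ m : ℕ, {q : Nat.Primes | (q : ℕ) ≤ m}.Finite := fun m =>
    Set.Finite.of_injOn (f := fun q : Nat.Primes => (q : ℕ)) (t := Set.Iic m)
      (fun q hq => hq) (fun a _ b _ h => Subtype.ext h) (Set.finite_Iic m)
  let T : ℕ → Finset Nat.Primes := fun m => (hfinite m).toFinset
  have hT : ∀ m q, q ∈ T m ↔ (q : ℕ) ≤ m := fun m q => by simp [T]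
  -- The cardinality of `T m` in the denominator keeps `(1 + η)^{|T|} ≤ e`; the term `m` forces `η →
  -- 0`.
  let η : ℕ → ℝ := fun m => 1 / ((T m).card + m + 1)
  have hη : ∀ m, 0 < η m := fun m => by positivity
  choose l K hl0 hl1 hlK hlm using fun m => exists_isDiscMultiplier hp (hη m) m
  let w : ℕ → ℕ+ → ℂ := fun m n => (∏ q ∈ T m, l m ((n : ℕ).factorization q)) *
    if ∀ q : Nat.Primes, m < (q : ℕ) → (n : ℕ).factorization q = 0 then 1 else 0
  have hw : ∀ m, IsTorusMultiplier p (ENNReal.ofReal (Real.exp 1)) (w m) := fun m P => by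
    refine (((IsTorusMultiplier.prod (T m) fun q _ => (hlm m).isTorusMultiplier q).mul
      (isTorusMultiplier_smooth hp m)) P).trans ?_
    gcongr
    rw [mul_one, ← ENNReal.ofReal_pow (by have := hη m; positivity)]
    refine ENNReal.ofReal_le_ofReal ?_
    calc (1 + η m) ^ (T m).card ≤ (Real.exp (η m)) ^ (T m).card := by
          have := hη m
          gcongr
          rw [add_comm]; exact Real.add_one_le_exp _
      _ = Real.exp ((T m).card * η m) := by rw [← Real.exp_nat_mul]
      _ ≤ Real.exp 1 := by
          refine Real.exp_le_exp.2 ?_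
          simp only [η]
          rw [mul_one_div, div_le_one (by positivity)]
          have : (0 : ℝ) ≤ m := by positivity
          linarith
  -- An `n` in the support has only prime factors `q ≤ m`, each with exponent at most `K m`, and
  -- every such `q` divides `m!`; hence `n` divides `(m!)^{K m}`.
  let L : ℕ → ℕ+ := fun m => ⟨(m.factorial) ^ (K m), by positivity⟩
  have hsupp : ∀ m n, w m n ≠ 0 → n ∈ Finset.Icc 1 (L m) := by
    intro m n hn
    have hsm := right_ne_zero_of_mul hn
    have hpr := left_ne_zero_of_mul hn
    rw [Finset.prod_ne_zero_iff] at hpr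
    rw [ite_ne_right_iff] at hsm
    refine Finset.mem_Icc.2 ⟨one_le, ?_⟩
    rw [← PNat.coe_le_coe]
    change (n : ℕ) ≤ m.factorial ^ K m
    refine Nat.le_of_dvd (by positivity) ?_
    rw [← Nat.factorization_prime_le_iff_dvd n.ne_zero (by positivity)]
    intro q hq
    rcases le_or_gt q m with h | h
    · have h1 : (n : ℕ).factorization q ≤ K m := by
        by_contra hcon
        exact hpr ⟨q, hq⟩ ((hT m _).2 h) (hlK m _ (not_le.1 hcon))
      rw [Nat.factorization_pow, Finsupp.smul_apply, smul_eq_mul]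
      have h2 : 1 ≤ (m.factorial).factorization q :=
        (hq.dvd_iff_one_le_factorization (Nat.factorial_ne_zero m)).1 (hq.dvd_factorial.2 h)
      nlinarith
    · rw [hsm.1 ⟨q, hq⟩ h]; exact Nat.zero_le _
  refine ⟨fun m => Finsupp.onFinset _ (w m) (hsupp m), fun n => ?_, hw⟩
  have hη0 : Tendsto η atTop (𝓝 0) := by
    refine squeeze_zero (fun m => (hη m).le) (fun m => ?_) tendsto_one_div_add_atTop_nhds_zero_nat
    simp only [η]
    gcongr
    have : (0 : ℝ) ≤ (T m).card := by positivity
    linarith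
  -- Once `m ≥ n`, the primes not dividing `n` contribute `l m 0 = 1`, so the product runs over a
  -- set of primes independent of `m` and each factor tends to `1`.
  have hlim : Tendsto (fun m => ∏ q ∈ primeSupport n,
      l m ((n : ℕ).factorization q)) atTop (𝓝 1) := by
    have : Tendsto (fun m => ∏ q ∈ primeSupport n,
      l m ((n : ℕ).factorization q)) atTop
        (𝓝 (∏ q ∈ primeSupport n, 1)) := by
      refine tendsto_finsetProd _ fun q _ => ?_
      rw [tendsto_iff_norm_sub_tendsto_zero]
      refine squeeze_zero' (Eventually.of_forall fun _ => norm_nonneg _) ?_ hη0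
      filter_upwards [eventually_ge_atTop (n : ℕ)] with m hm
      exact hl1 m _ ((Nat.factorization_lt _ n.ne_zero).le.trans hm)
    simpa using this
  refine hlim.congr' ?_
  filter_upwards [eventually_ge_atTop (n : ℕ)] with m hm
  change _ = w m n
  have hle : ∀ q : Nat.Primes, (n : ℕ).factorization q ≠ 0 → (q : ℕ) ≤ n := fun q hq =>
    Nat.le_of_dvd n.pos (Nat.dvd_of_factorization_pos hq)
  simp only [w]
  rw [if_pos, mul_one]
  · refine Finset.prod_subset (fun q hq => ?_) fun q _ hq => ?_
    · exact (hT m q).2 ((hle q (mem_primeSupport.1 hq)).trans hm)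
    · rw [mem_primeSupport, not_not] at hq
      rw [hq, hl0]
  · intro q hq
    by_contra hcon
    exact absurd ((hle q hcon).trans hm) (not_le.2 hq)

/-! ### Mixed norms for a general measure on the half line -/

/-- The mixed norm `(∫ ‖P_σ‖_{H^p}^q dκ(σ))^{1/q}`. -/
def mixNorm (p q : ℝ) (κ : Measure ℝ) (P : ℕ+ →₀ ℂ) : ℝ≥0∞ :=
  (∫⁻ σ, hardyPolyNorm p (translate σ P) ^ q ∂κ) ^ (1 / q)

/-! ### Algebra and measurability of coefficientwise products. -/

lemma translate_lmul (σ : ℝ) (P : ℕ+ →₀ ℂ) (b : ℕ+ → ℂ) :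
    translate σ (lmul P b) = lmul P fun n => b n * (((n : ℝ) ^ (-σ) : ℝ) : ℂ) := by
  ext n
  simp [translate_eq_lmul, mul_assoc]

lemma lmul_sub (P : ℕ+ →₀ ℂ) (b c : ℕ+ → ℂ) : lmul P (b - c) = lmul P b - lmul P c := by
  ext n; simp [mul_sub]

lemma add_lmul (P Q : ℕ+ →₀ ℂ) (b : ℕ+ → ℂ) : lmul (P + Q) b = lmul P b + lmul Q b := by
  ext n; simp [add_mul]

lemma sub_lmul (P Q : ℕ+ →₀ ℂ) (b : ℕ+ → ℂ) : lmul (P - Q) b = lmul P b - lmul Q b := by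
  ext n; simp [sub_mul]

lemma lmul_comm (P Q : ℕ+ →₀ ℂ) : lmul P Q = lmul Q P := by
  ext n; simp [mul_comm]

lemma lmul_lmul_right_comm (P : ℕ+ →₀ ℂ) (b c : ℕ+ → ℂ) :
    lmul (lmul P b) c = lmul (lmul P c) b := by
  ext n; simp [mul_right_comm]

lemma lmul_randomize {Ω : Type*} (P : ℕ+ →₀ ℂ) (X : ℕ+ → Ω → ℂ) (a : ℕ+ → ℂ) (ω : Ω) :
    lmul P (randomize X a ω) = lmul (lmul P a) fun n => X n ω := by
  ext n; simp [randomize, mul_assoc]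

lemma bohrLift_add (P Q : ℕ+ →₀ ℂ) (z : Nat.Primes → ℂ) :
    bohrLift (P + Q) z = bohrLift P z + bohrLift Q z :=
  Finsupp.sum_add_index' (fun _ => by simp) fun _ _ _ => add_mul _ _ _

lemma bohrLift_zero (z : Nat.Primes → ℂ) : bohrLift 0 z = 0 := Finsupp.sum_zero_index

section Measurability

variable {Y : Type*} [MeasurableSpace Y]

lemma measurable_bohrLift_lmul (P : ℕ+ →₀ ℂ) {b : Y → ℕ+ → ℂ} (hb : ∀ n,
    Measurable fun y => b y n) :
    Measurable fun x : Y × (Nat.Primes → ℂ) => bohrLift (lmul P (b x.1)) x.2 := by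
  simp only [bohrLift_lmul]
  refine Finset.measurable_sum _ fun n _ => ?_
  exact (((hb n).comp measurable_fst).const_mul _).mul
    ((measurable_bohrMonomial n).comp measurable_snd)

lemma measurable_hardyPolyNorm_lmul (p : ℝ) (P : ℕ+ →₀ ℂ) {b : Y → ℕ+ → ℂ}
    (hb : ∀ n, Measurable fun y => b y n) : Measurable fun y => hardyPolyNorm p (lmul P (b y)) :=
  (Measurable.lintegral_prod_right
    ((measurable_bohrLift_lmul P hb).enorm.pow_const p)).pow_const _

lemma measurable_natCast_rpow_neg (n : ℕ+) :
    Measurable fun σ : ℝ => (((n : ℝ) ^ (-σ) : ℝ) : ℂ) :=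
  Complex.measurable_ofReal.comp (measurable_const.pow measurable_neg)

lemma measurable_hardyPolyNorm_translate_lmul (p : ℝ) (P : ℕ+ →₀ ℂ) {b : Y → ℕ+ → ℂ}
    (hb : ∀ n, Measurable fun y => b y n) :
    Measurable fun x : Y × ℝ => hardyPolyNorm p (translate x.2 (lmul P (b x.1))) := by
  simp only [translate_lmul]
  exact measurable_hardyPolyNorm_lmul p P
    (b := fun x : Y × ℝ => fun n => b x.1 n * (((n : ℝ) ^ (-x.2) : ℝ) : ℂ))
    fun n => ((hb n).comp measurable_fst).mul ((measurable_natCast_rpow_neg n).comp measurable_snd)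

lemma measurable_mixNorm_lmul (p q : ℝ) (κ : Measure ℝ) [SFinite κ] (P : ℕ+ →₀ ℂ) {b : Y → ℕ+ → ℂ}
    (hb : ∀ n, Measurable fun y => b y n) : Measurable fun y => mixNorm p q κ (lmul P (b y)) :=
  (Measurable.lintegral_prod_right
    ((measurable_hardyPolyNorm_translate_lmul p P hb).pow_const q)).pow_const _

end Measurability

lemma measurable_hardyPolyNorm_translate (p : ℝ) (P : ℕ+ →₀ ℂ) :
    Measurable fun σ => hardyPolyNorm p (translate σ P) := by
  simp only [translate_eq_lmul]
  exact measurable_hardyPolyNorm_lmul p P measurable_natCast_rpow_neg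

/-! ### Subadditivity -/

/-- Minkowski's inequality in `L^{p/r}`, applied to the `r`-th powers. Used once on the torus and
once on the half line, it makes the `r`-th power of the mixed norm subadditive for `r ≤ min(p,q,1)`,
which is the source of the exponent in (e). -/
lemma lintegral_rpow_add_le {α : Type*} [MeasurableSpace α] {μ : Measure α} {f g h : α → ℝ≥0∞}
    {p r : ℝ} (hr : 0 < r) (hrp : r ≤ p) (hf : Measurable f) (hg : Measurable g)
    (hle : ∀ x, h x ^ r ≤ f x ^ r + g x ^ r) :
    ((∫⁻ x, h x ^ p ∂μ) ^ (1 / p)) ^ r ≤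
      ((∫⁻ x, f x ^ p ∂μ) ^ (1 / p)) ^ r + ((∫⁻ x, g x ^ p ∂μ) ^ (1 / p)) ^ r := by
  have hp : 0 < p := hr.trans_le hrp
  have key : ∀ k : α → ℝ≥0∞, ((∫⁻ x, k x ^ p ∂μ) ^ (1 / p)) ^ r =
      (∫⁻ x, (k x ^ r) ^ (p / r) ∂μ) ^ (1 / (p / r)) := fun k => by
    rw [← ENNReal.rpow_mul, one_div_div, one_div_mul_eq_div]
    congr 2 with x
    rw [← ENNReal.rpow_mul, mul_div_cancel₀ _ hr.ne']
  rw [key, key, key]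
  have h1 : 1 ≤ p / r := (one_le_div hr).2 hrp
  refine le_trans ?_ (ENNReal.lintegral_Lp_add_le (hf.pow_const r).aemeasurable
    (hg.pow_const r).aemeasurable h1)
  have : 0 < p / r := by positivity
  gcongr with x
  exact hle x

lemma hardyPolyNorm_add_rpow_le {p r : ℝ} (hr : 0 < r) (hr1 : r ≤ 1) (hrp : r ≤ p)
    (P Q : ℕ+ →₀ ℂ) :
    hardyPolyNorm p (P + Q) ^ r ≤ hardyPolyNorm p P ^ r + hardyPolyNorm p Q ^ r := by
  refine lintegral_rpow_add_le hr hrp (measurable_bohrLift P).enorm (measurable_bohrLift Q).enorm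
    fun z => ?_
  rw [bohrLift_add]
  exact (ENNReal.rpow_le_rpow (enorm_add_le _ _) hr.le).trans
    (ENNReal.rpow_add_le_add_rpow _ _ hr.le hr1)

lemma mixNorm_add_rpow_le {p q r : ℝ} (κ : Measure ℝ) (hr : 0 < r) (hr1 : r ≤ 1) (hrp : r ≤ p)
    (hrq : r ≤ q) (P Q : ℕ+ →₀ ℂ) :
    mixNorm p q κ (P + Q) ^ r ≤ mixNorm p q κ P ^ r + mixNorm p q κ Q ^ r := by
  refine lintegral_rpow_add_le hr hrq (measurable_hardyPolyNorm_translate p P)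
    (measurable_hardyPolyNorm_translate p Q) fun σ => ?_
  rw [translate_eq_lmul, add_lmul]
  exact hardyPolyNorm_add_rpow_le hr hr1 hrp _ _

lemma mixNorm_neg (p q : ℝ) (κ : Measure ℝ) (P : ℕ+ →₀ ℂ) :
    mixNorm p q κ (-P) = mixNorm p q κ P := by
  have h : ∀ Q z, bohrLift (-Q) z = -bohrLift Q z := fun Q z => by
    have := bohrLift_add Q (-Q) z
    rw [add_neg_cancel, bohrLift_zero] at this
    exact (neg_eq_of_add_eq_zero_right this.symm).symm
  have h2 : ∀ σ, translate σ (-P) = -translate σ P := fun σ => by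
    ext n; simp [translate_eq_lmul]
  simp [mixNorm, hardyPolyNorm, h, h2]

lemma mixNorm_sub_rpow_le {p q r : ℝ} (κ : Measure ℝ) (hr : 0 < r) (hr1 : r ≤ 1) (hrp : r ≤ p)
    (hrq : r ≤ q) (P Q : ℕ+ →₀ ℂ) :
    mixNorm p q κ (P - Q) ^ r ≤ mixNorm p q κ P ^ r + mixNorm p q κ Q ^ r := by
  rw [sub_eq_add_neg, ← mixNorm_neg p q κ Q]
  exact mixNorm_add_rpow_le κ hr hr1 hrp hrq _ _

lemma mixNorm_zero {p q : ℝ} (hp : 0 < p) (hq : 0 < q) (κ : Measure ℝ) : mixNorm p q κ 0 = 0 := by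
  have h2 : ∀ σ, translate σ 0 = 0 := fun σ => by ext n; simp [translate_eq_lmul]
  simp [mixNorm, hardyPolyNorm, h2, bohrLift_zero, hp, hq, ENNReal.zero_rpow_of_pos]

/-! ### Bounds by the coefficients -/

lemma hardyPolyNorm_le_sum {p : ℝ} (hp : 0 < p) {P : ℕ+ →₀ ℂ} {s : Finset ℕ+}
    (hs : P.support ⊆ s) : hardyPolyNorm p P ≤ ∑ n ∈ s, ‖P n‖ₑ := by
  rw [hardyPolyNorm, one_div, ENNReal.rpow_inv_le_iff hp]
  refine (lintegral_mono_ae (g := fun _ => (∑ n ∈ s, ‖P n‖ₑ) ^ p) ?_).trans (by simp)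
  filter_upwards [ae_norm_eq_one_torusMeasure] with z hz
  rw [bohrLift_eq_sum hs]
  refine ENNReal.rpow_le_rpow ((enorm_sum_le _ _).trans (Finset.sum_le_sum fun n _ => ?_)) hp.le
  rw [enorm_mul, ← ofReal_norm (bohrMonomial n z), norm_bohrMonomial n hz]
  simp

lemma enorm_mul_rpow_neg_le (n : ℕ+) {σ : ℝ} (hσ : 0 ≤ σ) (c : ℂ) :
    ‖c * (((n : ℝ) ^ (-σ) : ℝ) : ℂ)‖ₑ ≤ ‖c‖ₑ := by
  rw [enorm_mul, ← ofReal_norm (((n : ℝ) ^ (-σ) : ℝ) : ℂ), Complex.norm_real,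
    Real.norm_of_nonneg (by positivity)]
  refine mul_le_of_le_one_right' (ENNReal.ofReal_le_one.2 ?_)
  exact Real.rpow_le_one_of_one_le_of_nonpos (by exact_mod_cast n.pos) (by linarith)

/-- A crude bound by the coefficients, valid because `n^{-σ} ≤ 1` for `σ ≥ 0`. It serves for
finiteness and for limits within a fixed finite set of frequencies. -/
lemma mixNorm_le_sum {p q : ℝ} (hp : 0 < p) (hq : 0 < q) {κ : Measure ℝ} (hκ : ∀ᵐ σ ∂κ, 0 ≤ σ)
    {P : ℕ+ →₀ ℂ} {s : Finset ℕ+} (hs : P.support ⊆ s) :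
    mixNorm p q κ P ≤ (∑ n ∈ s, ‖P n‖ₑ) * κ Set.univ ^ (1 / q) := by
  rw [mixNorm, one_div, ENNReal.rpow_inv_le_iff hq, ENNReal.mul_rpow_of_nonneg _ _ hq.le,
    ← ENNReal.rpow_mul, inv_mul_cancel₀ hq.ne', ENNReal.rpow_one]
  refine (lintegral_mono_ae (g := fun _ => (∑ n ∈ s, ‖P n‖ₑ) ^ q) ?_).trans
    (by rw [lintegral_const])
  filter_upwards [hκ] with σ hσ
  refine ENNReal.rpow_le_rpow ?_ hq.le
  rw [translate_eq_lmul]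
  refine (hardyPolyNorm_le_sum hp (s := s) ?_).trans (Finset.sum_le_sum fun n _ => ?_)
  · exact Finsupp.support_onFinset_subset.trans hs
  · exact enorm_mul_rpow_neg_le n hσ _

lemma mixNorm_lt_top {p q : ℝ} (hp : 0 < p) (hq : 0 < q) {κ : Measure ℝ} [IsFiniteMeasure κ]
    (hκ : ∀ᵐ σ ∂κ, 0 ≤ σ) (P : ℕ+ →₀ ℂ) : mixNorm p q κ P < ⊤ := by
  refine (mixNorm_le_sum hp hq hκ (Finset.Subset.refl _)).trans_lt
    (ENNReal.mul_lt_top (ENNReal.sum_lt_top.2 fun n _ => enorm_lt_top) ?_)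
  exact ENNReal.rpow_lt_top_of_nonneg (by positivity) (measure_ne_top κ _)

/-! ### Multipliers and the completion -/

lemma IsTorusMultiplier.mixNorm_le {p q : ℝ} (hp : 0 < p) (hq : 0 < q) {B : ℝ≥0∞} {w : ℕ+ → ℂ}
    (hw : IsTorusMultiplier p B w) (κ : Measure ℝ) (P : ℕ+ →₀ ℂ) :
    mixNorm p q κ (lmul P w) ≤ B ^ (1 / p) * mixNorm p q κ P := by
  have h : ∀ σ, hardyPolyNorm p (translate σ (lmul P w)) ^ q ≤
      (B ^ (1 / p)) ^ q * hardyPolyNorm p (translate σ P) ^ q := fun σ => by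
    rw [← ENNReal.mul_rpow_of_nonneg _ _ hq.le]
    refine ENNReal.rpow_le_rpow ?_ hq.le
    rw [translate_eq_lmul, lmul_lmul_right_comm, ← translate_eq_lmul, hardyPolyNorm, hardyPolyNorm,
      ← ENNReal.mul_rpow_of_nonneg _ _ (by positivity)]
    exact ENNReal.rpow_le_rpow (hw _) (by positivity)
  calc mixNorm p q κ (lmul P w)
      ≤ (∫⁻ σ, (B ^ (1 / p)) ^ q * hardyPolyNorm p (translate σ P) ^ q ∂κ) ^ (1 / q) :=
        ENNReal.rpow_le_rpow (lintegral_mono h) (by positivity)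
    _ = _ := by
        rw [lintegral_const_mul _ ((measurable_hardyPolyNorm_translate p P).pow_const q),
          ENNReal.mul_rpow_of_nonneg _ _ (by positivity), ← ENNReal.rpow_mul,
          mul_one_div_cancel hq.ne', ENNReal.rpow_one]
        rfl

lemma isTorusMultiplier_two {w : ℕ+ → ℂ} (hw : ∀ n, ‖w n‖ ≤ 1) : IsTorusMultiplier 2 1 w :=
  fun P => by
    rw [lintegral_enorm_bohrLift_sq, lintegral_enorm_bohrLift_sq, one_mul]
    refine (Finset.sum_le_sum_of_subset (f := fun n => ‖lmul P w n‖ₑ ^ (2 : ℝ))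
      (Finsupp.support_onFinset_subset (s := P.support))).trans (Finset.sum_le_sum fun n _ => ?_)
    refine ENNReal.rpow_le_rpow ?_ (by norm_num)
    rw [lmul_apply, enorm_mul]
    refine mul_le_of_le_one_right' ?_
    rw [← ofReal_norm]
    exact ENNReal.ofReal_le_one.2 (hw n)

/-- All the differences are supported in the finite support of `Q`, so coefficientwise convergence
is convergence in norm. -/
lemma tendsto_mixNorm_lmul_sub {p q : ℝ} (hp : 0 < p) (hq : 0 < q) {κ : Measure ℝ}
    [IsFiniteMeasure κ] (hκ : ∀ᵐ σ ∂κ, 0 ≤ σ) (Q : ℕ+ →₀ ℂ) {P : ℕ → ℕ+ →₀ ℂ} {a : ℕ+ → ℂ}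
    (h : ∀ n, Tendsto (fun j => P j n) atTop (𝓝 (a n))) :
    Tendsto (fun j => mixNorm p q κ (lmul Q a - lmul Q (P j))) atTop (𝓝 0) := by
  have hbound : ∀ j, mixNorm p q κ (lmul Q a - lmul Q (P j)) ≤
      (∑ n ∈ Q.support, ‖Q n * (a n - P j n)‖ₑ) * κ Set.univ ^ (1 / q) := fun j => by
    rw [← lmul_sub]
    exact mixNorm_le_sum hp hq hκ Finsupp.support_onFinset_subset
  refine tendsto_of_tendsto_of_tendsto_of_le_of_le tendsto_const_nhds ?_ (fun _ => zero_le) hbound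
  have h0 : Tendsto (fun j => ∑ n ∈ Q.support, ‖Q n * (a n - P j n)‖ₑ) atTop (𝓝 0) := by
    rw [← Finset.sum_const_zero (s := Q.support)]
    refine tendsto_finsetSum _ fun n _ => ?_
    have : Tendsto (fun j => Q n * (a n - P j n)) atTop (𝓝 (Q n * (a n - a n))) :=
      (tendsto_const_nhds.sub (h n)).const_mul _
    simpa using this.enorm
  have h1 := ENNReal.Tendsto.mul_const (b := κ Set.univ ^ (1 / q)) h0
    (Or.inr (ENNReal.rpow_ne_top_of_nonneg (by positivity) (measure_ne_top κ _)))
  simpa using h1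

/-- A finitely supported multiplier sees finitely many coefficients, so its bound on polynomials
passes to the limit of any representing Cauchy sequence. With random coefficients the left side is
measurable, which makes it a usable lower bound for the norm of the completion. -/
lemma IsTorusMultiplier.mixNorm_le_completionNorm {p q : ℝ} (hp : 0 < p) (hq : 0 < q)
    {κ : Measure ℝ} [IsFiniteMeasure κ] (hκ : ∀ᵐ σ ∂κ, 0 ≤ σ) {B : ℝ≥0∞} (hB0 : B ≠ 0) (hB : B ≠ ⊤)
    {Q : ℕ+ →₀ ℂ} (hQ : IsTorusMultiplier p B Q) (a : ℕ+ → ℂ) :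
    mixNorm p q κ (lmul Q a) ≤ B ^ (1 / p) * completionNorm (mixNorm p q κ) a := by
  have hB' : B ^ (1 / p) ≠ ⊤ := ENNReal.rpow_ne_top_of_nonneg (by positivity) hB
  set r := min (min p q) 1 with hr_def
  have hr : 0 < r := lt_min (lt_min hp hq) one_pos
  have hr1 : r ≤ 1 := min_le_right _ _
  have hrp : r ≤ p := (min_le_left _ _).trans (min_le_left _ _)
  have hrq : r ≤ q := (min_le_left _ _).trans (min_le_right _ _)
  have main : ∀ P, Represents (mixNorm p q κ) P a → ∀ c, limsup (fun j => mixNorm p q κ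
      (P j)) atTop < c →
      mixNorm p q κ (lmul Q a) ≤ B ^ (1 / p) * c := fun P hP c hc => by
    rw [← ENNReal.rpow_le_rpow_iff hr]
    have ht := (((ENNReal.continuous_rpow_const (y := r)).tendsto _).comp
      (tendsto_mixNorm_lmul_sub hp hq hκ Q hP.2)).const_add ((B ^ (1 / p) * c) ^ r)
    rw [ENNReal.zero_rpow_of_pos hr, add_zero] at ht
    refine ge_of_tendsto ht ?_
    filter_upwards [eventually_lt_of_limsup_lt hc] with j hj
    have h1 := mixNorm_add_rpow_le κ hr hr1 hrp hrq (lmul Q (P j)) (lmul Q a - lmul Q (P j))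
    rw [add_sub_cancel] at h1
    refine h1.trans ?_
    simp only [Function.comp]
    gcongr
    rw [lmul_comm]
    exact (hQ.mixNorm_le hp hq κ (P j)).trans (by gcongr)
  rw [completionNorm]
  have h0 : B ^ (1 / p) ≠ 0 := by
    simp [ENNReal.rpow_eq_zero_iff, hB0, hp.not_gt]
  rw [← ENNReal.div_le_iff' h0 hB']
  refine le_iInf₂ fun P hP => le_of_forall_gt_imp_ge_of_dense fun c hc => ?_
  rw [ENNReal.div_le_iff' h0 hB']
  exact main P hP c hc

/-- Cauchy sequences are bounded, by subadditivity of the `r`-th power; outside the completion the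
infimum is over the empty set. -/
lemma mem_completionSpace_iff {p q : ℝ} (hp : 0 < p) (hq : 0 < q) {κ : Measure ℝ}
    [IsFiniteMeasure κ] (hκ : ∀ᵐ σ ∂κ, 0 ≤ σ) (a : ℕ+ → ℂ) :
    a ∈ completionSpace (mixNorm p q κ) ↔ completionNorm (mixNorm p q κ) a < ⊤ := by
  constructor
  · rintro ⟨P, hP⟩
    set r := min (min p q) 1 with hr_def
    have hr : 0 < r := lt_min (lt_min hp hq) one_pos
    have hr1 : r ≤ 1 := min_le_right _ _
    have hrp : r ≤ p := (min_le_left _ _).trans (min_le_left _ _)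
    have hrq : r ≤ q := (min_le_left _ _).trans (min_le_right _ _)
    obtain ⟨K, hK⟩ := hP.1 1 one_pos
    set C := (1 + mixNorm p q κ (P K) ^ r) ^ (1 / r) with hC
    have hCtop : C < ⊤ := ENNReal.rpow_lt_top_of_nonneg (by positivity) (ENNReal.add_ne_top.2
      ⟨ENNReal.one_ne_top, ENNReal.rpow_ne_top_of_nonneg hr.le (mixNorm_lt_top hp hq hκ _).ne⟩)
    refine (iInf₂_le P hP).trans_lt ((limsup_le_of_le ?_ ?_).trans_lt hCtop)
    · isBoundedDefault
    · filter_upwards [eventually_ge_atTop K] with j hj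
      rw [hC, one_div, ENNReal.le_rpow_inv_iff hr]
      have h1 := mixNorm_add_rpow_le κ hr hr1 hrp hrq (P j - P K) (P K)
      rw [sub_add_cancel] at h1
      refine h1.trans ?_
      gcongr
      exact ENNReal.rpow_le_one (hK j hj K le_rfl).le hr.le
  · intro h
    by_contra hne
    refine h.ne ?_
    rw [completionNorm, iInf₂_eq_top]
    exact fun P hP => absurd ⟨P, hP⟩ hne

/-! ### The case `p = 2` -/

/-- The norm of `H^{2,q}` of a Dirichlet series, in terms of its coefficients. -/
def sqNorm (q : ℝ) (κ : Measure ℝ) (a : ℕ+ → ℂ) : ℝ≥0∞ :=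
  (∫⁻ σ, (∑' n : ℕ+, ‖a n * (((n : ℝ) ^ (-σ) : ℝ) : ℂ)‖ₑ ^ (2 : ℝ)) ^ (q / 2) ∂κ) ^ (1 / q)

lemma hardyPolyNorm_two_translate (P : ℕ+ →₀ ℂ) (σ : ℝ) :
    hardyPolyNorm 2 (translate σ P) =
      (∑' n : ℕ+, ‖P n * (((n : ℝ) ^ (-σ) : ℝ) : ℂ)‖ₑ ^ (2 : ℝ)) ^ (1 / 2 : ℝ) := by
  rw [hardyPolyNorm_two, tsum_eq_sum (s := (translate σ P).support)]
  · rfl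
  · intro n hn
    rw [Finsupp.notMem_support_iff] at hn
    change P n * _ = 0 at hn
    rw [hn]; simp

lemma mixNorm_two (q : ℝ) (κ : Measure ℝ) (P : ℕ+ →₀ ℂ) : mixNorm 2 q κ P = sqNorm q κ P := by
  simp only [mixNorm, sqNorm, hardyPolyNorm_two_translate, ← ENNReal.rpow_mul]
  congr 3 with σ
  congr 1; ring

lemma sqNorm_mono {q : ℝ} (hq : 0 < q) (κ : Measure ℝ) {a b : ℕ+ → ℂ} (h : ∀ n, ‖a n‖ ≤ ‖b n‖) :
    sqNorm q κ a ≤ sqNorm q κ b := by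
  refine ENNReal.rpow_le_rpow (lintegral_mono fun σ => ENNReal.rpow_le_rpow
    (ENNReal.tsum_le_tsum fun n => ENNReal.rpow_le_rpow ?_ (by norm_num)) (by positivity))
    (by positivity)
  rw [enorm_mul, enorm_mul]
  gcongr
  rw [← ofReal_norm, ← ofReal_norm]
  exact ENNReal.ofReal_le_ofReal (h n)

lemma measurable_sqNorm_integrand (q : ℝ) (a : ℕ+ → ℂ) :
    Measurable fun σ : ℝ =>
      (∑' n : ℕ+, ‖a n * (((n : ℝ) ^ (-σ) : ℝ) : ℂ)‖ₑ ^ (2 : ℝ)) ^ (q / 2) :=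
  (Measurable.tsum fun n =>
    ((measurable_natCast_rpow_neg n).const_mul _).enorm.pow_const _).pow_const _

/-- Fatou's lemma twice: for the counting measure in `n`, then for `κ` in `σ`. -/
lemma sqNorm_le_of_tendsto {q : ℝ} (hq : 0 < q) (κ : Measure ℝ) {a : ℕ+ → ℂ} {b : ℕ → ℕ+ → ℂ}
    (h : ∀ n, Tendsto (fun m => b m n) atTop (𝓝 (a n))) {C : ℝ≥0∞}
    (hC : ∀ m, sqNorm q κ (b m) ≤ C) : sqNorm q κ a ≤ C := by
  rw [sqNorm, one_div, ENNReal.rpow_inv_le_iff hq]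
  have hle : ∀ σ : ℝ, (∑' n : ℕ+, ‖a n * (((n : ℝ) ^ (-σ) : ℝ) : ℂ)‖ₑ ^ (2 : ℝ)) ^ (q / 2) ≤
      liminf (fun m => (∑' n : ℕ+, ‖b m n * (((n : ℝ) ^ (-σ) : ℝ) : ℂ)‖ₑ ^ (2 : ℝ)) ^ (q / 2))
        atTop := fun σ => by
    have h1 : ∑' n : ℕ+, ‖a n * (((n : ℝ) ^ (-σ) : ℝ) : ℂ)‖ₑ ^ (2 : ℝ) ≤
        liminf (fun m => ∑' n : ℕ+, ‖b m n * (((n : ℝ) ^ (-σ) : ℝ) : ℂ)‖ₑ ^ (2 : ℝ)) atTop := by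
      let _ : MeasurableSpace ℕ+ := ⊤
      have : DiscreteMeasurableSpace ℕ+ := ⟨fun _ => trivial⟩
      simp only [← lintegral_count]
      refine le_trans (le_of_eq ?_) (lintegral_liminf_le fun m => measurable_of_countable _)
      refine lintegral_congr fun n => (Tendsto.liminf_eq ?_).symm
      exact ((ENNReal.continuous_rpow_const (y := 2)).tendsto _).comp
        ((h n).mul_const _).enorm
    refine (ENNReal.rpow_le_rpow h1 (by positivity)).trans (le_of_eq ?_)
    exact (ENNReal.orderIsoRpow (q / 2) (by positivity)).liminf_apply
  refine (lintegral_mono hle).trans ((lintegral_liminf_le fun m =>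
    measurable_sqNorm_integrand q (b m)).trans ?_)
  refine liminf_le_of_frequently_le' (Frequently.of_forall fun m => ?_)
  have := hC m
  rwa [sqNorm, one_div, ENNReal.rpow_inv_le_iff hq] at this

/-- The indicator function of `{n | n ≤ N}`. -/
def cutoff (N : ℕ+) : ℕ+ →₀ ℂ := partialSum N fun _ => 1

lemma partialSum_apply (N : ℕ+) (a : ℕ+ → ℂ) (n : ℕ+) :
    partialSum N a n = if n ≤ N then a n else 0 := by
  rw [partialSum, Finsupp.finsetSum_apply]
  simp only [Finsupp.single_apply, Finset.sum_ite_eq', Finset.mem_Icc]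
  simp

lemma partialSum_eq_lmul (N : ℕ+) (a : ℕ+ → ℂ) : partialSum N a = lmul (cutoff N) a := by
  ext n; simp [partialSum_apply, cutoff]

lemma isTorusMultiplier_cutoff (N : ℕ+) : IsTorusMultiplier 2 1 (cutoff N) :=
  isTorusMultiplier_two fun n => by
    rw [cutoff, partialSum_apply]; split_ifs <;> simp

lemma tendsto_succPNat : Tendsto Nat.succPNat atTop atTop :=
  tendsto_atTop.2 fun N => by
    filter_upwards [eventually_ge_atTop (N : ℕ)] with m hm
    rw [← PNat.coe_le_coe, Nat.succPNat_coe]; omega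

lemma tendsto_partialSum_apply (a : ℕ+ → ℂ) (n : ℕ+) :
    Tendsto (fun N => partialSum N a n) atTop (𝓝 (a n)) :=
  tendsto_const_nhds.congr' <| by
    filter_upwards [eventually_ge_atTop n] with N hN
    rw [partialSum_apply, if_pos hN]

/-- Dominated convergence twice: in `σ`, and in `n` at each `σ` where the full series is finite. The
tails are dominated by the series itself. -/
lemma tendsto_sqNorm_tail {q : ℝ} (hq : 0 < q) (κ : Measure ℝ) {a : ℕ+ → ℂ}
    (ha : sqNorm q κ a < ⊤) :
    Tendsto (fun m : ℕ => sqNorm q κ (a - partialSum m.succPNat a)) atTop (𝓝 0) := by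
  have hle : ∀ m n, ‖(a - partialSum (Nat.succPNat m) a) n‖ ≤ ‖a n‖ := fun m n => by
    rw [Pi.sub_apply, partialSum_apply]; split_ifs <;> simp
  have hfin : ∫⁻ σ, (∑' n : ℕ+, ‖a n * (((n : ℝ) ^ (-σ) : ℝ) : ℂ)‖ₑ ^ (2 : ℝ)) ^ (q / 2) ∂κ < ⊤
      := by
    rw [sqNorm, ENNReal.rpow_lt_top_iff_of_pos (by positivity)] at ha
    exact ha
  have hmono : ∀ (m : ℕ) (σ : ℝ) (n : ℕ+),
      ‖(a - partialSum (Nat.succPNat m) a) n * (((n : ℝ) ^ (-σ) : ℝ) : ℂ)‖ₑ ^ (2 : ℝ) ≤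
        ‖a n * (((n : ℝ) ^ (-σ) : ℝ) : ℂ)‖ₑ ^ (2 : ℝ) := fun m σ n => by
    refine ENNReal.rpow_le_rpow ?_ (by norm_num)
    rw [enorm_mul, enorm_mul]
    gcongr
    rw [← ofReal_norm, ← ofReal_norm]
    exact ENNReal.ofReal_le_ofReal (hle m n)
  have h1 := tendsto_lintegral_of_dominated_convergence
    (F := fun m σ => (∑' n : ℕ+, ‖(a - partialSum (Nat.succPNat m) a) n *
      (((n : ℝ) ^ (-σ) : ℝ) : ℂ)‖ₑ ^ (2 : ℝ)) ^ (q / 2)) (f := fun _ => 0)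
    (fun σ => (∑' n : ℕ+, ‖a n * (((n : ℝ) ^ (-σ) : ℝ) : ℂ)‖ₑ ^ (2 : ℝ)) ^ (q / 2))
    (fun m => measurable_sqNorm_integrand q _)
    (fun m => Eventually.of_forall fun σ => ENNReal.rpow_le_rpow
      (ENNReal.tsum_le_tsum (hmono m σ)) (by positivity)) hfin.ne ?_ (μ := κ)
  · have h2 := ((ENNReal.continuous_rpow_const (y := 1 / q)).tendsto _).comp h1
    simpa [ENNReal.zero_rpow_of_pos (inv_pos.2 hq), Function.comp_def, sqNorm] using h2
  · filter_upwards [ae_lt_top (measurable_sqNorm_integrand q a) hfin.ne] with σ hσ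
    rw [ENNReal.rpow_lt_top_iff_of_pos (by positivity)] at hσ
    let _ : MeasurableSpace ℕ+ := ⊤
    have : DiscreteMeasurableSpace ℕ+ := ⟨fun _ => trivial⟩
    have h3 := tendsto_lintegral_of_dominated_convergence (μ := (Measure.count : Measure ℕ+))
      (F := fun m n => ‖(a - partialSum (Nat.succPNat m) a) n *
        (((n : ℝ) ^ (-σ) : ℝ) : ℂ)‖ₑ ^ (2 : ℝ)) (f := fun _ => 0)
      (fun n => ‖a n * (((n : ℝ) ^ (-σ) : ℝ) : ℂ)‖ₑ ^ (2 : ℝ))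
      (fun m => measurable_of_countable _)
      (fun m => Eventually.of_forall fun n => hmono m σ n) (by rw [lintegral_count]; exact hσ.ne)
      (Eventually.of_forall fun n => ?_)
    · simp only [lintegral_count] at h3
      have h4 := ((ENNReal.continuous_rpow_const (y := q / 2)).tendsto _).comp h3
      simpa [ENNReal.zero_rpow_of_pos (half_pos hq), Function.comp_def] using h4
    · refine tendsto_const_nhds.congr' ?_
      filter_upwards [tendsto_succPNat.eventually (eventually_ge_atTop n)] with m hm
      rw [Pi.sub_apply, partialSum_apply, if_pos hm]
      simp

/-- A sequence of indices along which the partial sums of a series of `H^{2,q}` are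
`ε`-close to each other. -/
lemma exists_sqNorm_partialSum_sub_le {q : ℝ} (hq : 0 < q) (κ : Measure ℝ) {a : ℕ+ → ℂ}
    (ha : sqNorm q κ a < ⊤) {ε : ℝ≥0∞} (hε : 0 < ε) :
    ∃ K : ℕ, ∀ j ≥ K, ∀ k ≥ K,
      sqNorm q κ ⇑(partialSum (Nat.succPNat j) a - partialSum (Nat.succPNat k) a) < ε := by
  obtain ⟨K, hK⟩ := ((tendsto_sqNorm_tail hq κ ha).eventually_lt_const hε).exists
  refine ⟨K, fun j hj k hk => (sqNorm_mono hq κ fun n => ?_).trans_lt hK⟩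
  have hj' : Nat.succPNat K ≤ Nat.succPNat j := Nat.succPNat_le_succPNat.2 hj
  have hk' : Nat.succPNat K ≤ Nat.succPNat k := Nat.succPNat_le_succPNat.2 hk
  rw [Finsupp.sub_apply, Pi.sub_apply, partialSum_apply, partialSum_apply, partialSum_apply]
  by_cases hn : n ≤ Nat.succPNat K
  · simp [hn, hn.trans hj', hn.trans hk']
  · rw [if_neg hn]
    split_ifs <;> simp

/-- For `p = 2` truncation is contractive by Parseval, so the partial sums are bounded by the norm
of the completion; conversely, a finite norm makes them Cauchy. -/
lemma mem_completionSpace_two_iff {q : ℝ} (hq : 0 < q) {κ : Measure ℝ} [IsFiniteMeasure κ]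
    (hκ : ∀ᵐ σ ∂κ, 0 ≤ σ) (a : ℕ+ → ℂ) :
    a ∈ completionSpace (mixNorm 2 q κ) ↔ sqNorm q κ a < ⊤ := by
  constructor
  · intro h
    have hfin := (mem_completionSpace_iff two_pos hq hκ a).1 h
    refine (sqNorm_le_of_tendsto hq κ (b := fun m => partialSum (Nat.succPNat m) a) (fun n =>
      (tendsto_partialSum_apply a n).comp tendsto_succPNat) fun m => ?_).trans_lt hfin
    have := (isTorusMultiplier_cutoff (Nat.succPNat m)).mixNorm_le_completionNorm two_pos hq hκ
      one_ne_zero ENNReal.one_ne_top a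
    rwa [ENNReal.one_rpow, one_mul, ← partialSum_eq_lmul, mixNorm_two] at this
  · intro h
    refine ⟨fun m => partialSum (Nat.succPNat m) a, fun ε hε => ?_, fun n =>
      (tendsto_partialSum_apply a n).comp tendsto_succPNat⟩
    obtain ⟨K, hK⟩ := exists_sqNorm_partialSum_sub_le hq κ h hε
    exact ⟨K, fun j hj k hk => by rw [mixNorm_two]; exact hK j hj k hk⟩

/-- Since `κ ≠ 0`, some `σ` satisfies `∑ |a_n|² n^{-2σ} < ∞`. The inequality `xy ≤ x² + y²` with `y
= n^{-(Re s - σ)}` then gives absolute convergence for `Re s > σ + 1/2`. -/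
lemma mem_dirichletSeries_of_sqNorm_lt_top {q : ℝ} (hq : 0 < q) {κ : Measure ℝ} (hκ0 : κ ≠ 0)
    {a : ℕ+ → ℂ} (ha : sqNorm q κ a < ⊤) : a ∈ dirichletSeries := by
  have hfin : ∫⁻ σ, (∑' n : ℕ+, ‖a n * (((n : ℝ) ^ (-σ) : ℝ) : ℂ)‖ₑ ^ (2 : ℝ)) ^ (q / 2) ∂κ ≠ ⊤
      := by
    rw [sqNorm, ENNReal.rpow_lt_top_iff_of_pos (by positivity)] at ha
    exact ha.ne
  have : (ae κ).NeBot := ae_neBot.2 hκ0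
  obtain ⟨σ, hσ⟩ := (ae_lt_top (measurable_sqNorm_integrand q a) hfin).exists
  rw [ENNReal.rpow_lt_top_iff_of_pos (by positivity)] at hσ
  have hsum : Summable fun n : ℕ+ => ‖a n * (((n : ℝ) ^ (-σ) : ℝ) : ℂ)‖ ^ 2 := by
    have h1 : ∀ n : ℕ+, ‖a n * (((n : ℝ) ^ (-σ) : ℝ) : ℂ)‖ₑ ^ (2 : ℝ) =
        ENNReal.ofReal (‖a n * (((n : ℝ) ^ (-σ) : ℝ) : ℂ)‖ ^ 2) := fun n => by
      rw [enorm_rpow_eq_ofReal _ two_pos, Real.rpow_two]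
    simp only [h1] at hσ
    have h2 := ENNReal.summable_toReal hσ.ne
    refine h2.congr fun n => ENNReal.toReal_ofReal (by positivity)
  refine ⟨σ + 1 / 2, fun s hs => ?_⟩
  have hsum2 : Summable fun n : ℕ+ => ((n : ℝ) ^ (-(s.re - σ))) ^ 2 := by
    have h1 : Summable fun n : ℕ => (n : ℝ) ^ (-(s.re - σ) * 2) :=
      Real.summable_nat_rpow.2 (by linarith)
    have h2 := h1.comp_injective PNat.coe_injective
    refine h2.congr fun n => ?_
    simp only [Function.comp]
    rw [Real.rpow_mul (by positivity), Real.rpow_two]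
  have hs3 : Summable fun n : ℕ+ => a n * ((n : ℕ) : ℂ) ^ (-s) := by
    refine Summable.of_norm_bounded (hsum.add hsum2) fun n => ?_
    have hn : (0 : ℝ) < n := by exact_mod_cast n.pos
    have h1 : ‖a n * ((n : ℕ) : ℂ) ^ (-s)‖ =
        ‖a n * (((n : ℝ) ^ (-σ) : ℝ) : ℂ)‖ * (n : ℝ) ^ (-(s.re - σ)) := by
      rw [norm_mul, norm_mul, Complex.norm_natCast_cpow_of_pos n.pos, Complex.norm_real,
        Real.norm_of_nonneg (by positivity), mul_assoc, ← Real.rpow_add hn]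
      congr 2
      rw [Complex.neg_re]; ring
    rw [h1]
    set x := ‖a n * (((n : ℝ) ^ (-σ) : ℝ) : ℂ)‖
    set y := (n : ℝ) ^ (-(s.re - σ))
    nlinarith [sq_nonneg (x - y), sq_nonneg x, sq_nonneg y]
  refine ⟨_, hs3.hasSum.comp (tendsto_atTop_finset_of_monotone (fun N M h =>
    Finset.Icc_subset_Icc le_rfl h) fun n => ⟨n, Finset.mem_Icc.2 ⟨one_le, le_rfl⟩⟩)⟩

lemma sqNorm_dirac_lt_top_iff (a : ℕ+ → ℂ) : sqNorm 1 (Measure.dirac 0) a < ⊤ ↔ a ∈ hardyTwo := by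
  rw [sqNorm, lintegral_dirac' _ (measurable_sqNorm_integrand 1 a),
    ENNReal.rpow_lt_top_iff_of_pos (by norm_num), ENNReal.rpow_lt_top_iff_of_pos (by norm_num)]
  have h1 : ∀ n : ℕ+, ‖a n * (((n : ℝ) ^ (-(0 : ℝ)) : ℝ) : ℂ)‖ₑ ^ (2 : ℝ) =
      ENNReal.ofReal (‖a n‖ ^ 2) := fun n => by
    rw [neg_zero, Real.rpow_zero, Complex.ofReal_one, mul_one, enorm_rpow_eq_ofReal _ two_pos,
      Real.rpow_two]
  simp only [h1, hardyTwo, Set.mem_ofPred_eq]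
  constructor
  · intro h
    refine (ENNReal.summable_toReal h.ne).congr fun n => ENNReal.toReal_ofReal (by positivity)
  · intro h
    rw [← ENNReal.ofReal_tsum_of_nonneg (fun n => by positivity) h]
    exact ENNReal.ofReal_lt_top

/-! ### Standard random variables -/

/-- Normalized complex laws with sub-Gaussian real linear images. -/
structure IsSubgaussianLaw (L : Measure ℂ) : Prop where
  prob : IsProbabilityMeasure L
  mean : ∫ z, z ∂L = 0
  sq : ∫ z, ‖z‖ ^ 2 ∂L = 1
  subgaussian : ∀ c : ℂ, HasSubgaussianMGF (fun z => (c * z).re) (‖c‖₊ ^ 2) L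

/-- Hoeffding's lemma: `Re (cz)` is centred and lies in `[-|c|, |c|]`, and the variance proxy is the
square of half the length of this interval. -/
lemma isSubgaussianLaw_of_norm_eq_one {L : Measure ℂ} [IsProbabilityMeasure L]
    (h1 : ∀ᵐ z ∂L, ‖z‖ = 1) (h0 : ∫ z, z ∂L = 0) : IsSubgaussianLaw L where
  prob := inferInstance
  mean := h0
  sq := by
    rw [integral_congr_ae (g := fun _ => (1 : ℝ)) (by filter_upwards [h1] with z hz; simp [hz])]
    simp
  subgaussian c := by
    have hint : Integrable (fun z => c * z) L := by
      refine Integrable.of_bound (by fun_prop) ‖c‖ ?_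
      filter_upwards [h1] with z hz
      simp [hz]
    have := hasSubgaussianMGF_of_mem_Icc_of_integral_eq_zero (μ := L) (X := fun z => (c * z).re)
      (a := -‖c‖) (b := ‖c‖) (by fun_prop) ?_ ?_
    · convert this using 1
      rw [sub_neg_eq_add, ← two_mul, nnnorm_mul, nnnorm_norm]
      simp
    · filter_upwards [h1] with z hz
      have h2 := Complex.abs_re_le_norm (c * z)
      rw [norm_mul, hz, mul_one] at h2
      exact abs_le.1 h2
    · have h2 := integral_re hint
      simp only [RCLike.re_to_complex] at h2
      rw [h2, integral_const_mul, h0]; simp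

lemma isSubgaussianLaw_circleLaw : IsSubgaussianLaw circleLaw :=
  isSubgaussianLaw_of_norm_eq_one ae_norm_eq_one_circleLaw (by
    simpa using integral_pow_mul_conj_pow 1 0)

lemma isSubgaussianLaw_bernoulliLaw : IsSubgaussianLaw bernoulliLaw := by
  have : IsProbabilityMeasure bernoulliLaw := ⟨by
    simp [bernoulliLaw, ENNReal.inv_two_add_inv_two]⟩
  refine isSubgaussianLaw_of_norm_eq_one ?_ ?_
  · have hm : MeasurableSet {z : ℂ | ‖z‖ = 1}
      := measurableSet_eq_fun measurable_norm measurable_const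
    rw [bernoulliLaw, ae_add_measure_iff]
    constructor <;> refine Measure.ae_smul_measure ?_ _
    · rw [ae_dirac_iff hm]; simp
    · rw [ae_dirac_iff hm]; simp
  · have hi : ∀ w : ℂ, Integrable (fun z : ℂ => z) (Measure.dirac w) := fun w =>
      integrable_dirac (by simp)
    rw [bernoulliLaw, integral_add_measure ((hi _).smul_measure (by simp))
      ((hi _).smul_measure (by simp)), integral_smul_measure, integral_smul_measure,
      integral_dirac, integral_dirac]
    simp

/-- Here `Re (cx) = (Re c) x` is Gaussian of variance `(Re c)² ≤ |c|²`. -/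
lemma isSubgaussianLaw_gaussianLaw : IsSubgaussianLaw gaussianLaw := by
  have hm : AEMeasurable (fun x : ℝ => (x : ℂ)) (gaussianReal 0 1) := by fun_prop
  refine ⟨Measure.isProbabilityMeasure_map hm, ?_, ?_, fun c => ?_⟩
  · rw [gaussianLaw, integral_map hm (by fun_prop), integral_complex_ofReal,
      integral_id_gaussianReal, Complex.ofReal_zero]
  · rw [gaussianLaw, integral_map hm (by fun_prop)]
    have := variance_eq_integral (X := fun x : ℝ => x) (μ := gaussianReal 0 1) (by fun_prop)
    rw [variance_fun_id_gaussianReal, integral_id_gaussianReal] at this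
    simpa using this.symm
  · have hmeas : Measurable fun z : ℂ => (c * z).re := by fun_prop
    have hcomp : ∀ x : ℝ, (c * (x : ℂ)).re = c.re * x := fun x => by simp
    have hmgf : ∀ t, mgf (fun x : ℝ => c.re * x) (gaussianReal 0 1) t =
        Real.exp ((c.re * t) ^ 2 / 2) := fun t => by
      have := mgf_gaussianReal (p := gaussianReal 0 1) (X := fun x : ℝ => x) (μ := 0) (v := 1)
        (by simp) (c.re * t)
      rw [mgf] at this ⊢
      rw [show Real.exp ((c.re * t) ^ 2 / 2) = Real.exp (0 * (c.re * t) + ↑(1 : ℝ≥0) *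
          (c.re * t) ^ 2 / 2)
        by simp, ← this]
      congr 1 with x
      ring_nf
    constructor
    · intro t
      rw [gaussianLaw, integrable_map_measure (by fun_prop) hm]
      have := integrable_exp_mul_gaussianReal (μ := 0) (v := 1) (t * c.re)
      refine this.congr (Eventually.of_forall fun x => ?_)
      simp [mul_assoc]
    · intro t
      rw [gaussianLaw, mgf, integral_map hm (by fun_prop)]
      have h := hmgf t
      rw [mgf] at h
      simp only [hcomp]
      rw [h]
      refine Real.exp_le_exp.2 ?_
      have : c.re ^ 2 ≤ ‖c‖ ^ 2 := by
        rw [← sq_abs c.re]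
        exact pow_le_pow_left₀ (abs_nonneg _) (Complex.abs_re_le_norm c) 2
      push_cast
      rw [mul_pow]
      gcongr

section Sums

variable {Ω : Type*} [MeasurableSpace Ω] {μ : Measure Ω} {X : ℕ+ → Ω → ℂ}

lemma IsStandardRandomSequence.isSubgaussianLaw (hX : IsStandardRandomSequence X μ) (n : ℕ+) :
    IsSubgaussianLaw (μ.map (X n)) := by
  rcases hX.law with h | h | h <;> rw [h n]
  · exact isSubgaussianLaw_bernoulliLaw
  · exact isSubgaussianLaw_circleLaw
  · exact isSubgaussianLaw_gaussianLaw

lemma IsStandardRandomSequence.hasSubgaussianMGF (hX : IsStandardRandomSequence X μ) (n : ℕ+)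
    (c : ℂ) : HasSubgaussianMGF (fun ω => (c * X n ω).re) (‖c‖₊ ^ 2) μ :=
  HasSubgaussianMGF.of_map (Y := X n) (X := fun z => (c * z).re) (hX.measurable n).aemeasurable
    ((hX.isSubgaussianLaw n).subgaussian c)

lemma IsStandardRandomSequence.hasSubgaussianMGF_sum (hX : IsStandardRandomSequence X μ)
    (s : Finset ℕ+) (c : ℕ+ → ℂ) :
    HasSubgaussianMGF (fun ω => (∑ n ∈ s, c n * X n ω).re) (∑ n ∈ s, ‖c n‖₊ ^ 2) μ := by
  simp only [Complex.re_sum]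
  exact HasSubgaussianMGF.sum_of_iIndepFun
    (hX.indep.comp (fun n z => (c n * z).re) fun n => by fun_prop)
    fun n _ => hX.hasSubgaussianMGF n (c n)

/-- Real and imaginary parts are the sub-Gaussian variables `Re (cX)` with `c = 1` and `c = -i`. -/
lemma IsStandardRandomSequence.memLp (hX : IsStandardRandomSequence X μ) (n : ℕ+) :
    MemLp (X n) 2 μ := by
  have h1 := (hX.hasSubgaussianMGF n 1).memLp 2
  have h2 := (hX.hasSubgaussianMGF n (-Complex.I)).memLp 2
  have h3 := h1.ofReal (K := ℂ) |>.add ((h2.ofReal (K := ℂ)).const_mul Complex.I)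
  refine h3.ae_eq (Eventually.of_forall fun ω => ?_)
  simp [mul_comm Complex.I, Complex.re_add_im]

lemma IsStandardRandomSequence.integral_eq_zero (hX : IsStandardRandomSequence X μ) (n : ℕ+) :
    ∫ ω, X n ω ∂μ = 0 := by
  have := (hX.isSubgaussianLaw n).mean
  rwa [integral_map (hX.measurable n).aemeasurable (by fun_prop)] at this

lemma IsStandardRandomSequence.integral_norm_sq (hX : IsStandardRandomSequence X μ) (n : ℕ+) :
    ∫ ω, ‖X n ω‖ ^ 2 ∂μ = 1 := by
  have := (hX.isSubgaussianLaw n).sq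
  rwa [integral_map (hX.measurable n).aemeasurable (by fun_prop)] at this

lemma IsStandardRandomSequence.integrable_mul_conj (hX : IsStandardRandomSequence X μ) (n m : ℕ+) :
    Integrable (fun ω => X n ω * (starRingEnd ℂ) (X m ω)) μ := by
  have h : MemLp (fun ω => (starRingEnd ℂ) (X m ω)) 2 μ := (hX.memLp m).star
  exact (hX.memLp n).integrable_mul h

lemma IsStandardRandomSequence.integral_mul_conj [IsProbabilityMeasure μ]
    (hX : IsStandardRandomSequence X μ) (n m : ℕ+) :
    ∫ ω, X n ω * (starRingEnd ℂ) (X m ω) ∂μ = if n = m then 1 else 0 := by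
  split_ifs with h
  · subst h
    simp only [Complex.mul_conj', ← Complex.ofReal_pow]
    rw [integral_complex_ofReal, hX.integral_norm_sq, Complex.ofReal_one]
  · have hi : IndepFun (X n) (fun ω => (starRingEnd ℂ) (X m ω)) μ :=
      (hX.indep.indepFun h).comp measurable_id Complex.continuous_conj.measurable
    rw [hi.integral_fun_mul_eq_mul_integral (hX.measurable n).aestronglyMeasurable
      (Complex.continuous_conj.measurable.comp (hX.measurable m)).aestronglyMeasurable,
      hX.integral_eq_zero, zero_mul]

lemma IsStandardRandomSequence.measurable_sum (hX : IsStandardRandomSequence X μ)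
    (s : Finset ℕ+) (c : ℕ+ → ℂ) : Measurable fun ω => ∑ n ∈ s, c n * X n ω :=
  Finset.measurable_sum _ fun n _ => (hX.measurable n).const_mul _

lemma IsStandardRandomSequence.lintegral_enorm_sum_sq [IsProbabilityMeasure μ]
    (hX : IsStandardRandomSequence X μ) (s : Finset ℕ+) (c : ℕ+ → ℂ) :
    ∫⁻ ω, ‖∑ n ∈ s, c n * X n ω‖ₑ ^ (2 : ℝ) ∂μ = ∑ n ∈ s, ‖c n‖ₑ ^ (2 : ℝ) :=
  lintegral_enorm_sum_sq_of_orthonormal (fun n m => hX.integrable_mul_conj n m)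
    (fun n m => hX.integral_mul_conj n m) s c

/-- The constant in the moment bounds. -/
def momentConst : ℝ≥0∞ := ENNReal.ofReal (2 * Real.exp 2)

/-- From `|S| ≤ |Re S| + |Im S|` and `xy ≤ (x² + y²)/2`, the exponential is at most half the sum of
four one-sided exponentials of `±(2/w) Re S` and `±(2/w) Im S`. Each has mean at most `exp(w² (2/w)²
/ 2) = e²`, whence the constant `2e²`. -/
lemma IsStandardRandomSequence.lintegral_exp_le [IsProbabilityMeasure μ]
    (hX : IsStandardRandomSequence X μ) (s : Finset ℕ+) (c : ℕ+ → ℂ) {w : ℝ} (hw : 0 < w)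
    (hwc : ∑ n ∈ s, ‖c n‖ ^ 2 = w ^ 2) :
    ∫⁻ ω, ENNReal.ofReal (Real.exp (‖∑ n ∈ s, c n * X n ω‖ / w)) ∂μ ≤ momentConst := by
  have key : ∀ d : ℕ+ → ℂ, (∑ n ∈ s, ‖d n‖ ^ 2 = w ^ 2) → ∀ t : ℝ, t ^ 2 = (2 / w) ^ 2 →
      ∫⁻ ω, ENNReal.ofReal (Real.exp (t * (∑ n ∈ s, d n * X n ω).re)) ∂μ ≤
        ENNReal.ofReal (Real.exp 2) := fun d hd t ht => by
    have h := hX.hasSubgaussianMGF_sum s d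
    rw [← ofReal_integral_eq_lintegral_ofReal (h.integrable_exp_mul t)
      (Eventually.of_forall fun ω => (Real.exp_pos _).le)]
    refine ENNReal.ofReal_le_ofReal ((h.mgf_le t).trans (le_of_eq ?_))
    push_cast
    rw [hd, ht, div_pow, mul_div_cancel₀ _ (by positivity)]
    norm_num
  have him : ∀ ω, (∑ n ∈ s, c n * X n ω).im = (∑ n ∈ s, (-Complex.I * c n) * X n ω).re
      := fun ω => by
    rw [Complex.im_sum, Complex.re_sum]
    refine Finset.sum_congr rfl fun n _ => ?_
    simp [mul_assoc]
  have hd : ∑ n ∈ s, ‖-Complex.I * c n‖ ^ 2 = w ^ 2 := by simpa using hwc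
  set S : Ω → ℂ := fun ω => ∑ n ∈ s, c n * X n ω with hS
  set S' : Ω → ℂ := fun ω => ∑ n ∈ s, (-Complex.I * c n) * X n ω with hS'
  have hpt : ∀ ω, Real.exp (‖S ω‖ / w) ≤ (1 / 2) * ((Real.exp (2 / w * (S ω).re) +
      Real.exp (-(2 / w) * (S ω).re)) + (Real.exp (2 / w * (S' ω).re) +
      Real.exp (-(2 / w) * (S' ω).re))) := fun ω => by
    have habs : ∀ x : ℝ, Real.exp (2 / w * |x|) ≤ Real.exp (2 / w * x) + Real.exp (-(2 / w) * x) :=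
      fun x => by
        rcases abs_cases x with ⟨h, _⟩ | ⟨h, _⟩ <;> rw [h]
        · linarith [Real.exp_pos (-(2 / w) * x)]
        · rw [mul_neg, ← neg_mul]; linarith [Real.exp_pos (2 / w * x)]
    have h1 : ‖S ω‖ ≤ |(S ω).re| + |(S' ω).re| := by
      rw [← him]; exact Complex.norm_le_abs_re_add_abs_im _
    set x := Real.exp (|(S ω).re| / w)
    set y := Real.exp (|(S' ω).re| / w)
    have h2 : Real.exp (‖S ω‖ / w) ≤ x * y := by
      rw [← Real.exp_add, ← add_div]
      exact Real.exp_le_exp.2 (by gcongr)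
    have hx : x ^ 2 = Real.exp (2 / w * |(S ω).re|) := by
      rw [← Real.exp_nat_mul]; congr 1; push_cast; ring
    have hy : y ^ 2 = Real.exp (2 / w * |(S' ω).re|) := by
      rw [← Real.exp_nat_mul]; congr 1; push_cast; ring
    have := habs (S ω).re
    have := habs (S' ω).re
    nlinarith [sq_nonneg (x - y)]
  have hSm : Measurable S := hX.measurable_sum s c
  have hSm' : Measurable S' := hX.measurable_sum s _
  have hm : ∀ t : ℝ, Measurable fun ω => ENNReal.ofReal (Real.exp (t * (S ω).re)) := fun t => by
    fun_prop
  have hm' : ∀ t : ℝ, Measurable fun ω => ENNReal.ofReal (Real.exp (t * (S' ω).re)) := fun t => by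
    fun_prop
  calc ∫⁻ ω, ENNReal.ofReal (Real.exp (‖S ω‖ / w)) ∂μ
      ≤ ∫⁻ ω, ENNReal.ofReal (1 / 2) * ((ENNReal.ofReal (Real.exp (2 / w * (S ω).re)) +
          ENNReal.ofReal (Real.exp (-(2 / w) * (S ω).re))) +
          (ENNReal.ofReal (Real.exp (2 / w * (S' ω).re)) +
          ENNReal.ofReal (Real.exp (-(2 / w) * (S' ω).re)))) ∂μ := by
        refine lintegral_mono fun ω => ?_
        rw [← ENNReal.ofReal_add (by positivity) (by positivity),
          ← ENNReal.ofReal_add (by positivity) (by positivity),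
          ← ENNReal.ofReal_add (by positivity) (by positivity), ← ENNReal.ofReal_mul (by norm_num)]
        exact ENNReal.ofReal_le_ofReal (hpt ω)
    _ ≤ ENNReal.ofReal (1 / 2) * ((ENNReal.ofReal (Real.exp 2) + ENNReal.ofReal (Real.exp 2)) +
          (ENNReal.ofReal (Real.exp 2) + ENNReal.ofReal (Real.exp 2))) := by
        have hmm : Measurable fun ω => ENNReal.ofReal (Real.exp (2 / w * (S ω).re)) +
          ENNReal.ofReal (Real.exp (-(2 / w) * (S ω).re)) := by fun_prop
        rw [lintegral_const_mul' _ _ ENNReal.ofReal_ne_top,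
          lintegral_add_left hmm, lintegral_add_left (hm _),
          lintegral_add_left (hm' _)]
        gcongr
        · exact key c hwc _ rfl
        · exact key c hwc _ (by ring)
        · exact key _ hd _ rfl
        · exact key _ hd _ (by ring)
    _ = momentConst := by
        rw [momentConst, ← ENNReal.ofReal_add (by positivity) (by positivity),
          ← ENNReal.ofReal_add (by positivity) (by positivity), ← ENNReal.ofReal_mul (by norm_num)]
        congr 1; ring

lemma exists_sqrt_sum (s : Finset ℕ+) (c : ℕ+ → ℂ) (h0 : ∑ n ∈ s, ‖c n‖ₑ ^ (2 : ℝ) ≠ 0) :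
    ∃ w : ℝ, 0 < w ∧ ∑ n ∈ s, ‖c n‖ ^ 2 = w ^ 2 ∧
      (∑ n ∈ s, ‖c n‖ₑ ^ (2 : ℝ)) ^ (1 / 2 : ℝ) = ENNReal.ofReal w := by
  have h1 : ∑ n ∈ s, ‖c n‖ₑ ^ (2 : ℝ) = ENNReal.ofReal (∑ n ∈ s, ‖c n‖ ^ 2) := by
    rw [ENNReal.ofReal_sum_of_nonneg fun n _ => by positivity]
    exact Finset.sum_congr rfl fun n _ => by rw [enorm_rpow_eq_ofReal _ two_pos, Real.rpow_two]
  have hpos : 0 < ∑ n ∈ s, ‖c n‖ ^ 2 := by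
    rw [h1] at h0
    by_contra hcon
    exact h0 (ENNReal.ofReal_of_nonpos (not_lt.1 hcon))
  refine ⟨√(∑ n ∈ s, ‖c n‖ ^ 2), Real.sqrt_pos.2 hpos, (Real.sq_sqrt hpos.le).symm, ?_⟩
  rw [h1, ENNReal.ofReal_rpow_of_pos hpos, Real.sqrt_eq_rpow]

/-- Upper moment bounds for random sums. -/
lemma IsStandardRandomSequence.lintegral_div_pow_le [IsProbabilityMeasure μ]
    (hX : IsStandardRandomSequence X μ) (s : Finset ℕ+) (c : ℕ+ → ℂ)
    (h0 : ∑ n ∈ s, ‖c n‖ₑ ^ (2 : ℝ) ≠ 0) (k : ℕ) :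
    ∫⁻ ω, (‖∑ n ∈ s, c n * X n ω‖ₑ / (∑ n ∈ s, ‖c n‖ₑ ^ (2 : ℝ)) ^ (1 / 2 : ℝ)) ^ (k : ℝ) ∂μ ≤
      momentConst * k.factorial := by
  obtain ⟨w, hw, hwc, hW⟩ := exists_sqrt_sum s c h0
  rw [hW]
  have hpt : ∀ ω, (‖∑ n ∈ s, c n * X n ω‖ₑ / ENNReal.ofReal w) ^ (k : ℝ) ≤
      k.factorial * ENNReal.ofReal (Real.exp (‖∑ n ∈ s, c n * X n ω‖ / w)) := fun ω => by
    rw [← ofReal_norm, ← ENNReal.ofReal_div_of_pos hw, ENNReal.rpow_natCast,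
      ← ENNReal.ofReal_pow (by positivity), ← ENNReal.ofReal_natCast,
      ← ENNReal.ofReal_mul (by positivity)]
    refine ENNReal.ofReal_le_ofReal ?_
    have := Real.pow_div_factorial_le_exp (x := ‖∑ n ∈ s, c n * X n ω‖ / w) (by positivity) k
    rw [div_le_iff₀ (by positivity)] at this
    linarith
  refine (lintegral_mono hpt).trans ?_
  rw [lintegral_const_mul' _ _ (by simp), mul_comm]
  gcongr
  exact hX.lintegral_exp_le s c hw hwc

/-- Random sums are of the order of their standard deviation with a fixed probability. -/
lemma IsStandardRandomSequence.le_measure_half_le_div [IsProbabilityMeasure μ]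
    (hX : IsStandardRandomSequence X μ) (s : Finset ℕ+) (c : ℕ+ → ℂ)
    (h0 : ∑ n ∈ s, ‖c n‖ₑ ^ (2 : ℝ) ≠ 0) :
    (48 * momentConst)⁻¹ ≤ μ {ω | 1 / 2 ≤
      ‖∑ n ∈ s, c n * X n ω‖ₑ / (∑ n ∈ s, ‖c n‖ₑ ^ (2 : ℝ)) ^ (1 / 2 : ℝ)} := by
  have h4 := hX.lintegral_div_pow_le s c h0 4
  have h2 := hX.lintegral_enorm_sum_sq s c
  obtain ⟨w, hw, hwc, hW⟩ := exists_sqrt_sum s c h0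
  have hV : ∑ n ∈ s, ‖c n‖ₑ ^ (2 : ℝ) = ENNReal.ofReal (w ^ 2) := by
    rw [← hwc, ENNReal.ofReal_sum_of_nonneg fun n _ => by positivity]
    exact Finset.sum_congr rfl fun n _ => by rw [enorm_rpow_eq_ofReal _ two_pos, Real.rpow_two]
  rw [hV] at h2
  rw [hW] at h4 ⊢
  set S : Ω → ℂ := fun ω => ∑ n ∈ s, c n * X n ω with hS
  have hSm : Measurable S := hX.measurable_sum s c
  set k : ℝ := 2 * Real.exp 2 with hk
  have hkpos : 0 < k := by positivity
  have hdiv : ∀ ω, ‖S ω‖ₑ / ENNReal.ofReal w = ENNReal.ofReal (‖S ω‖ / w) := fun ω => by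
    rw [← ofReal_norm, ENNReal.ofReal_div_of_pos hw]
  set A : Set Ω := {ω | 1 / 2 ≤ ‖S ω‖ₑ / ENNReal.ofReal w} with hA
  have hAiff : ∀ ω, ω ∈ A ↔ 1 / 2 ≤ ‖S ω‖ / w := fun ω => by
    rw [hA, Set.mem_ofPred_eq, hdiv, ← ENNReal.ofReal_le_ofReal_iff (by positivity)]
    rw [ENNReal.ofReal_div_of_pos two_pos]; simp
  have hAm : MeasurableSet A := measurableSet_le measurable_const (hSm.enorm.div_const _)
  -- Paley-Zygmund in additive form. Off `A` the square is below `1/4`; on `A` the bound is `(τ² -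
  -- 48k)² ≥ 0`. The fourth moment is at most `4! k = 24k`, so integration gives `1 ≤ 1/4 + 1/4 +
  -- 24k P(A)`.
  have hpt : ∀ ω, ENNReal.ofReal ((‖S ω‖ / w) ^ 2) ≤ ENNReal.ofReal (1 / 4) +
      ENNReal.ofReal (1 / (96 * k)) * ENNReal.ofReal (‖S ω‖ / w) ^ 4 +
      A.indicator (fun _ => ENNReal.ofReal (24 * k)) ω := fun ω => by
    set τ := ‖S ω‖ / w with hτ
    have hτ0 : 0 ≤ τ := by positivity
    rw [← ENNReal.ofReal_pow hτ0, ← ENNReal.ofReal_mul (by positivity),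
      ← ENNReal.ofReal_add (by positivity) (by positivity)]
    by_cases h : ω ∈ A
    · rw [Set.indicator_of_mem h, ← ENNReal.ofReal_add (by positivity) (by positivity)]
      refine ENNReal.ofReal_le_ofReal ?_
      have h1 : 1 / (96 * k) * τ ^ 4 + 24 * k - τ ^ 2 = (τ ^ 2 - 48 * k) ^ 2 / (96 * k) := by
        field_simp; ring
      have h2 : 0 ≤ (τ ^ 2 - 48 * k) ^ 2 / (96 * k) := by positivity
      linarith
    · rw [Set.indicator_of_notMem h, add_zero]
      refine ENNReal.ofReal_le_ofReal ?_
      rw [hAiff, not_le] at h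
      have h1 : 0 ≤ 1 / (96 * k) * τ ^ 4 := by positivity
      nlinarith
  have hint : ∫⁻ ω, ENNReal.ofReal ((‖S ω‖ / w) ^ 2) ∂μ = 1 := by
    have h3 : ∀ ω, ENNReal.ofReal ((‖S ω‖ / w) ^ 2) =
        ENNReal.ofReal (w ^ 2)⁻¹ * ‖S ω‖ₑ ^ (2 : ℝ) := fun ω => by
      rw [enorm_rpow_eq_ofReal _ two_pos, Real.rpow_two, ← ENNReal.ofReal_mul (by positivity),
        div_pow, div_eq_inv_mul]
    simp only [h3]
    rw [lintegral_const_mul' _ _ ENNReal.ofReal_ne_top, h2, ← ENNReal.ofReal_mul (by positivity),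
      inv_mul_cancel₀ (by positivity), ENNReal.ofReal_one]
  have h4' : ∫⁻ ω, ENNReal.ofReal (‖S ω‖ / w) ^ 4 ∂μ ≤ ENNReal.ofReal (24 * k) := by
    refine le_trans (le_of_eq (lintegral_congr fun ω => ?_)) (h4.trans (le_of_eq ?_))
    · rw [hdiv, ENNReal.rpow_natCast]
    · rw [momentConst, mul_comm, ← ENNReal.ofReal_natCast, ← ENNReal.ofReal_mul (by positivity),
        show ((Nat.factorial 4 : ℕ) : ℝ) = 24 by norm_num [Nat.factorial]]
  have hfin := lintegral_mono (μ := μ) hpt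
  have hm4 : Measurable fun ω => ENNReal.ofReal (1 / (96 * k)) * ENNReal.ofReal (‖S ω‖ / w) ^ 4
      := by
    fun_prop
  rw [hint, lintegral_add_right _ (measurable_const.indicator hAm), lintegral_add_right _ hm4,
    lintegral_const_mul' _ _ ENNReal.ofReal_ne_top, lintegral_indicator_const hAm,
    lintegral_const, measure_univ, mul_one, ← ofReal_measureReal] at hfin
  have hfin2 : (1 : ℝ≥0∞) ≤ ENNReal.ofReal (1 / 4 + 1 / (96 * k) * (24 * k) +
      24 * k * μ.real A) := by
    rw [ENNReal.ofReal_add (by positivity) (by positivity), ENNReal.ofReal_add (by positivity)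
      (by positivity), ENNReal.ofReal_mul (p := 1 / (96 * k)) (by positivity),
      ENNReal.ofReal_mul (p := 24 * k) (by positivity)]
    exact hfin.trans (by gcongr)
  rw [ENNReal.one_le_ofReal] at hfin2
  have h5 : 1 / (96 * k) * (24 * k) = 1 / 4 := by field_simp; norm_num
  rw [h5] at hfin2
  rw [← ofReal_measureReal (s := A), momentConst, show (48 : ℝ≥0∞) = ENNReal.ofReal 48 by simp,
    ← ENNReal.ofReal_mul (by norm_num), ← ENNReal.ofReal_inv_of_pos (by positivity)]
  refine ENNReal.ofReal_le_ofReal ?_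
  rw [inv_le_iff_one_le_mul₀ (by positivity)]
  linarith

end Sums

/-! ### Mixed norms and means with respect to a weighted probability measure -/

lemma lintegral_rpow_mono_exponent {α : Type*} [MeasurableSpace α] {μ : Measure α}
    [IsProbabilityMeasure μ] {a b : ℝ} (ha : 0 < a) (hab : a ≤ b) {f : α → ℝ≥0∞}
    (hf : Measurable f) :
    (∫⁻ x, f x ^ a ∂μ) ^ (1 / a) ≤ (∫⁻ x, f x ^ b ∂μ) ^ (1 / b) := by
  have := eLpNorm'_le_eLpNorm'_of_exponent_le (f := f) ha hab μ hf.aestronglyMeasurable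
  simpa [eLpNorm'] using this

/-- The probability measure with density proportional to `W ^ q`. -/
def weighted (q : ℝ) (κ : Measure ℝ) (W : ℝ → ℝ≥0∞) : Measure ℝ :=
  (∫⁻ σ, W σ ^ q ∂κ)⁻¹ • κ.withDensity fun σ => W σ ^ q

section Weighted

variable {q : ℝ} {κ : Measure ℝ} {W : ℝ → ℝ≥0∞}

lemma isProbabilityMeasure_weighted (h0 : ∫⁻ σ, W σ ^ q ∂κ ≠ 0) (h1 : ∫⁻ σ, W σ ^ q ∂κ ≠ ⊤) :
    IsProbabilityMeasure (weighted q κ W) :=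
  ⟨by simp [weighted, ENNReal.inv_mul_cancel h0 h1]⟩

/-- The `L^q` norm of `W` is factored out by a change of measure. The quotient `G / W` is left on a
probability space, where norms with different exponents can be compared. -/
lemma lintegral_rpow_eq_weighted (hq : 0 < q) (hW : Measurable W) (hW0 : ∀ σ, W σ ≠ 0)
    (hW1 : ∀ σ, W σ ≠ ⊤) (h0 : ∫⁻ σ, W σ ^ q ∂κ ≠ 0) (h1 : ∫⁻ σ, W σ ^ q ∂κ ≠ ⊤)
    {G : ℝ → ℝ≥0∞} (hG : Measurable G) :
    (∫⁻ σ, G σ ^ q ∂κ) ^ (1 / q) = (∫⁻ σ, W σ ^ q ∂κ) ^ (1 / q) *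
      (∫⁻ σ, (G σ / W σ) ^ q ∂weighted q κ W) ^ (1 / q) := by
  have hGW : Measurable fun σ => (G σ / W σ) ^ q := (hG.div hW).pow_const q
  rw [← ENNReal.mul_rpow_of_nonneg _ _ (by positivity), weighted, lintegral_smul_measure,
    lintegral_withDensity_eq_lintegral_mul _ (hW.pow_const q) hGW, smul_eq_mul, ← mul_assoc,
      ENNReal.mul_inv_cancel h0 h1, one_mul]
  congr 2 with σ
  rw [Pi.mul_apply, ← ENNReal.mul_rpow_of_nonneg _ _ hq.le, ENNReal.mul_div_cancel (hW0 σ) (hW1 σ)]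

variable {Z : Type*} [MeasurableSpace Z] {m : Measure Z}

lemma lintegral_div_rpow {p : ℝ} (hp : 0 < p) {w : ℝ≥0∞} (hw0 : w ≠ 0) (f : Z → ℝ≥0∞) :
    (∫⁻ z, f z ^ p ∂m) ^ (1 / p) / w = (∫⁻ z, (f z / w) ^ p ∂m) ^ (1 / p) := by
  have hw : w⁻¹ ^ p ≠ ⊤ := ENNReal.rpow_ne_top_of_nonneg hp.le (ENNReal.inv_ne_top.2 hw0)
  simp only [div_eq_mul_inv, ENNReal.mul_rpow_of_nonneg _ _ hp.le]
  rw [lintegral_mul_const' _ _ hw, ENNReal.mul_rpow_of_nonneg _ _ (by positivity),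
    ← ENNReal.rpow_mul, one_mul, mul_inv_cancel₀ hp.ne', ENNReal.rpow_one]

/-- On a probability space `L^s` norms increase with `s`. Both exponents are raised to the common
value `t`, after which the iterated norm is a single integral over the product. -/
lemma mixed_le_weighted [IsProbabilityMeasure m] {p t : ℝ} (hp : 0 < p) (hq : 0 < q) (hpt : p
    ≤ t) (hqt : q ≤ t)
    (hW : Measurable W) (hW0 : ∀ σ, W σ ≠ 0) (hW1 : ∀ σ, W σ ≠ ⊤) (h0 : ∫⁻ σ, W σ ^ q ∂κ ≠ 0)
    (h1 : ∫⁻ σ, W σ ^ q ∂κ ≠ ⊤) {f : ℝ → Z → ℝ≥0∞} (hf : Measurable fun x : ℝ × Z => f x.1 x.2) :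
    (∫⁻ σ, ((∫⁻ z, f σ z ^ p ∂m) ^ (1 / p)) ^ q ∂κ) ^ (1 / q) ≤ (∫⁻ σ, W σ ^ q ∂κ) ^ (1 / q) *
      (∫⁻ x, (f x.1 x.2 / W x.1) ^ t ∂((weighted q κ W).prod m)) ^ (1 / t) := by
  have := isProbabilityMeasure_weighted h0 h1
  have ht : 0 < t := hp.trans_le hpt
  have hg : Measurable fun x : ℝ × Z => f x.1 x.2 / W x.1 := hf.div (hW.comp measurable_fst)
  have hG : Measurable fun σ => (∫⁻ z, f σ z ^ p ∂m) ^ (1 / p) :=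
    (Measurable.lintegral_prod_right (hf.pow_const p)).pow_const _
  rw [lintegral_rpow_eq_weighted hq hW hW0 hW1 h0 h1 hG]
  refine mul_le_mul' le_rfl ?_
  have e : ∀ σ, (∫⁻ z, f σ z ^ p ∂m) ^ (1 / p) / W σ = (∫⁻ z, (f σ z / W σ) ^ p ∂m) ^ (1 / p) :=
    fun σ => lintegral_div_rpow hp (hW0 σ) _
  rw [lintegral_congr fun σ => congrArg (· ^ q) (e σ)]
  calc (∫⁻ σ, ((∫⁻ z, (f σ z / W σ) ^ p ∂m) ^ (1 / p)) ^ q ∂weighted q κ W) ^ (1 / q)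
      ≤ (∫⁻ σ, ((∫⁻ z, (f σ z / W σ) ^ t ∂m) ^ (1 / t)) ^ q ∂weighted q κ W) ^ (1 / q) := by
        gcongr with σ
        exact lintegral_rpow_mono_exponent hp hpt (hg.comp measurable_prodMk_left)
    _ ≤ (∫⁻ σ, ((∫⁻ z, (f σ z / W σ) ^ t ∂m) ^ (1 / t)) ^ t ∂weighted q κ W) ^ (1 / t) :=
        lintegral_rpow_mono_exponent hq hqt
          ((Measurable.lintegral_prod_right (hg.pow_const t)).pow_const _)
    _ = _ := by
        simp only [← ENNReal.rpow_mul, one_div_mul_cancel ht.ne', ENNReal.rpow_one]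
        rw [lintegral_prod _ (hg.pow_const t).aemeasurable]

lemma weighted_le_mixed [IsProbabilityMeasure m] {p u : ℝ} (hu : 0 < u) (hup : u ≤ p) (huq : u ≤ q)
    (hW : Measurable W) (hW0 : ∀ σ, W σ ≠ 0) (hW1 : ∀ σ, W σ ≠ ⊤) (h0 : ∫⁻ σ, W σ ^ q ∂κ ≠ 0)
    (h1 : ∫⁻ σ, W σ ^ q ∂κ ≠ ⊤) {f : ℝ → Z → ℝ≥0∞} (hf : Measurable fun x : ℝ × Z => f x.1 x.2) :
    (∫⁻ σ, W σ ^ q ∂κ) ^ (1 / q) *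
      (∫⁻ x, (f x.1 x.2 / W x.1) ^ u ∂((weighted q κ W).prod m)) ^ (1 / u) ≤
    (∫⁻ σ, ((∫⁻ z, f σ z ^ p ∂m) ^ (1 / p)) ^ q ∂κ) ^ (1 / q) := by
  have := isProbabilityMeasure_weighted h0 h1
  have hp : 0 < p := hu.trans_le hup
  have hq : 0 < q := hu.trans_le huq
  have hg : Measurable fun x : ℝ × Z => f x.1 x.2 / W x.1 := hf.div (hW.comp measurable_fst)
  have hG : Measurable fun σ => (∫⁻ z, f σ z ^ p ∂m) ^ (1 / p) :=
    (Measurable.lintegral_prod_right (hf.pow_const p)).pow_const _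
  rw [lintegral_rpow_eq_weighted hq hW hW0 hW1 h0 h1 hG]
  refine mul_le_mul' le_rfl ?_
  have e : ∀ σ, (∫⁻ z, f σ z ^ p ∂m) ^ (1 / p) / W σ = (∫⁻ z, (f σ z / W σ) ^ p ∂m) ^ (1 / p) :=
    fun σ => lintegral_div_rpow hp (hW0 σ) _
  rw [lintegral_congr fun σ => congrArg (· ^ q) (e σ)]
  calc _ = (∫⁻ σ, ((∫⁻ z, (f σ z / W σ) ^ u ∂m) ^ (1 / u)) ^ u ∂weighted q κ W) ^ (1 / u) := by
        simp only [← ENNReal.rpow_mul, one_div_mul_cancel hu.ne', ENNReal.rpow_one]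
        rw [lintegral_prod _ (hg.pow_const u).aemeasurable]
    _ ≤ (∫⁻ σ, ((∫⁻ z, (f σ z / W σ) ^ u ∂m) ^ (1 / u)) ^ q ∂weighted q κ W) ^ (1 / q) :=
        lintegral_rpow_mono_exponent hu huq
          ((Measurable.lintegral_prod_right (hg.pow_const u)).pow_const _)
    _ ≤ _ := by
        gcongr with σ
        exact lintegral_rpow_mono_exponent hu hup (hg.comp measurable_prodMk_left)

end Weighted

/-! ### Random Dirichlet polynomials -/

lemma hardyPolyNorm_two_translate_eq (P : ℕ+ →₀ ℂ) (σ : ℝ) : hardyPolyNorm 2 (translate σ P) =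
    (∑ n ∈ P.support, ‖P n * (((n : ℝ) ^ (-σ) : ℝ) : ℂ)‖ₑ ^ (2 : ℝ)) ^ (1 / 2 : ℝ) := by
  rw [hardyPolyNorm_two_translate, tsum_eq_sum (s := P.support)]
  intro n hn
  rw [Finsupp.notMem_support_iff.1 hn]; simp

lemma sum_translate_ne_zero {P : ℕ+ →₀ ℂ} (hP : P ≠ 0) (σ : ℝ) :
    ∑ n ∈ P.support, ‖P n * (((n : ℝ) ^ (-σ) : ℝ) : ℂ)‖ₑ ^ (2 : ℝ) ≠ 0 := by
  obtain ⟨n, hn⟩ := Finsupp.ne_iff.1 hP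
  intro h
  have h1 := (Finset.sum_eq_zero_iff.1 h) n (Finsupp.mem_support_iff.2 hn)
  rw [ENNReal.rpow_eq_zero_iff_of_pos two_pos, enorm_eq_zero] at h1
  have h2 : (0 : ℝ) < (n : ℝ) ^ (-σ) := Real.rpow_pos_of_pos (by exact_mod_cast n.pos) _
  rcases mul_eq_zero.1 h1 with h3 | h3
  · exact hn h3
  · exact h2.ne' (by exact_mod_cast h3)

lemma hardyPolyNorm_two_translate_ne_zero {P : ℕ+ →₀ ℂ} (hP : P ≠ 0) (σ : ℝ) :
    hardyPolyNorm 2 (translate σ P) ≠ 0 := by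
  rw [hardyPolyNorm_two_translate_eq]
  simp only [ne_eq, ENNReal.rpow_eq_zero_iff_of_pos (by norm_num : (0 : ℝ) < 1 / 2)]
  exact sum_translate_ne_zero hP σ

lemma hardyPolyNorm_two_translate_ne_top (P : ℕ+ →₀ ℂ) (σ : ℝ) :
    hardyPolyNorm 2 (translate σ P) ≠ ⊤ := by
  rw [hardyPolyNorm_two_translate_eq]
  refine ENNReal.rpow_ne_top_of_nonneg (by norm_num) (ENNReal.sum_ne_top.2 fun n _ => ?_)
  exact ENNReal.rpow_ne_top_of_nonneg (by norm_num) enorm_ne_top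

/-- The probability measure on `ℝ × 𝕋^∞` with density proportional to the `q`-th power of the
`H^2` norm of the translates of `P`. -/
def weightedProd (q : ℝ) (κ : Measure ℝ) (P : ℕ+ →₀ ℂ) : Measure (ℝ × (Nat.Primes → ℂ)) :=
  (weighted q κ fun σ => hardyPolyNorm 2 (translate σ P)).prod torusMeasure

section WeightedProd

variable {κ : Measure ℝ} {q : ℝ}

lemma mixNorm_two_rpow (hq : 0 < q) (P : ℕ+ →₀ ℂ) :
    ∫⁻ σ, hardyPolyNorm 2 (translate σ P) ^ q ∂κ = mixNorm 2 q κ P ^ q := by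
  rw [mixNorm, ← ENNReal.rpow_mul, one_div_mul_cancel hq.ne', ENNReal.rpow_one]

lemma lintegral_hardyPolyNorm_ne_zero (hq : 0 < q) (hκ0 : κ ≠ 0) {P : ℕ+ →₀ ℂ} (hP : P ≠ 0) :
    ∫⁻ σ, hardyPolyNorm 2 (translate σ P) ^ q ∂κ ≠ 0 := by
  rw [ne_eq, lintegral_eq_zero_iff ((measurable_hardyPolyNorm_translate 2 P).pow_const q)]
  intro h
  have : (ae κ).NeBot := ae_neBot.2 hκ0
  obtain ⟨σ, hσ⟩ := h.exists
  exact hardyPolyNorm_two_translate_ne_zero hP σ ((ENNReal.rpow_eq_zero_iff_of_pos hq).1 hσ)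

lemma lintegral_hardyPolyNorm_ne_top (hq : 0 < q) [IsFiniteMeasure κ] (hκ : ∀ᵐ σ ∂κ, 0 ≤ σ)
    (P : ℕ+ →₀ ℂ) : ∫⁻ σ, hardyPolyNorm 2 (translate σ P) ^ q ∂κ ≠ ⊤ := by
  rw [mixNorm_two_rpow hq]
  exact ENNReal.rpow_ne_top_of_nonneg hq.le (mixNorm_lt_top two_pos hq hκ P).ne

lemma isProbabilityMeasure_weightedProd (hq : 0 < q) [IsFiniteMeasure κ] (hκ : ∀ᵐ σ ∂κ, 0 ≤ σ)
    (hκ0 : κ ≠ 0) {P : ℕ+ →₀ ℂ} (hP : P ≠ 0) : IsProbabilityMeasure (weightedProd q κ P) := by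
  have := isProbabilityMeasure_weighted (lintegral_hardyPolyNorm_ne_zero hq hκ0 hP)
    (lintegral_hardyPolyNorm_ne_top hq hκ P)
  unfold weightedProd
  infer_instance

lemma ae_weightedProd_norm_eq_one (q : ℝ) (κ : Measure ℝ) (P : ℕ+ →₀ ℂ) :
    ∀ᵐ x ∂weightedProd q κ P, ∀ j, ‖x.2 j‖ = 1 :=
  Measure.quasiMeasurePreserving_snd.ae ae_norm_eq_one_torusMeasure

lemma measurable_bohrLift_translate (Q : ℕ+ →₀ ℂ) :
    Measurable fun x : ℝ × (Nat.Primes → ℂ) => ‖bohrLift (translate x.1 Q) x.2‖ₑ := by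
  simp only [translate_eq_lmul]
  exact (measurable_bohrLift_lmul Q (b := fun σ : ℝ => fun n : ℕ+ => (((n : ℝ) ^ (-σ) : ℝ) : ℂ))
    measurable_natCast_rpow_neg).enorm

lemma mixNorm_le_weightedProd {p t : ℝ} (hp : 0 < p) (hq : 0 < q) (hpt : p ≤ t) (hqt : q ≤ t)
    [IsFiniteMeasure κ] (hκ : ∀ᵐ σ ∂κ, 0 ≤ σ) (hκ0 : κ ≠ 0) {P : ℕ+ →₀ ℂ} (hP : P ≠ 0)
    (Q : ℕ+ →₀ ℂ) : mixNorm p q κ Q ≤ mixNorm 2 q κ P *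
      (∫⁻ x, (‖bohrLift (translate x.1 Q) x.2‖ₑ / hardyPolyNorm 2 (translate x.1 P)) ^ t
        ∂weightedProd q κ P) ^ (1 / t) :=
  mixed_le_weighted (f := fun σ z => ‖bohrLift (translate σ Q) z‖ₑ) hp hq hpt hqt
    (measurable_hardyPolyNorm_translate 2 P) (hardyPolyNorm_two_translate_ne_zero hP)
    (hardyPolyNorm_two_translate_ne_top P) (lintegral_hardyPolyNorm_ne_zero hq hκ0 hP)
    (lintegral_hardyPolyNorm_ne_top hq hκ P) (measurable_bohrLift_translate Q)

lemma weightedProd_le_mixNorm {p u : ℝ} (hu : 0 < u) (hup : u ≤ p) (huq : u ≤ q)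
    [IsFiniteMeasure κ] (hκ : ∀ᵐ σ ∂κ, 0 ≤ σ) (hκ0 : κ ≠ 0) {P : ℕ+ →₀ ℂ} (hP : P ≠ 0)
    (Q : ℕ+ →₀ ℂ) : mixNorm 2 q κ P *
      (∫⁻ x, (‖bohrLift (translate x.1 Q) x.2‖ₑ / hardyPolyNorm 2 (translate x.1 P)) ^ u
        ∂weightedProd q κ P) ^ (1 / u) ≤ mixNorm p q κ Q :=
  weighted_le_mixed (f := fun σ z => ‖bohrLift (translate σ Q) z‖ₑ) hu hup huq
    (measurable_hardyPolyNorm_translate 2 P) (hardyPolyNorm_two_translate_ne_zero hP)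
    (hardyPolyNorm_two_translate_ne_top P)
    (lintegral_hardyPolyNorm_ne_zero (hu.trans_le huq) hκ0 hP)
    (lintegral_hardyPolyNorm_ne_top (hu.trans_le huq) hκ P) (measurable_bohrLift_translate Q)

end WeightedProd

section Random

variable {Ω : Type*} {X : ℕ+ → Ω → ℂ}

lemma bohrLift_translate_random (P : ℕ+ →₀ ℂ) (σ : ℝ) (z : Nat.Primes → ℂ) (ω : Ω) :
    bohrLift (translate σ (lmul P fun n => X n ω)) z =
      ∑ n ∈ P.support, (P n * (((n : ℝ) ^ (-σ) : ℝ) : ℂ) * bohrMonomial n z) * X n ω := by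
  rw [translate_lmul, bohrLift_lmul]
  refine Finset.sum_congr rfl fun n _ => ?_
  ring

/-- The reason why the inner exponent becomes `2`: unimodular monomials leave the variance of the
random sum unchanged, so it depends on `σ` alone. -/
lemma sum_enorm_mul_bohrMonomial (P : ℕ+ →₀ ℂ) (σ : ℝ) {z : Nat.Primes → ℂ} (hz : ∀ j, ‖z j‖ = 1) :
    ∑ n ∈ P.support, ‖P n * (((n : ℝ) ^ (-σ) : ℝ) : ℂ) * bohrMonomial n z‖ₑ ^ (2 : ℝ) =
      ∑ n ∈ P.support, ‖P n * (((n : ℝ) ^ (-σ) : ℝ) : ℂ)‖ₑ ^ (2 : ℝ) := by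
  refine Finset.sum_congr rfl fun n _ => ?_
  rw [enorm_mul, ← ofReal_norm (bohrMonomial n z), norm_bohrMonomial n hz]
  simp

variable [MeasurableSpace Ω] {μ : Measure Ω}

/-- The normalized modulus of the Bohr lift of a translated random Dirichlet polynomial. -/
def normalizedLift (X : ℕ+ → Ω → ℂ) (P : ℕ+ →₀ ℂ) (ω : Ω) (x : ℝ × (Nat.Primes → ℂ)) : ℝ≥0∞ :=
  ‖bohrLift (translate x.1 (lmul P fun n => X n ω)) x.2‖ₑ / hardyPolyNorm 2 (translate x.1 P)

lemma IsStandardRandomSequence.measurable_bohrLift (hX : IsStandardRandomSequence X μ)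
    (P : ℕ+ →₀ ℂ) : Measurable fun x : Ω × ℝ × (Nat.Primes → ℂ) =>
      ‖bohrLift (translate x.2.1 (lmul P fun n => X n x.1)) x.2.2‖ₑ := by
  refine Measurable.enorm ?_
  simp only [bohrLift_translate_random]
  refine Finset.measurable_sum _ fun n _ => ?_
  exact ((((measurable_natCast_rpow_neg n).comp
      (measurable_fst.comp measurable_snd)).const_mul _).mul
    ((measurable_bohrMonomial n).comp (measurable_snd.comp measurable_snd))).mul
    ((hX.measurable n).comp measurable_fst)

lemma IsStandardRandomSequence.measurable_normalizedLift (hX : IsStandardRandomSequence X μ)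
    (P : ℕ+ →₀ ℂ) :
    Measurable fun x : Ω × ℝ × (Nat.Primes → ℂ) => normalizedLift X P x.1 x.2 :=
  (hX.measurable_bohrLift P).div
    ((measurable_hardyPolyNorm_translate 2 P).comp (measurable_fst.comp measurable_snd))

lemma IsStandardRandomSequence.measurable_mixNorm (hX : IsStandardRandomSequence X μ) (p q : ℝ)
    (κ : Measure ℝ) [SFinite κ] (P : ℕ+ →₀ ℂ) :
    Measurable fun ω => mixNorm p q κ (lmul P fun n => X n ω) :=
  measurable_mixNorm_lmul p q κ P hX.measurable

variable {κ : Measure ℝ} {q : ℝ} [IsProbabilityMeasure μ]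

lemma IsStandardRandomSequence.lintegral_normalizedLift_pow_le (hX : IsStandardRandomSequence X μ)
    {P : ℕ+ →₀ ℂ} (hP : P ≠ 0) (k : ℕ) (σ : ℝ) {z : Nat.Primes → ℂ} (hz : ∀ j, ‖z j‖ = 1) :
    ∫⁻ ω, normalizedLift X P ω (σ, z) ^ (k : ℝ) ∂μ ≤ momentConst * k.factorial := by
  have := hX.lintegral_div_pow_le P.support
    (fun n => P n * (((n : ℝ) ^ (-σ) : ℝ) : ℂ) * bohrMonomial n z)
    (by rw [sum_enorm_mul_bohrMonomial P σ hz]; exact sum_translate_ne_zero hP σ) k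
  rw [sum_enorm_mul_bohrMonomial P σ hz, ← hardyPolyNorm_two_translate_eq] at this
  simpa only [normalizedLift, bohrLift_translate_random] using this

lemma IsStandardRandomSequence.le_measure_half_le_normalizedLift
    (hX : IsStandardRandomSequence X μ)
    {P : ℕ+ →₀ ℂ} (hP : P ≠ 0) (σ : ℝ) {z : Nat.Primes → ℂ} (hz : ∀ j, ‖z j‖ = 1) :
    (48 * momentConst)⁻¹ ≤ μ {ω | 1 / 2 ≤ normalizedLift X P ω (σ, z)} := by
  have := hX.le_measure_half_le_div P.support
    (fun n => P n * (((n : ℝ) ^ (-σ) : ℝ) : ℂ) * bohrMonomial n z)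
    (by rw [sum_enorm_mul_bohrMonomial P σ hz]; exact sum_translate_ne_zero hP σ)
  rw [sum_enorm_mul_bohrMonomial P σ hz, ← hardyPolyNorm_two_translate_eq] at this
  simpa only [normalizedLift, bohrLift_translate_random] using this

/-- The same exponent `k` is used for the mean over `(σ, z)` and for the expectation, so Fubini
reduces the claim to a fixed pair `(σ, z)`, where the moment bound does not depend on `P`. The zero
polynomial is separate because its weight cannot be normalized. -/
lemma IsStandardRandomSequence.lintegral_mixNorm_pow_le (hX : IsStandardRandomSequence X μ)
    {p : ℝ} (hp : 0 < p) (hq : 0 < q) [IsFiniteMeasure κ] (hκ : ∀ᵐ σ ∂κ, 0 ≤ σ) (hκ0 : κ ≠ 0)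
    {k : ℕ} (hpk : p ≤ k) (hqk : q ≤ k) (P : ℕ+ →₀ ℂ) :
    ∫⁻ ω, mixNorm p q κ (lmul P fun n => X n ω) ^ (k : ℝ) ∂μ ≤
      momentConst * k.factorial * mixNorm 2 q κ P ^ (k : ℝ) := by
  have hk : (0 : ℝ) < k := hp.trans_le hpk
  rcases eq_or_ne P 0 with rfl | hP
  · have : ∀ ω, lmul 0 (fun n => X n ω) = 0 := fun ω => by ext n; simp
    simp [this, mixNorm_zero hp hq, ENNReal.zero_rpow_of_pos hk]
  have hprob := isProbabilityMeasure_weightedProd hq hκ hκ0 hP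
  have hpt : ∀ ω, mixNorm p q κ (lmul P fun n => X n ω) ^ (k : ℝ) ≤
      mixNorm 2 q κ P ^ (k : ℝ) * ∫⁻ x, normalizedLift X P ω x ^ (k : ℝ) ∂weightedProd q κ P :=
    fun ω => by
      have := mixNorm_le_weightedProd hp hq hpk hqk hκ hκ0 hP (lmul P fun n => X n ω)
      refine (ENNReal.rpow_le_rpow this hk.le).trans (le_of_eq ?_)
      rw [ENNReal.mul_rpow_of_nonneg _ _ hk.le, ← ENNReal.rpow_mul, one_div_mul_cancel hk.ne',
        ENNReal.rpow_one]
      rfl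
  refine (lintegral_mono hpt).trans ?_
  have hm := hX.measurable_normalizedLift P
  rw [lintegral_const_mul _ (Measurable.lintegral_prod_right (hm.pow_const _)), mul_comm]
  gcongr
  rw [lintegral_lintegral_swap (hm.pow_const _).aemeasurable]
  refine (lintegral_mono_ae (g := fun _ => momentConst * k.factorial) ?_).trans (by simp)
  filter_upwards [ae_weightedProd_norm_eq_one q κ P] with x hx
  exact hX.lintegral_normalizedLift_pow_le hP k x.1 hx

/-- The constants in the lower bound for mixed norms of random Dirichlet polynomials. -/
def lowerConst : ℝ≥0∞ := (48 * momentConst)⁻¹ / 2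

lemma lowerConst_pos : 0 < lowerConst := by
  refine ENNReal.div_pos (ENNReal.inv_ne_zero.2 (ENNReal.mul_ne_top (by simp) ?_)) (by simp)
  exact ENNReal.ofReal_ne_top

lemma lowerConst_ne_top : lowerConst ≠ ⊤ := by
  refine ENNReal.div_ne_top (ENNReal.inv_ne_top.2 (mul_ne_zero (by simp) ?_)) (by simp)
  rw [momentConst, ne_eq, ENNReal.ofReal_eq_zero, not_le]
  positivity

/-- Let `Y` be the weighted measure of the points where the normalized lift is at least `1/2`. By
Fubini its expectation is at least `2 lowerConst`, and `Y ≤ 1`, so `Y ≥ lowerConst` with probability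
at least `lowerConst`. On that event the `L^u` mean is at least `(1/2) lowerConst^{1/u}`. -/
lemma IsStandardRandomSequence.lowerConst_le_measure (hX : IsStandardRandomSequence X μ)
    {p u : ℝ} (hu : 0 < u) (hup : u ≤ p) (huq : u ≤ q) [IsFiniteMeasure κ]
    (hκ : ∀ᵐ σ ∂κ, 0 ≤ σ) (hκ0 : κ ≠ 0) (P : ℕ+ →₀ ℂ) :
    lowerConst ≤ μ {ω | mixNorm 2 q κ P * ((1 / 2) * lowerConst ^ (1 / u)) ≤
      mixNorm p q κ (lmul P fun n => X n ω)} := by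
  have hq : 0 < q := hu.trans_le huq
  have hlow : lowerConst + lowerConst = (48 * momentConst)⁻¹ := ENNReal.add_halves _
  rcases eq_or_ne P 0 with rfl | hP
  · have hcl : lowerConst ≤ 1 := by
      -- For `P = 0` the event is everything, and `lowerConst ≤ 1` remains; it is read off from the
      -- estimate for the constant polynomial `1`, whose left side is bounded by a probability.
      have := hX.le_measure_half_le_normalizedLift (P := Finsupp.single 1 1) (by simp) 0
        (z := fun _ => 1) (by simp)
      rw [← hlow] at this
      exact le_self_add.trans (this.trans prob_le_one)
    simpa [mixNorm_zero two_pos hq] using hcl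
  have hprob := isProbabilityMeasure_weightedProd hq hκ hκ0 hP
  have hm := hX.measurable_normalizedLift P
  have hset : MeasurableSet {x : Ω × ℝ × (Nat.Primes → ℂ) | 1 / 2 ≤ normalizedLift X P x.1 x.2} :=
    measurableSet_le measurable_const hm
  set Y : Ω → ℝ≥0∞ := fun ω => weightedProd q κ P {x | 1 / 2 ≤ normalizedLift X P ω x} with hY
  have hYm : Measurable Y := measurable_measure_prodMk_left hset
  have hmean : lowerConst + lowerConst ≤ ∫⁻ ω, Y ω ∂μ := by
    have e1 : ∫⁻ ω, Y ω ∂μ = (μ.prod (weightedProd q κ P)) {x | 1 / 2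
        ≤ normalizedLift X P x.1 x.2} :=
      (Measure.prod_apply hset).symm
    rw [e1, Measure.prod_apply_symm hset, hlow]
    refine le_trans (by simp) (lintegral_mono_ae (f := fun _ => (48 * momentConst)⁻¹) ?_)
    filter_upwards [ae_weightedProd_norm_eq_one q κ P] with x hx
    exact hX.le_measure_half_le_normalizedLift hP x.1 hx
  have hprobY : lowerConst ≤ μ {ω | lowerConst ≤ Y ω} := by
    have hYset : MeasurableSet {ω | lowerConst ≤ Y ω} := measurableSet_le measurable_const hYm
    have h2 : ∫⁻ ω, Y ω ∂μ ≤ lowerConst + μ {ω | lowerConst ≤ Y ω} := by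
      calc ∫⁻ ω, Y ω ∂μ ≤ ∫⁻ ω, (lowerConst + {ω | lowerConst ≤ Y ω}.indicator 1 ω) ∂μ := by
            refine lintegral_mono fun ω => ?_
            by_cases h : lowerConst ≤ Y ω
            · rw [Set.indicator_of_mem (by exact h)]
              exact (prob_le_one).trans le_add_self
            · exact (not_le.1 h).le.trans le_self_add
        _ = _ := by
            rw [lintegral_add_left measurable_const, lintegral_indicator_one hYset]
            simp
    exact (ENNReal.add_le_add_iff_left lowerConst_ne_top).1 (hmean.trans h2)
  refine hprobY.trans (measure_mono fun ω hω => ?_)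
  have hlower := weightedProd_le_mixNorm hu hup huq hκ hκ0 hP (lmul P fun n => X n ω)
  refine le_trans ?_ hlower
  gcongr
  rw [one_div u, ENNReal.le_rpow_inv_iff hu, ENNReal.mul_rpow_of_nonneg _ _ hu.le,
    ← ENNReal.rpow_mul, inv_mul_cancel₀ hu.ne', ENNReal.rpow_one]
  calc (1 / 2 : ℝ≥0∞) ^ u * lowerConst ≤ (1 / 2) ^ u * Y ω := by gcongr; exact hω
    _ ≤ (1 / 2) ^ u * weightedProd q κ P {x | (1 / 2) ^ u ≤ normalizedLift X P ω x ^ u} := by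
        gcongr
        refine measure_mono fun x hx => ENNReal.rpow_le_rpow hx hu.le
    _ ≤ ∫⁻ x, normalizedLift X P ω x ^ u ∂weightedProd q κ P :=
        mul_meas_ge_le_lintegral ((hm.comp measurable_prodMk_left).pow_const u) _

end Random

/-! ### A maximal inequality -/

/-- Ottaviani's maximal inequality. -/
lemma measure_exists_lt_le_of_indepFun {Ω : Type*} [MeasurableSpace Ω] {μ : Measure Ω}
    [IsProbabilityMeasure μ] {v w : ℕ → Ω → ℝ≥0∞} {L : ℕ} {x δ : ℝ≥0∞}
    (hv : ∀ i, Measurable (v i)) (hvw : ∀ i ≤ L, ∀ ω, v i ω ≤ v L ω + w i ω)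
    (hind : ∀ i ≤ L, IndepFun (fun ω (j : ℕ) => v (min j i) ω) (w i) μ)
    (hw : ∀ i ≤ L, μ {ω | x ≤ w i ω} ≤ δ) (hL : μ {ω | x ≤ v L ω} ≤ δ) :
    μ {ω | ∃ i ≤ L, x + x < v i ω} ≤ δ + δ := by
  set A : ℕ → Set (ℕ → ℝ≥0∞) := fun i => {u | x + x < u i ∧ ∀ j < i, u j ≤ x + x} with hA
  have hAm : ∀ i, MeasurableSet (A i) := fun i => by
    have : A i = {u | x + x < u i} ∩ ⋂ j, ⋂ (_ : j < i), {u | u j ≤ x + x} := by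
      ext u; simp [hA]
    rw [this]
    exact (measurableSet_lt measurable_const (measurable_pi_apply i)).inter
      (.iInter fun j => .iInter fun _ => measurableSet_le (measurable_pi_apply j) measurable_const)
  -- `E i` is the event that the first exceedance of `2x` occurs at `i`. The stopped path `j ↦ v
  -- (min j i)` records exactly `v 0, …, v i`, so `E i` is independent of `w i`.
  set E : ℕ → Set Ω := fun i => (fun ω (j : ℕ) => v (min j i) ω) ⁻¹' A i with hE
  have hEm : ∀ i, MeasurableSet (E i) := fun i =>
    (measurable_pi_lambda _ fun j => hv (min j i)) (hAm i)
  have hE' : ∀ i ω, ω ∈ E i ↔ x + x < v i ω ∧ ∀ j < i, v j ω ≤ x + x := fun i ω => by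
    simp only [hE, hA, Set.mem_preimage, Set.mem_ofPred_eq, min_self]
    refine and_congr_right fun _ => forall₂_congr fun j hj => ?_
    rw [min_eq_left hj.le]
  have hdisj : Pairwise (Function.onFun Disjoint E) := by
    intro i j hij
    refine Set.disjoint_left.2 fun ω hi hj => ?_
    rw [hE'] at hi hj
    rcases lt_or_gt_of_ne hij with h | h
    · exact (hj.2 i h).not_gt hi.1
    · exact (hi.2 j h).not_gt hj.1
  have hsub : {ω | ∃ i ≤ L, x + x < v i ω} ⊆
      {ω | x ≤ v L ω} ∪ ⋃ i ∈ Finset.range (L + 1), (E i ∩ w i ⁻¹' Set.Ici x) := by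
    classical
    intro ω hω
    have hex : ∃ i, x + x < v i ω := hω.imp fun i h => h.2
    obtain ⟨i₀, hi₀, hi₀'⟩ := hω
    have hle : Nat.find hex ≤ L := (Nat.find_min' hex hi₀').trans hi₀
    have hmem : ω ∈ E (Nat.find hex) :=
      (hE' _ _).2 ⟨Nat.find_spec hex, fun j hj => not_lt.1 (Nat.find_min hex hj)⟩
    by_cases h : x ≤ v L ω
    · exact Or.inl h
    · refine Or.inr (Set.mem_biUnion (Finset.mem_coe.2 (Finset.mem_range.2 (Nat.lt_succ_of_le hle)))
        ⟨hmem, ?_⟩)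
      -- If both `v L` and `w i` were below `x`, then `v i ≤ v L + w i` could not exceed `2x`.
      by_contra h'
      have := (Nat.find_spec hex).trans_le (hvw _ hle ω)
      exact this.not_ge (add_le_add (not_le.1 h).le (not_le.1 h').le)
  refine (measure_mono hsub).trans ((measure_union_le _ _).trans (add_le_add hL ?_))
  refine (measure_biUnion_finset_le _ _).trans ?_
  calc ∑ i ∈ Finset.range (L + 1), μ (E i ∩ w i ⁻¹' Set.Ici x)
      ≤ ∑ i ∈ Finset.range (L + 1), μ (E i) * δ := by
        refine Finset.sum_le_sum fun i hi => ?_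
        have hi' : i ≤ L := Nat.lt_succ_iff.1 (Finset.mem_range.1 hi)
        rw [(hind i hi').measure_inter_preimage_eq_mul _ _ (hAm i) measurableSet_Ici]
        exact mul_le_mul' le_rfl (hw i hi')
    _ = μ (⋃ i ∈ Finset.range (L + 1), E i) * δ := by
        rw [← Finset.sum_mul, measure_biUnion_finset (fun i _ j _ h => hdisj h) fun i _ => hEm i]
    _ ≤ δ := mul_le_of_le_one_left' prob_le_one

/-! ### Random Dirichlet series -/

lemma partialSum_randomize {Ω : Type*} (N : ℕ+) (X : ℕ+ → Ω → ℂ) (a : ℕ+ → ℂ) (ω : Ω) :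
    partialSum N (randomize X a ω) = lmul (partialSum N a) fun n => X n ω := by
  rw [partialSum_eq_lmul, partialSum_eq_lmul, lmul_randomize]

lemma norm_partialSum_apply_le (N : ℕ+) (a : ℕ+ → ℂ) (n : ℕ+) : ‖partialSum N a n‖ ≤ ‖a n‖ := by
  rw [partialSum_apply]; split_ifs <;> simp

lemma norm_partialSum_sub_apply_le {M N : ℕ+} (h : M ≤ N) (a : ℕ+ → ℂ) (n : ℕ+) :
    ‖(partialSum N a - partialSum M a) n‖ ≤ ‖a n‖ := by
  rw [Finsupp.sub_apply, partialSum_apply, partialSum_apply]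
  by_cases h1 : n ≤ M
  · simp [h1, h1.trans h]
  · by_cases h2 : n ≤ N <;> simp [h1, h2]

section Random

variable {Ω : Type*} [MeasurableSpace Ω] {X : ℕ+ → Ω → ℂ} {μ : Measure Ω} {κ : Measure ℝ} {q : ℝ}
  {p r : ℝ} {a : ℕ+ → ℂ}

/-- The mixed norm of a random polynomial is a measurable function of the variables that occur
in it. -/
lemma exists_measurable_mixNorm_eq (p q : ℝ) (κ : Measure ℝ) [SFinite κ] (P : ℕ+ →₀ ℂ)
    {S : Finset ℕ+} (hS : ∀ n ∉ S, P n = 0) : ∃ Φ : (S → ℂ) → ℝ≥0∞, Measurable Φ ∧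
      ∀ b : ℕ+ → ℂ, mixNorm p q κ (lmul P b) = Φ fun n => b n := by
  classical
  set e : (S → ℂ) → ℕ+ → ℂ := fun y n => if h : n ∈ S then y ⟨n, h⟩ else 0 with he
  have hem : ∀ n, Measurable fun y => e y n := fun n => by
    by_cases h : n ∈ S
    · simpa only [he, h, dif_pos] using measurable_pi_apply (⟨n, h⟩ : S)
    · simp only [he, h, dif_neg, not_false_eq_true, measurable_const]
  refine ⟨fun y => mixNorm p q κ (lmul P (e y)), measurable_mixNorm_lmul p q κ P hem, fun b => ?_⟩
  have : lmul P b = lmul P (e fun n => b n) := by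
    ext n
    by_cases h : n ∈ S <;> simp [h, hS, he]
  rw [this]

lemma IsStandardRandomSequence.indepFun_mixNorm (hX : IsStandardRandomSequence X μ) [SFinite κ]
    {P : ℕ → ℕ+ →₀ ℂ} {Q : ℕ+ →₀ ℂ} {S T : Finset ℕ+} (hST : Disjoint S T)
    (hP : ∀ j, ∀ n ∉ S, P j n = 0) (hQ : ∀ n ∉ T, Q n = 0) (r : ℝ) :
    IndepFun (fun ω j => mixNorm p q κ (lmul (P j) fun n => X n ω) ^ r)
      (fun ω => mixNorm p q κ (lmul Q fun n => X n ω) ^ r) μ := by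
  choose Φ hΦ hΦ' using fun j => exists_measurable_mixNorm_eq p q κ (P j) (hP j)
  obtain ⟨Ψ, hΨ, hΨ'⟩ := exists_measurable_mixNorm_eq p q κ Q hQ
  simp only [hΦ', hΨ']
  exact (hX.indep.indepFun_finset S T hST hX.measurable).comp
    (φ := fun y j => Φ j y ^ r) (ψ := fun y => Ψ y ^ r)
    (measurable_pi_lambda _ fun j => (hΦ j).pow_const r) (hΨ.pow_const r)

variable [IsProbabilityMeasure μ]

lemma IsStandardRandomSequence.exists_lintegral_mixNorm_rpow_le (hX : IsStandardRandomSequence X μ)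
    (hp : 0 < p) (hq : 0 < q) [IsFiniteMeasure κ] (hκ : ∀ᵐ σ ∂κ, 0 ≤ σ) (hκ0 : κ ≠ 0)
    (hr : 0 < r) : ∃ C : ℝ≥0∞, C ≠ ⊤ ∧ ∀ P : ℕ+ →₀ ℂ,
      ∫⁻ ω, mixNorm p q κ (lmul P fun n => X n ω) ^ r ∂μ ≤ C * mixNorm 2 q κ P ^ r := by
  obtain ⟨k, hk⟩ := exists_nat_ge (max r (max p q))
  have hrk : r ≤ k := (le_max_left _ _).trans hk
  have hpk : p ≤ k := ((le_max_left _ _).trans (le_max_right _ _)).trans hk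
  have hqk : q ≤ k := ((le_max_right _ _).trans (le_max_right _ _)).trans hk
  have hk0 : (0 : ℝ) < k := hr.trans_le hrk
  refine ⟨(momentConst * k.factorial) ^ (1 / (k : ℝ) * r), ?_, fun P => ?_⟩
  · refine ENNReal.rpow_ne_top_of_nonneg (by positivity) (ENNReal.mul_ne_top ?_ (by simp))
    exact ENNReal.ofReal_ne_top
  have h1 := (lintegral_rpow_mono_exponent hr hrk (hX.measurable_mixNorm p q κ P)).trans
    (ENNReal.rpow_le_rpow (hX.lintegral_mixNorm_pow_le hp hq hκ hκ0 hpk hqk P)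
      (by positivity : 0 ≤ 1 / (k : ℝ)))
  have h2 := ENNReal.rpow_le_rpow h1 hr.le
  rw [← ENNReal.rpow_mul, one_div_mul_cancel hr.ne', ENNReal.rpow_one] at h2
  refine h2.trans (le_of_eq ?_)
  rw [← ENNReal.rpow_mul, ENNReal.mul_rpow_of_nonneg _ _ (by positivity), ← ENNReal.rpow_mul,
    ← mul_assoc, mul_one_div_cancel hk0.ne', one_mul]

/-- The partial sums of the randomization are almost surely bounded if `f` belongs to the mixed
norm space with first exponent `2`. -/
lemma IsStandardRandomSequence.ae_iSup_mixNorm_lt_top (hX : IsStandardRandomSequence X μ)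
    (hr : 0 < r) (hr1 : r ≤ 1) (hrp : r ≤ p) (hrq : r ≤ q) [IsFiniteMeasure κ]
    (hκ : ∀ᵐ σ ∂κ, 0 ≤ σ) (hκ0 : κ ≠ 0) (ha : sqNorm q κ a < ⊤) :
    ∀ᵐ ω ∂μ, ⨆ N : ℕ+, mixNorm p q κ (partialSum N (randomize X a ω)) < ⊤ := by
  have hp := hr.trans_le hrp
  have hq := hr.trans_le hrq
  obtain ⟨C, hC, hCP⟩ := hX.exists_lintegral_mixNorm_rpow_le hp hq hκ hκ0 hr
  set D : ℝ≥0∞ := C * sqNorm q κ a ^ r with hD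
  have hDtop : D ≠ ⊤ := ENNReal.mul_ne_top hC (ENNReal.rpow_ne_top_of_nonneg hr.le ha.ne)
  -- Markov's inequality with one constant for every polynomial dominated coefficientwise by `a`:
  -- this covers both partial sums and blocks between two of them, as Ottaviani's inequality
  -- requires.
  have hmarkov : ∀ P : ℕ+ →₀ ℂ, (∀ n, ‖P n‖ ≤ ‖a n‖) → ∀ M : ℕ, M ≠ 0 →
      μ {ω | (M : ℝ≥0∞) ≤ mixNorm p q κ (lmul P fun n => X n ω) ^ r} ≤ D / M := by
    intro P hP M hM
    refine (meas_ge_le_lintegral_div ((hX.measurable_mixNorm p q κ P).pow_const r).aemeasurable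
      (by exact_mod_cast hM) (ENNReal.natCast_ne_top M)).trans ?_
    refine ENNReal.div_le_div_right ((hCP P).trans ?_) _
    rw [hD, mixNorm_two]
    exact mul_le_mul' le_rfl (ENNReal.rpow_le_rpow (sqNorm_mono hq κ hP) hr.le)
  set v : ℕ → Ω → ℝ≥0∞ := fun i ω =>
    mixNorm p q κ (lmul (partialSum (Nat.succPNat i) a) fun n => X n ω) ^ r with hv
  have hvm : ∀ i, Measurable (v i) := fun i => (hX.measurable_mixNorm p q κ _).pow_const r
  have hmax : ∀ M : ℕ, M ≠ 0 → ∀ L, μ {ω | ∃ i ≤ L, (M : ℝ≥0∞) + M < v i ω} ≤ D / M + D / M := by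
    intro M hM L
    refine measure_exists_lt_le_of_indepFun (w := fun i ω => mixNorm p q κ
      (lmul (partialSum (Nat.succPNat L) a - partialSum (Nat.succPNat i) a) fun n => X n ω) ^ r)
      hvm (fun i _ ω => ?_) (fun i hi => ?_) (fun i hi => ?_) ?_
    · have := mixNorm_sub_rpow_le κ hr hr1 hrp hrq
        (lmul (partialSum (Nat.succPNat L) a) fun n => X n ω)
        (lmul (partialSum (Nat.succPNat L) a - partialSum (Nat.succPNat i) a) fun n => X n ω)
      rwa [← sub_lmul, sub_sub_cancel] at this
    · have hle : Nat.succPNat i ≤ Nat.succPNat L := Nat.succPNat_le_succPNat.2 hi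
      refine hX.indepFun_mixNorm (P := fun j => partialSum (Nat.succPNat (min j i)) a)
        (S := Finset.Icc 1 (Nat.succPNat i))
        (T := Finset.Icc 1 (Nat.succPNat L) \ Finset.Icc 1 (Nat.succPNat i))
        Finset.disjoint_sdiff (fun j n hn => ?_) (fun n hn => ?_) r
      · rw [partialSum_apply, if_neg]
        intro h
        exact hn (Finset.mem_Icc.2 ⟨one_le,
          h.trans (Nat.succPNat_le_succPNat.2 (min_le_right _ _))⟩)
      · rw [Finsupp.sub_apply, partialSum_apply, partialSum_apply]
        by_cases h1 : n ≤ Nat.succPNat i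
        · simp [h1, h1.trans hle]
        · have h2 : ¬ n ≤ Nat.succPNat L := fun h2 => hn (by simp [h1, h2])
          simp [h1, h2]
    · exact hmarkov _ (norm_partialSum_sub_apply_le (Nat.succPNat_le_succPNat.2 hi) a) M hM
    · exact hmarkov _ (norm_partialSum_apply_le _ a) M hM
  have hsup : ∀ M : ℕ, M ≠ 0 → μ {ω | ⨆ i, v i ω = ⊤} ≤ D / M + D / M := by
    intro M hM
    have hmono : Monotone fun L => {ω | ∃ i ≤ L, (M : ℝ≥0∞) + M < v i ω} :=
      fun L L' h ω ⟨i, hi, hi'⟩ => ⟨i, hi.trans h, hi'⟩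
    have hsub : {ω | ⨆ i, v i ω = ⊤} ⊆ ⋃ L, {ω | ∃ i ≤ L, (M : ℝ≥0∞) + M < v i ω} := by
      intro ω hω
      have : (M : ℝ≥0∞) + M < ⨆ i, v i ω := by
        rw [show ⨆ i, v i ω = ⊤ from hω]
        exact ENNReal.add_lt_top.2 ⟨ENNReal.natCast_lt_top M, ENNReal.natCast_lt_top M⟩
      obtain ⟨i, hi⟩ := lt_iSup_iff.1 this
      exact Set.mem_iUnion.2 ⟨i, i, le_rfl, hi⟩
    refine (measure_mono hsub).trans ?_
    rw [hmono.measure_iUnion]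
    exact iSup_le fun L => hmax M hM L
  have hnull : μ {ω | ⨆ i, v i ω = ⊤} = 0 := by
    have hlim : Tendsto (fun M : ℕ => D / (M : ℝ≥0∞) + D / M) atTop (𝓝 (0 + 0)) := by
      have : Tendsto (fun M : ℕ => D / (M : ℝ≥0∞)) atTop (𝓝 0) := by
        simpa [div_eq_mul_inv] using
          ENNReal.Tendsto.const_mul ENNReal.tendsto_inv_nat_nhds_zero (Or.inr hDtop)
      exact this.add this
    rw [add_zero] at hlim
    refine le_antisymm (ge_of_tendsto hlim ?_) bot_le
    filter_upwards [eventually_ge_atTop 1] with M hM using hsup M (by omega)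
  have hae : ∀ᵐ ω ∂μ, ¬ ⨆ i, v i ω = ⊤ := by rw [ae_iff]; simpa using hnull
  filter_upwards [hae] with ω hω
  have hle : ⨆ N : ℕ+, mixNorm p q κ (partialSum N (randomize X a ω)) ≤
      (⨆ i, v i ω) ^ (1 / r) := by
    refine iSup_le fun N => ?_
    rw [one_div, ENNReal.le_rpow_inv_iff hr, partialSum_randomize]
    refine le_trans (le_of_eq ?_) (le_iSup (fun i => v i ω) N.natPred)
    simp [hv, PNat.succPNat_natPred]
  exact hle.trans_lt (ENNReal.rpow_lt_top_of_nonneg (by positivity) hω)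

/-- If coefficientwise approximations of the randomization are almost surely bounded, then the
norm of `f` in the mixed norm space with first exponent `2` is finite. -/
lemma IsStandardRandomSequence.sqNorm_lt_top_of_ae (hX : IsStandardRandomSequence X μ)
    (hr : 0 < r) (hrp : r ≤ p) (hrq : r ≤ q) [IsFiniteMeasure κ]
    (hκ : ∀ᵐ σ ∂κ, 0 ≤ σ) (hκ0 : κ ≠ 0) {Λ : ℕ → ℕ+ →₀ ℂ}
    (hΛ : ∀ n, Tendsto (fun m => Λ m n) atTop (𝓝 1))
    (h : ∀ᵐ ω ∂μ, ⨆ m, mixNorm p q κ (lmul (Λ m) (randomize X a ω)) < ⊤) :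
    sqNorm q κ a < ⊤ := by
  have hq := hr.trans_le hrq
  simp only [lmul_randomize] at h
  set G : Ω → ℝ≥0∞ := fun ω => ⨆ m, mixNorm p q κ (lmul (lmul (Λ m) a) fun n => X n ω) with hG
  have hGm : Measurable G := .iSup fun m => hX.measurable_mixNorm p q κ _
  have hlim : Tendsto (μ ∘ fun M : ℕ => {ω | (M : ℝ≥0∞) < G ω}) atTop
      (𝓝 (μ (⋂ M : ℕ, {ω | (M : ℝ≥0∞) < G ω}))) :=
    tendsto_measure_iInter_atTop
      (fun M => (measurableSet_lt measurable_const hGm).nullMeasurableSet)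
      (fun M N hMN ω (hω : (N : ℝ≥0∞) < G ω) => lt_of_le_of_lt (Nat.cast_le.2 hMN) hω) ⟨0,
        measure_ne_top _ _⟩
  have hnull : μ (⋂ M : ℕ, {ω | (M : ℝ≥0∞) < G ω}) = 0 := by
    refine measure_mono_null (fun ω hω => ?_) (ae_iff.1 h)
    intro hlt
    obtain ⟨M, hM⟩ := ENNReal.exists_nat_gt hlt.ne
    exact hM.not_gt (Set.mem_iInter.1 hω M)
  rw [hnull] at hlim
  -- With `M` chosen so that `G > M` has probability below `lowerConst`, a norm of the `m`-th
  -- approximation of `f` above `M / c` would put an event of probability at least `lowerConst`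
  -- inside `G > M`. One `M` serves all `m`.
  obtain ⟨M, hM⟩ := (hlim.eventually (gt_mem_nhds lowerConst_pos)).exists
  set c : ℝ≥0∞ := (1 / 2) * lowerConst ^ (1 / r) with hc
  have hc0 : c ≠ 0 := mul_ne_zero (by simp)
    (ENNReal.rpow_pos lowerConst_pos lowerConst_ne_top).ne'
  have hbound : ∀ m, sqNorm q κ (lmul (Λ m) a) ≤ M / c := by
    intro m
    rw [← mixNorm_two, ENNReal.le_div_iff_mul_le (Or.inl hc0) (Or.inr (by simp))]
    by_contra hlt
    refine hM.not_ge ((hX.lowerConst_le_measure hr hrp hrq hκ hκ0 (lmul (Λ m) a)).trans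
      (measure_mono fun ω hω => ?_))
    exact (not_le.1 hlt).trans_le (le_trans hω (le_iSup (fun m => mixNorm p q κ
      (lmul (lmul (Λ m) a) fun n => X n ω)) m))
  refine (sqNorm_le_of_tendsto hq κ (fun n => ?_) hbound).trans_lt
    (ENNReal.div_lt_top (by simp) hc0)
  simpa using (hΛ n).mul_const (a n)

end Random

/-! ### Cauchy sequences of polynomials -/

lemma Represents.comp {ν : (ℕ+ →₀ ℂ) → ℝ≥0∞} {P : ℕ → ℕ+ →₀ ℂ} {a : ℕ+ → ℂ}
    (h : Represents ν P a) {φ : ℕ → ℕ} (hφ : StrictMono φ) :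
    Represents ν (fun j => P (φ j)) a := by
  refine ⟨fun ε hε => ?_, fun n => (h.2 n).comp hφ.tendsto_atTop⟩
  obtain ⟨K, hK⟩ := h.1 ε hε
  exact ⟨K, fun j hj k hk => hK _ (hj.trans (hφ.id_le j)) _ (hk.trans (hφ.id_le k))⟩

/-- A subsequence of a Cauchy sequence represents the same series, so the upper limit in the norm of
the completion can be replaced by a lower limit, the form needed for Fatou's lemma. -/
lemma Represents.completionNorm_le_liminf {ν : (ℕ+ →₀ ℂ) → ℝ≥0∞} {P : ℕ → ℕ+ →₀ ℂ} {a : ℕ+ → ℂ}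
    (h : Represents ν P a) : completionNorm ν a ≤ liminf (fun j => ν (P j)) atTop := by
  refine le_of_forall_gt fun c hc => ?_
  obtain ⟨d, hd, hdc⟩ := exists_between hc
  have hfreq : ∃ᶠ j in atTop, ν (P j) < d := frequently_lt_of_liminf_lt (h := hd)
  obtain ⟨φ, hφ, hφ'⟩ := extraction_of_frequently_atTop hfreq
  refine lt_of_le_of_lt ?_ hdc
  refine (iInf₂_le (f := fun P (_ : Represents ν P a) => limsup (fun j => ν (P j)) atTop) _
    (h.comp hφ)).trans ?_
  exact limsup_le_of_le (h := .of_forall fun j => (hφ' j).le)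

/-- A series of polynomials is Cauchy if the norms of its terms have summable `r`-th powers. -/
lemma represents_of_tsum_lt_top {p q r : ℝ} {κ : Measure ℝ} (hr : 0 < r) (hr1 : r ≤ 1) (hrp : r ≤ p)
    (hrq : r ≤ q) {P : ℕ → ℕ+ →₀ ℂ} {a : ℕ+ → ℂ}
    (hP : ∑' j, mixNorm p q κ (P (j + 1) - P j) ^ r < ⊤)
    (hlim : ∀ n, Tendsto (fun j => P j n) atTop (𝓝 (a n))) :
    Represents (mixNorm p q κ) P a := by
  refine ⟨fun ε hε => ?_, hlim⟩
  set d : ℕ → ℝ≥0∞ := fun j => mixNorm p q κ (P (j + 1) - P j) ^ r with hd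
  have htel : ∀ j n, mixNorm p q κ (P (j + n) - P j) ^ r ≤ ∑ i ∈ Finset.range n, d (i + j) := by
    intro j n
    induction n with
    | zero => simp [mixNorm_zero (hr.trans_le hrp) (hr.trans_le hrq), hr]
    | succ n ih =>
      have := mixNorm_add_rpow_le κ hr hr1 hrp hrq (P (j + n) - P j) (P (j + n + 1) - P (j + n))
      rw [sub_add_sub_cancel'] at this
      rw [Finset.sum_range_succ]
      refine this.trans (add_le_add ih (le_of_eq ?_))
      simp only [hd, add_comm n j]
  obtain ⟨K, hK⟩ := eventually_atTop.1 ((ENNReal.tendsto_sum_nat_add d hP.ne).eventually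
    (gt_mem_nhds (ENNReal.rpow_pos_of_nonneg hε hr.le)))
  have hlt : ∀ j ≥ K, ∀ k ≥ j, mixNorm p q κ (P k - P j) < ε := by
    intro j hj k hk
    obtain ⟨n, rfl⟩ := Nat.exists_eq_add_of_le hk
    exact (ENNReal.rpow_lt_rpow_iff hr).1
      (((htel j n).trans (ENNReal.sum_le_tsum _)).trans_lt (hK j hj))
  refine ⟨K, fun j hj k hk => ?_⟩
  rcases le_total j k with h | h
  · rw [← neg_sub, mixNorm_neg]
    exact hlt j hj k h
  · exact hlt k hk j h

/-! ### Exponential integrability -/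

lemma le_exp_coe (y : ℝ≥0∞) : y ≤ EReal.exp (y : EReal) := by
  induction y with
  | top => simp
  | coe y =>
    rw [show (((y : ℝ≥0∞) : EReal)) = ((y : ℝ) : EReal) from rfl, EReal.exp_coe,
      ← ENNReal.ofReal_coe_nnreal]
    exact ENNReal.ofReal_le_ofReal (by linarith [Real.add_one_le_exp (y : ℝ)])

/-- For finite values this is the exponential series; at `∞` the linear term alone makes the right
side infinite. -/
lemma exp_coe_le_tsum (y : ℝ≥0∞) : EReal.exp (y : EReal) ≤ ∑' k : ℕ, y ^ k / k.factorial := by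
  induction y with
  | top => exact le_top.trans (le_trans (by simp) (ENNReal.le_tsum 1))
  | coe y =>
    have h := NormedSpace.expSeries_div_hasSum_exp (y : ℝ)
    rw [show (((y : ℝ≥0∞) : EReal)) = ((y : ℝ) : EReal) from rfl, EReal.exp_coe,
      Real.exp_eq_exp_ℝ, ← h.tsum_eq, ENNReal.ofReal_tsum_of_nonneg (fun k => by positivity)
        h.summable]
    refine ENNReal.tsum_le_tsum fun k => le_of_eq ?_
    rw [ENNReal.ofReal_div_of_pos (by positivity), ENNReal.ofReal_pow y.coe_nonneg,
      ENNReal.ofReal_coe_nnreal, ENNReal.ofReal_natCast]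

lemma one_add_pow_le_two_pow_mul (x : ℝ≥0∞) (k : ℕ) : (1 + x) ^ k ≤ 2 ^ k * (1 + x ^ k) := by
  rcases le_total x 1 with h | h
  · calc (1 + x) ^ k ≤ (1 + 1) ^ k := by gcongr
      _ = 2 ^ k * 1 := by rw [one_add_one_eq_two, mul_one]
      _ ≤ _ := by gcongr; exact le_self_add
  · calc (1 + x) ^ k ≤ (x + x) ^ k := by gcongr
      _ = 2 ^ k * x ^ k := by rw [← two_mul, mul_pow]
      _ ≤ _ := by gcongr; exact le_add_self

lemma rpow_le_one_add_rpow (x : ℝ≥0∞) {s t : ℝ} (hs : 0 < s) (hst : s ≤ t) :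
    x ^ s ≤ 1 + x ^ t := by
  rcases le_total x 1 with h | h
  · exact (ENNReal.rpow_le_one h hs.le).trans le_self_add
  · exact (ENNReal.rpow_le_rpow_of_exponent_le h hst).trans le_add_self

/-- The factorials in the moments cancel those of the exponential series and leave geometric series
of ratios `2l` and `2lA`, both at most `1/2` for `l = 1/(4(1 + A))`. Positive moments of order below
`k₀` are bounded by one plus the moment of order `k₀`. The shift `1 + V` prepares for the inequality
`V^r ≤ 1 + V`. -/
lemma exists_lintegral_exp_lt_top {Ω : Type*} [MeasurableSpace Ω] {μ : Measure Ω}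
    [IsProbabilityMeasure μ] {V : Ω → ℝ≥0∞} (hV : Measurable V) {K A : ℝ≥0∞} (hK : K ≠ ⊤)
    (hA : A ≠ ⊤) {k₀ : ℕ} (h : ∀ k ≥ k₀, ∫⁻ ω, V ω ^ k ∂μ ≤ K * k.factorial * A ^ k) :
    ∃ l : ℝ≥0, 0 < l ∧ ∫⁻ ω, EReal.exp (((l * (1 + V ω) : ℝ≥0∞)) : EReal) ∂μ < ⊤ := by
  lift A to ℝ≥0 using hA
  set l : ℝ≥0 := (4 * (1 + A))⁻¹ with hl
  have hlpos : 0 < l := by positivity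
  set M : ℝ≥0∞ := 1 + K * k₀.factorial * (A : ℝ≥0∞) ^ k₀ with hM
  have hMtop : M ≠ ⊤ := by
    refine ENNReal.add_ne_top.2 ⟨by simp, ENNReal.mul_ne_top (ENNReal.mul_ne_top hK (by simp)) ?_⟩
    exact ENNReal.pow_ne_top (by simp)
  have hVk : ∀ k : ℕ, ∫⁻ ω, V ω ^ k ∂μ ≤ M + K * k.factorial * (A : ℝ≥0∞) ^ k := by
    intro k
    rcases le_total k₀ k with hk | hk
    · exact (h k hk).trans le_add_self
    · refine le_trans ?_ (le_self_add (a := M))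
      rcases k.eq_zero_or_pos with rfl | hk0
      · simp [hM]
      calc ∫⁻ ω, V ω ^ k ∂μ ≤ ∫⁻ ω, (1 + V ω ^ k₀) ∂μ := by
            refine lintegral_mono fun ω => ?_
            have := rpow_le_one_add_rpow (V ω) (s := k) (t := k₀) (by exact_mod_cast hk0)
              (by exact_mod_cast hk)
            simpa only [ENNReal.rpow_natCast] using this
        _ = 1 + ∫⁻ ω, V ω ^ k₀ ∂μ := by rw [lintegral_add_left measurable_const]; simp
        _ ≤ M := by rw [hM]; gcongr; exact h k₀ le_rfl
  have hterm : ∀ k : ℕ, ∫⁻ ω, (l * (1 + V ω) : ℝ≥0∞) ^ k / k.factorial ∂μ ≤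
      (1 + M) * ((2 * l : ℝ≥0) : ℝ≥0∞) ^ k + K * ((2 * l * A : ℝ≥0) : ℝ≥0∞) ^ k := by
    intro k
    have hfac : (k.factorial : ℝ≥0∞) ≠ 0 := by exact_mod_cast k.factorial_ne_zero
    have hone : (1 : ℝ≥0∞) ≤ k.factorial := by exact_mod_cast k.factorial_pos
    have hpt : ∀ ω, (l * (1 + V ω) : ℝ≥0∞) ^ k ≤ ((2 * l : ℝ≥0) : ℝ≥0∞) ^ k * (1 + V ω ^ k) :=
      fun ω => by
        rw [mul_pow]
        refine (mul_le_mul' le_rfl (one_add_pow_le_two_pow_mul (V ω) k)).trans (le_of_eq ?_)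
        push_cast
        rw [mul_pow]
        ring
    simp only [div_eq_mul_inv]
    rw [lintegral_mul_const' _ _ (ENNReal.inv_ne_top.2 hfac), ← div_eq_mul_inv]
    refine ENNReal.div_le_of_le_mul ((lintegral_mono hpt).trans ?_)
    rw [lintegral_const_mul _ ((hV.pow_const k).const_add 1),
      lintegral_add_left measurable_const, lintegral_const, measure_univ, mul_one]
    calc ((2 * l : ℝ≥0) : ℝ≥0∞) ^ k * (1 + ∫⁻ ω, V ω ^ k ∂μ)
        ≤ ((2 * l : ℝ≥0) : ℝ≥0∞) ^ k * (1 + (M + K * k.factorial * (A : ℝ≥0∞) ^ k)) := by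
          gcongr; exact hVk k
      _ = (1 + M) * ((2 * l : ℝ≥0) : ℝ≥0∞) ^ k * 1 +
          K * ((2 * l * A : ℝ≥0) : ℝ≥0∞) ^ k * k.factorial := by
          push_cast
          simp only [mul_pow]
          ring
      _ ≤ _ := (add_le_add (mul_le_mul' le_rfl hone) le_rfl).trans (add_mul _ _ _).ge
  refine ⟨l, hlpos, ?_⟩
  calc ∫⁻ ω, EReal.exp (((l * (1 + V ω) : ℝ≥0∞)) : EReal) ∂μ
      ≤ ∫⁻ ω, ∑' k : ℕ, (l * (1 + V ω) : ℝ≥0∞) ^ k / k.factorial ∂μ :=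
        lintegral_mono fun ω => exp_coe_le_tsum _
    _ = ∑' k : ℕ, ∫⁻ ω, (l * (1 + V ω) : ℝ≥0∞) ^ k / k.factorial ∂μ := by
        refine lintegral_tsum fun k => Measurable.aemeasurable ?_
        exact (((measurable_const.add hV).const_mul _).pow_const k).div_const _
    _ ≤ ∑' k : ℕ, ((1 + M) * ((2 * l : ℝ≥0) : ℝ≥0∞) ^ k +
          K * ((2 * l * A : ℝ≥0) : ℝ≥0∞) ^ k) := ENNReal.tsum_le_tsum hterm
    _ < ⊤ := by
        have hgeom : ∀ x : ℝ≥0, x < 1 → ∑' k : ℕ, (x : ℝ≥0∞) ^ k ≠ ⊤ := fun x hx => by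
          rw [ENNReal.tsum_geometric]
          exact ENNReal.inv_ne_top.2 (tsub_pos_of_lt (by exact_mod_cast hx)).ne'
        have h2l : 2 * l * (1 + A) = 1 / 2 := by
          rw [hl]; field_simp; norm_num
        have hhalf : (1 / 2 : ℝ≥0) < 1 := by norm_num
        rw [ENNReal.tsum_add, ENNReal.tsum_mul_left, ENNReal.tsum_mul_left]
        refine ENNReal.add_lt_top.2 ⟨ENNReal.mul_lt_top ?_ ?_, ENNReal.mul_lt_top hK.lt_top ?_⟩
        · exact ENNReal.add_lt_top.2 ⟨by simp, hMtop.lt_top⟩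
        · refine (hgeom _ (lt_of_le_of_lt ?_ hhalf)).lt_top
          rw [← h2l]
          exact le_mul_of_one_le_right' le_self_add
        · refine (hgeom _ (lt_of_le_of_lt ?_ hhalf)).lt_top
          rw [← h2l]
          exact mul_le_mul' le_rfl le_add_self

/-! ### The symbol spaces -/

section Random

variable {Ω : Type*} [MeasurableSpace Ω] {X : ℕ+ → Ω → ℂ} {μ : Measure Ω} [IsProbabilityMeasure μ]
  {κ : Measure ℝ} [IsFiniteMeasure κ] {p q r : ℝ} {a : ℕ+ → ℂ}

/-- If `f` belongs to the mixed norm space with first exponent `2`, then some sequence of partial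
sums of its randomization is almost surely Cauchy. -/
lemma IsStandardRandomSequence.exists_ae_represents (hX : IsStandardRandomSequence X μ)
    (hr : 0 < r) (hr1 : r ≤ 1) (hrp : r ≤ p) (hrq : r ≤ q)
    (hκ : ∀ᵐ σ ∂κ, 0 ≤ σ) (hκ0 : κ ≠ 0) (ha : sqNorm q κ a < ⊤) :
    ∃ φ : ℕ → ℕ+, ∀ᵐ ω ∂μ, Represents (mixNorm p q κ)
      (fun j => partialSum (φ j) (randomize X a ω)) (randomize X a ω) := by
  have hp := hr.trans_le hrp
  have hq := hr.trans_le hrq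
  obtain ⟨C, hC, hCP⟩ := hX.exists_lintegral_mixNorm_rpow_le hp hq hκ hκ0 hr
  have hε : ∀ j : ℕ, (0 : ℝ≥0∞) < ((2⁻¹ : ℝ≥0∞) ^ j) ^ (1 / r) := fun j =>
    ENNReal.rpow_pos_of_nonneg (ENNReal.pow_pos (by simp) j) (by positivity)
  -- The indices are chosen so that the `r`-th powers of the `H^{2,q}` norms of successive blocks
  -- are at most `2^{-j}`; the expected `r`-th powers of the random blocks are then summable.
  obtain ⟨φ, hφ, hφ'⟩ := extraction_forall_of_eventually'
    (P := fun j k => ∀ l ≥ k, sqNorm q κ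
      ⇑(partialSum (Nat.succPNat l) a - partialSum (Nat.succPNat k) a) <
        ((2⁻¹ : ℝ≥0∞) ^ j) ^ (1 / r)) fun j => by
      obtain ⟨K, hK⟩ := exists_sqNorm_partialSum_sub_le hq κ ha (hε j)
      exact ⟨K, fun k hk l hl => hK l (hk.trans hl) k hk⟩
  refine ⟨fun j => Nat.succPNat (φ j), ?_⟩
  set D : ℕ → ℕ+ →₀ ℂ := fun j =>
    partialSum (Nat.succPNat (φ (j + 1))) a - partialSum (Nat.succPNat (φ j)) a with hD
  have hDj : ∀ j, ∫⁻ ω, mixNorm p q κ (lmul (D j) fun n => X n ω) ^ r ∂μ ≤ C * 2⁻¹ ^ j := by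
    intro j
    refine (hCP (D j)).trans (mul_le_mul' le_rfl ?_)
    have := (hφ' j (φ (j + 1)) (hφ j.lt_succ_self).le).le
    rw [one_div, ENNReal.le_rpow_inv_iff hr] at this
    rwa [mixNorm_two]
  have hmeas : ∀ j, Measurable fun ω => mixNorm p q κ (lmul (D j) fun n => X n ω) ^ r :=
    fun j => (hX.measurable_mixNorm p q κ _).pow_const r
  have hsum : ∫⁻ ω, ∑' j, mixNorm p q κ (lmul (D j) fun n => X n ω) ^ r ∂μ ≠ ⊤ := by
    rw [lintegral_tsum fun j => (hmeas j).aemeasurable]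
    refine ((ENNReal.tsum_le_tsum hDj).trans_lt ?_).ne
    rw [ENNReal.tsum_mul_left, ENNReal.tsum_geometric]
    exact ENNReal.mul_lt_top hC.lt_top (by simp)
  filter_upwards [ae_lt_top (Measurable.tsum hmeas) hsum] with ω hω
  refine represents_of_tsum_lt_top hr hr1 hrp hrq ?_ fun n => ?_
  · simpa only [partialSum_randomize, ← sub_lmul] using hω
  · exact (tendsto_partialSum_apply _ n).comp (tendsto_succPNat.comp hφ.tendsto_atTop)

/-- A measurable majorant of the norm of the randomization. -/
lemma IsStandardRandomSequence.exists_majorant (hX : IsStandardRandomSequence X μ)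
    (hr : 0 < r) (hr1 : r ≤ 1) (hrp : r ≤ p) (hrq : r ≤ q)
    (hκ : ∀ᵐ σ ∂κ, 0 ≤ σ) (hκ0 : κ ≠ 0) (ha : sqNorm q κ a < ⊤) :
    ∃ V : Ω → ℝ≥0∞, Measurable V ∧
      (∀ᵐ ω ∂μ, completionNorm (mixNorm p q κ) (randomize X a ω) ≤ V ω) ∧
      ∀ k : ℕ, p ≤ k → q ≤ k →
        ∫⁻ ω, V ω ^ k ∂μ ≤ momentConst * k.factorial * sqNorm q κ a ^ k := by
  obtain ⟨φ, hφ⟩ := hX.exists_ae_represents hr hr1 hrp hrq hκ hκ0 ha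
  have hp := hr.trans_le hrp
  have hq := hr.trans_le hrq
  have hm : ∀ j, Measurable fun ω => mixNorm p q κ (lmul (partialSum (φ j) a) fun n => X n ω) :=
    fun j => hX.measurable_mixNorm p q κ _
  -- Each term is measurable and inherits its moment bound from `f`, so Fatou's lemma keeps the same
  -- factorial constant for the lower limit.
  refine ⟨fun ω => liminf (fun j => mixNorm p q κ (lmul (partialSum (φ j) a) fun n => X n ω)) atTop,
    .liminf hm, ?_, fun k hpk hqk => ?_⟩
  · filter_upwards [hφ] with ω hω
    simpa only [partialSum_randomize] using hω.completionNorm_le_liminf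
  · have hk : (0 : ℝ) < k := hp.trans_le hpk
    have e : ∀ ω, liminf (fun j => mixNorm p q κ (lmul (partialSum (φ j) a) fun n => X n ω))
        atTop ^ k = liminf (fun j => mixNorm p q κ
          (lmul (partialSum (φ j) a) fun n => X n ω) ^ (k : ℝ)) atTop := fun ω => by
      rw [← ENNReal.rpow_natCast]
      exact (ENNReal.orderIsoRpow k hk).liminf_apply
    simp only [e]
    refine (lintegral_liminf_le fun j => (hm j).pow_const _).trans ?_
    refine liminf_le_of_frequently_le' (.of_forall fun j => ?_)
    refine (hX.lintegral_mixNorm_pow_le hp hq hκ hκ0 hpk hqk _).trans ?_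
    rw [ENNReal.rpow_natCast, mixNorm_two]
    gcongr
    exact sqNorm_mono hq κ (norm_partialSum_apply_le _ a)

/-- Every implication passes through the deterministic condition in the last place. Upper bounds use
the measurable majorant of the norm; lower bounds use the supremum over the multipliers `Λ m`,
measurable and at most `B^{1/p}` times the norm. -/
theorem IsStandardRandomSequence.tfae_mixNorm (hX : IsStandardRandomSequence X μ)
    (hr : 0 < r) (hr1 : r ≤ 1) (hrp : r ≤ p) (hrq : r ≤ q)
    (hκ : ∀ᵐ σ ∂κ, 0 ≤ σ) (hκ0 : κ ≠ 0) (a : ℕ+ → ℂ) :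
    List.TFAE [
      ∀ᵐ ω ∂μ, randomize X a ω ∈ completionSpace (mixNorm p q κ),
      ∀ᵐ ω ∂μ, (⨆ N : ℕ+, mixNorm p q κ (partialSum N (randomize X a ω))) < ⊤,
      ∃ t : ℝ, 0 < t ∧
        ∫⁻ ω, completionNorm (mixNorm p q κ) (randomize X a ω) ^ t ∂μ < ⊤,
      ∀ t : ℝ, 0 < t →
        ∫⁻ ω, completionNorm (mixNorm p q κ) (randomize X a ω) ^ t ∂μ < ⊤,
      ∃ l : ℝ≥0, 0 < l ∧ ∫⁻ ω, EReal.exp (((l : ℝ≥0∞) *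
        completionNorm (mixNorm p q κ) (randomize X a ω) ^ r : ℝ≥0∞) : EReal) ∂μ < ⊤,
      sqNorm q κ a < ⊤] := by
  have hp := hr.trans_le hrp
  have hq := hr.trans_le hrq
  obtain ⟨Λ, hΛ, hΛ'⟩ := exists_isTorusMultiplier_tendsto_one hp
  set B : ℝ≥0∞ := ENNReal.ofReal (Real.exp 1) with hB
  have hB0 : B ≠ 0 := by simp [hB, Real.exp_pos]
  have hB1 : B ≠ ⊤ := ENNReal.ofReal_ne_top
  have hBp : B ^ (1 / p) ≠ ⊤ := ENNReal.rpow_ne_top_of_nonneg (by positivity) hB1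
  have hG : ∀ b : ℕ+ → ℂ, ⨆ m, mixNorm p q κ (lmul (Λ m) b) ≤
      B ^ (1 / p) * completionNorm (mixNorm p q κ) b := fun b =>
    iSup_le fun m => (hΛ' m).mixNorm_le_completionNorm hp hq hκ hB0 hB1 b
  tfae_have 6 → 1 := fun ha => by
    obtain ⟨φ, hφ⟩ := hX.exists_ae_represents hr hr1 hrp hrq hκ hκ0 ha
    filter_upwards [hφ] with ω hω using ⟨_, hω⟩
  tfae_have 1 → 6 := fun h => by
    refine hX.sqNorm_lt_top_of_ae hr hrp hrq hκ hκ0 hΛ ?_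
    filter_upwards [h] with ω hω
    exact (hG _).trans_lt (ENNReal.mul_lt_top hBp.lt_top
        ((mem_completionSpace_iff hp hq hκ _).1 hω))
  tfae_have 6 → 2 := hX.ae_iSup_mixNorm_lt_top hr hr1 hrp hrq hκ hκ0
  tfae_have 2 → 6 := fun h => by
    refine hX.sqNorm_lt_top_of_ae hr hrp hrq hκ hκ0 (Λ := fun m => cutoff (Nat.succPNat m))
      (fun n => ?_) ?_
    · have := (tendsto_partialSum_apply (fun _ => 1) n).comp tendsto_succPNat
      refine this.congr fun m => ?_
      simp [partialSum_eq_lmul]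
    · filter_upwards [h] with ω hω
      refine lt_of_le_of_lt (iSup_le fun m => ?_) hω
      rw [← partialSum_eq_lmul]
      exact le_iSup (fun N => mixNorm p q κ (partialSum N (randomize X a ω))) (Nat.succPNat m)
  tfae_have 6 → 4 := fun ha t ht => by
    obtain ⟨V, hV, hle, hVk⟩ := hX.exists_majorant hr hr1 hrp hrq hκ hκ0 ha
    obtain ⟨k, hk⟩ := exists_nat_ge (max t (max p q))
    have htk : t ≤ k := (le_max_left _ _).trans hk
    have hpk : p ≤ k := ((le_max_left _ _).trans (le_max_right _ _)).trans hk
    have hqk : q ≤ k := ((le_max_right _ _).trans (le_max_right _ _)).trans hk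
    calc ∫⁻ ω, completionNorm (mixNorm p q κ) (randomize X a ω) ^ t ∂μ
        ≤ ∫⁻ ω, (1 + V ω ^ k) ∂μ := by
          refine lintegral_mono_ae ?_
          filter_upwards [hle] with ω hω
          refine (ENNReal.rpow_le_rpow hω ht.le).trans ?_
          rw [← ENNReal.rpow_natCast]
          exact rpow_le_one_add_rpow _ ht htk
      _ = 1 + ∫⁻ ω, V ω ^ k ∂μ := by rw [lintegral_add_left measurable_const]; simp
      _ < ⊤ := by
          refine ENNReal.add_lt_top.2 ⟨by simp, (hVk k hpk hqk).trans_lt ?_⟩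
          exact ENNReal.mul_lt_top (ENNReal.mul_lt_top ENNReal.ofReal_lt_top (by simp))
            (ENNReal.pow_lt_top ha)
  tfae_have 6 → 5 := fun ha => by
    obtain ⟨V, hV, hle, hVk⟩ := hX.exists_majorant hr hr1 hrp hrq hκ hκ0 ha
    obtain ⟨k₀, hk₀⟩ := exists_nat_ge (max p q)
    obtain ⟨l, hl, hlt⟩ := exists_lintegral_exp_lt_top hV (K := momentConst)
      ENNReal.ofReal_ne_top ha.ne (k₀ := k₀) fun k hk => by
        have hk' : max p q ≤ k := hk₀.trans (by exact_mod_cast hk)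
        exact hVk k ((le_max_left _ _).trans hk') ((le_max_right _ _).trans hk')
    refine ⟨l, hl, lt_of_le_of_lt (lintegral_mono_ae ?_) hlt⟩
    filter_upwards [hle] with ω hω
    refine EReal.exp_monotone (EReal.coe_ennreal_le_coe_ennreal_iff.2 (mul_le_mul' le_rfl ?_))
    refine (ENNReal.rpow_le_rpow hω hr.le).trans ?_
    simpa using rpow_le_one_add_rpow (V ω) hr hr1
  tfae_have 4 → 3 := fun h => ⟨1, one_pos, h 1 one_pos⟩
  -- The inequality `y ≤ e^y` gives the moment of order `r`. Monotonicity and scaling by a finite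
  -- constant hold for integrals of arbitrary functions, so measurability of the norm is not needed.
  tfae_have 5 → 3 := fun ⟨l, hl, h⟩ => by
    refine ⟨r, hr, ?_⟩
    have h1 := (lintegral_mono fun ω => le_exp_coe ((l : ℝ≥0∞) *
      completionNorm (mixNorm p q κ) (randomize X a ω) ^ r)).trans_lt h
    rw [lintegral_const_mul' _ _ ENNReal.coe_ne_top] at h1
    exact (ENNReal.lt_top_of_mul_ne_top_right h1.ne (by exact_mod_cast hl.ne'))
  tfae_have 3 → 6 := fun ⟨t, ht, h⟩ => by
    refine hX.sqNorm_lt_top_of_ae hr hrp hrq hκ hκ0 hΛ ?_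
    have hGm : Measurable fun ω => (⨆ m, mixNorm p q κ (lmul (Λ m) (randomize X a ω))) ^ t := by
      simp only [lmul_randomize]
      exact (Measurable.iSup fun m => hX.measurable_mixNorm p q κ _).pow_const t
    have hint : ∫⁻ ω, (⨆ m, mixNorm p q κ (lmul (Λ m) (randomize X a ω))) ^ t ∂μ ≠ ⊤ := by
      refine ((lintegral_mono fun ω => ENNReal.rpow_le_rpow (hG _) ht.le).trans_lt ?_).ne
      simp only [ENNReal.mul_rpow_of_nonneg _ _ ht.le]
      have hBt := ENNReal.rpow_ne_top_of_nonneg ht.le hBp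
      rw [lintegral_const_mul' _ _ hBt]
      exact ENNReal.mul_lt_top hBt.lt_top h
    filter_upwards [ae_lt_top hGm hint] with ω hω
    exact (ENNReal.rpow_lt_top_iff_of_pos ht).1 hω
  tfae_finish

end Random

/-! ### The weights `μ_α` -/

lemma isFiniteMeasure_muMeasure {α : ℝ} (hα : -1 < α) : IsFiniteMeasure (muMeasure α) := by
  refine isFiniteMeasure_withDensity_ofReal (Integrable.hasFiniteIntegral ?_)
  have h := integrableOn_rpow_mul_exp_neg_mul_rpow hα one_pos two_pos
  refine (h.const_mul (2 ^ (α + 1) / Real.Gamma (α + 1))).congr (.of_forall fun σ => ?_)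
  simp only [Real.rpow_one]
  ring

lemma ae_nonneg_muMeasure (α : ℝ) : ∀ᵐ σ ∂muMeasure α, 0 ≤ σ := by
  refine (withDensity_absolutelyContinuous _ _).ae_le ?_
  filter_upwards [ae_restrict_mem measurableSet_Ioi] with σ hσ using (Set.mem_Ioi.1 hσ).le

lemma muMeasure_ne_zero {α : ℝ} (hα : -1 < α) : muMeasure α ≠ 0 := by
  intro h
  rw [muMeasure, withDensity_eq_zero_iff (by fun_prop)] at h
  have h2 : ∀ᵐ σ ∂(volume : Measure ℝ).restrict (Set.Ioi 0), False := by
    filter_upwards [h, ae_restrict_mem measurableSet_Ioi] with σ hσ hσ0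
    have hσ0 : 0 < σ := hσ0
    have : 0 < Real.Gamma (α + 1) := Real.Gamma_pos_of_pos (by linarith)
    exact (ENNReal.ofReal_pos.2 (by positivity)).ne' hσ
  rw [eventually_false_iff_eq_bot, ae_eq_bot, Measure.restrict_eq_zero, Real.volume_Ioi] at h2
  exact ENNReal.top_ne_zero h2

lemma translate_zero (P : ℕ+ →₀ ℂ) : translate 0 P = P := by
  ext n
  simp [translate]

lemma mixedPolyNorm_top (p α : ℝ) : mixedPolyNorm p ⊤ α = mixNorm p 1 (Measure.dirac 0) := by
  ext P
  simp [mixedPolyNorm, mixNorm, translate_zero]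

lemma mixedPolyNorm_of_ne_top (p α : ℝ) {q : ℝ≥0∞} (hq : q ≠ ⊤) :
    mixedPolyNorm p q α = mixNorm p q.toReal (muMeasure α) := by
  ext P
  simp [mixedPolyNorm, mixNorm, hq]

/-- The mixed norms are those of a finite measure on `[0, ∞)` and a finite exponent. -/
lemma exists_mixedPolyNorm_eq {q : ℝ≥0∞} (hq : 0 < q) {α : ℝ} (hα : -1 < α) :
    ∃ (q' : ℝ) (κ : Measure ℝ), 0 < q' ∧ IsFiniteMeasure κ ∧ (∀ᵐ σ ∂κ, 0 ≤ σ) ∧ κ ≠ 0 ∧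
      (min q 1).toReal ≤ q' ∧ ∀ p, mixedPolyNorm p q α = mixNorm p q' κ := by
  rcases eq_or_ne q ⊤ with rfl | hq'
  -- For `q = ∞` the `H^p` norm is the mixed norm of the point mass at `0`. Any finite exponent
  -- would do; `1` is the one compatible with `min(q, 1)`.
  · refine ⟨1, Measure.dirac 0, one_pos, inferInstance, ?_, NeZero.ne _, by simp,
      fun p => mixedPolyNorm_top p α⟩
    rw [ae_dirac_eq]
    exact le_refl (0 : ℝ)
  · refine ⟨q.toReal, muMeasure α, ENNReal.toReal_pos hq.ne' hq', isFiniteMeasure_muMeasure hα,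
      ae_nonneg_muMeasure α, muMeasure_ne_zero hα, ENNReal.toReal_mono hq' (min_le_left _ _),
      fun p => mixedPolyNorm_of_ne_top p α hq'⟩

lemma bergmanPolyNorm_eq {p : ℝ} (hp : 0 < p) (α : ℝ) :
    bergmanPolyNorm p α = mixedPolyNorm p (ENNReal.ofReal p) α := by
  ext P
  simp [bergmanPolyNorm, mixedPolyNorm, ENNReal.toReal_ofReal hp.le]

lemma hardyPolyNorm_eq (p α : ℝ) : hardyPolyNorm p = mixedPolyNorm p ⊤ α := by
  ext P
  simp [mixedPolyNorm]

lemma mixedSpace_two_top (α : ℝ) : mixedSpace 2 ⊤ α = hardyTwo := by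
  ext a
  rw [mixedSpace, mixedPolyNorm_top, mem_completionSpace_two_iff one_pos, sqNorm_dirac_lt_top_iff]
  rw [ae_dirac_eq]
  exact le_refl (0 : ℝ)

section Main

variable {Ω : Type*} [MeasurableSpace Ω] {μ : Measure Ω} [IsProbabilityMeasure μ]
  {X : ℕ+ → Ω → ℂ} {p : ℝ} {q : ℝ≥0∞} {α : ℝ}

theorem IsStandardRandomSequence.tfae_mixedNorm (hX : IsStandardRandomSequence X μ) (hp : 0 < p)
    (hq : 0 < q) (hα : -1 < α) (a : ℕ+ → ℂ) :
    List.TFAE [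
      ∀ᵐ ω ∂μ, randomize X a ω ∈ mixedSpace p q α,
      ∀ᵐ ω ∂μ, (⨆ N : ℕ+, mixedPolyNorm p q α (partialSum N (randomize X a ω))) < ⊤,
      ∃ t : ℝ, 0 < t ∧ ∫⁻ ω, mixedNorm p q α (randomize X a ω) ^ t ∂μ < ⊤,
      ∀ t : ℝ, 0 < t → ∫⁻ ω, mixedNorm p q α (randomize X a ω) ^ t ∂μ < ⊤,
      ∃ l : ℝ≥0, 0 < l ∧ ∫⁻ ω, EReal.exp (((l : ℝ≥0∞) * mixedNorm p q α (randomize X a ω) ^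
        (min (min (ENNReal.ofReal p) q) 1).toReal : ℝ≥0∞) : EReal) ∂μ < ⊤,
      a ∈ mixedSpace 2 q α] := by
  obtain ⟨q', κ, hq', hκfin, hκ, hκ0, hqq', hnorm⟩ := exists_mixedPolyNorm_eq hq hα
  -- The minimum with `1` is finite even when `q = ∞`, so the conversion to a real number loses
  -- nothing.
  have hr : 0 < (min (min (ENNReal.ofReal p) q) 1).toReal :=
    ENNReal.toReal_pos (lt_min (lt_min (ENNReal.ofReal_pos.2 hp) hq) one_pos).ne'
      (ne_top_of_le_ne_top ENNReal.one_ne_top (min_le_right _ _))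
  have hr1 : (min (min (ENNReal.ofReal p) q) 1).toReal ≤ 1 := by
    simpa using ENNReal.toReal_mono ENNReal.one_ne_top (min_le_right (min (ENNReal.ofReal p) q) 1)
  have hrp : (min (min (ENNReal.ofReal p) q) 1).toReal ≤ p := by
    refine (ENNReal.toReal_mono ENNReal.ofReal_ne_top ((min_le_left _ _).trans
      (min_le_left _ _))).trans (ENNReal.toReal_ofReal hp.le).le
  have hrq : (min (min (ENNReal.ofReal p) q) 1).toReal ≤ q' := by
    refine (ENNReal.toReal_mono (ne_top_of_le_ne_top ENNReal.one_ne_top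
        (min_le_right _ _)) ?_).trans
      hqq'
    exact le_min ((min_le_left _ _).trans (min_le_right _ _)) (min_le_right _ _)
  have := hX.tfae_mixNorm hr hr1 hrp hrq hκ hκ0 a
  rw [← mem_completionSpace_two_iff hq' hκ] at this
  simpa only [mixedSpace, mixedNorm, hnorm] using this

lemma mixedSpace_two_subset_dirichletSeries (hq : 0 < q) (hα : -1 < α) :
    mixedSpace 2 q α ⊆ dirichletSeries := by
  obtain ⟨q', κ, hq', hκfin, hκ, hκ0, -, hnorm⟩ := exists_mixedPolyNorm_eq hq hα
  intro a ha
  rw [mixedSpace, hnorm, mem_completionSpace_two_iff hq' hκ] at ha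
  exact mem_dirichletSeries_of_sqNorm_lt_top hq' hκ0 ha

/-- The symbol space also demands convergence in some half plane, which membership in `H^{2,q}`
provides. -/
theorem IsStandardRandomSequence.symbolSpace_mixedSpace (hX : IsStandardRandomSequence X μ)
    (hp : 0 < p) (hq : 0 < q) (hα : -1 < α) :
    symbolSpace X μ (mixedSpace p q α) = mixedSpace 2 q α := by
  ext a
  have h := (hX.tfae_mixedNorm hp hq hα a).out 0 5
  exact ⟨fun ha => h.1 ha.2, fun ha => ⟨mixedSpace_two_subset_dirichletSeries hq hα ha, h.2 ha⟩⟩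

end Main

end RandomDirichlet

end

theorem mainTheorem2 {Ω : Type*} [MeasurableSpace Ω] (μ : Measure Ω) [IsProbabilityMeasure μ]
    (X : ℕ+ → Ω → ℂ) (hX : RandomDirichlet.IsStandardRandomSequence X μ)
    (p : ℝ) (hp : 0 < p) (q : ℝ≥0∞) (hq : 0 < q) (α : ℝ) (hα : -1 < α) :
    (∀ a ∈ RandomDirichlet.dirichletSeries,
      List.TFAE [
        ∀ᵐ ω ∂μ, RandomDirichlet.randomize X a ω ∈ RandomDirichlet.mixedSpace p q α,
        ∀ᵐ ω ∂μ, (⨆ N : ℕ+, RandomDirichlet.mixedPolyNorm p q α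
          (RandomDirichlet.partialSum N (RandomDirichlet.randomize X a ω))) < ⊤,
        ∃ t : ℝ, 0 < t ∧
          ∫⁻ ω, RandomDirichlet.mixedNorm p q α (RandomDirichlet.randomize X a ω) ^ t ∂μ < ⊤,
        ∀ t : ℝ, 0 < t →
          ∫⁻ ω, RandomDirichlet.mixedNorm p q α (RandomDirichlet.randomize X a ω) ^ t ∂μ < ⊤,
        ∃ l : ℝ≥0, 0 < l ∧
          ∫⁻ ω, EReal.exp (((l : ℝ≥0∞) *
            RandomDirichlet.mixedNorm p q α (RandomDirichlet.randomize X a ω) ^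
              (min (min (ENNReal.ofReal p) q) 1).toReal : ℝ≥0∞) : EReal) ∂μ < ⊤,
        a ∈ RandomDirichlet.mixedSpace 2 q α]) ∧
    RandomDirichlet.symbolSpace X μ (RandomDirichlet.mixedSpace p q α) =
      RandomDirichlet.mixedSpace 2 q α ∧
    RandomDirichlet.symbolSpace X μ (RandomDirichlet.hardySpace p) = RandomDirichlet.hardyTwo ∧
    RandomDirichlet.symbolSpace X μ (RandomDirichlet.bergmanSpace p α) =
      RandomDirichlet.mixedSpace 2 (ENNReal.ofReal p) α := by
  refine ⟨fun a _ => hX.tfae_mixedNorm hp hq hα a, hX.symbolSpace_mixedSpace hp hq hα, ?_, ?_⟩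
  · rw [RandomDirichlet.hardySpace, RandomDirichlet.hardyPolyNorm_eq p α,
      ← RandomDirichlet.mixedSpace_two_top α]
    exact hX.symbolSpace_mixedSpace hp ENNReal.zero_lt_top hα
  · rw [RandomDirichlet.bergmanSpace, RandomDirichlet.bergmanPolyNorm_eq hp]
    exact hX.symbolSpace_mixedSpace hp (ENNReal.ofReal_pos.2 hp) hα
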